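/- Let $\nu$ be a measure on $\mathbb{R}$ with $\int e^{\eta a}\,\nu(da)<\infty$ for every $\eta\in\mathbb{R}$, put $b(\eta)=\log\int e^{\eta a}\,\nu(da)$, and consider the exponential family with densities $\exp(\eta a-b(\eta))$ with respect to $\nu$; the inverse canonical link is $L^{-1}=b'$. Fix integers $m,r\ge 0$ and constants $K_\theta,K_\beta,K_x,C_R$. For each $n$ let $\Theta=\Theta^{(n)}\in\mathbb{R}^{n\times n}$, $\beta=\beta^{(n)}\in\mathbb{R}^m$ and covariates $x_{ij}=x^{(n)}_{ij}\in\mathbb{R}^m$ ($1\le i,j\le n$) be deterministic and satisfy - $\max_{i,j}|\theta_{ij}|\le K_\theta$ and $\mathrm{rank}(\Theta)\le r$, - $\|\beta\|_2\le K_\beta$, - $\|x_{ij}\|_2\le K_x$ for all $i,j$. Write $\mathcal{X}\otimes\beta=[x_{ij}^\top\beta]_{ij}$. Let $A=A^{(n)}$ be a random $n\times n$ matrix with independent entries, where $A_{ij}$ has density $\exp(\eta_{ij}a-b(\eta_{ij}))$ with respect to $\nu$ with $\eta_{ij}=\theta_{ij}+x_{ij}^\top\beta$, and let $P=\mathbb{E}[A]$.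 Let the tuning parameter $R=R_n$ satisfy $\sqrt{r}\,nK_\theta\le R_n\le C_R\,n$ (for instance $R_n=\sqrt{r}\,nK_\theta$), and let $(\widetilde\Theta,\widetilde\beta)$ almost surely maximize the log-likelihood $$\sum_{i,j}\bigl(\eta_{ij}A_{ij}-b(\eta_{ij})\bigr),\qquad \eta_{ij}=\theta_{ij}+x_{ij}^\top\beta,$$ over all $(\Theta,\beta)$ with nuclear norm $\|\Theta\|_*\le R_n$ and $\|\beta\|_2\le K_\beta$. Put $\widetilde P=L^{-1}(\widetilde\Theta+\mathcal{X}\otimes\widetilde\beta)$, with $L^{-1}=b'$ applied entrywise. Then $$n^{-1}\|\widetilde P-P\|_F\longrightarrow 0\quad\text{in probability as } n\to\infty .$$ -/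

import Mathlib

open MeasureTheory ProbabilityTheory Filter Topology

namespace LowRankGLM

/-- The cumulant function `b(η) = log ∫ exp(η a) ν(da)` of the one-parameter exponential family
with base measure `ν` (in the notation `c(a) exp(η a - b(η))`, `ν(da)` is `c(a)` times Lebesgue or
counting measure; `b` is then the normalization). -/
noncomputable def cumulant (ν : Measure ℝ) (η : ℝ) : ℝ :=
  Real.log (∫ a, Real.exp (η * a) ∂ν)

/-- The member of the exponential family with canonical parameter `η`: it has density
`exp(η a - b(η))` with respect to `ν`. -/
noncomputable def expFamily (ν : Measure ℝ) (η : ℝ) : Measure ℝ :=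
  ν.withDensity fun a => ENNReal.ofReal (Real.exp (η * a - cumulant ν η))

/-- The inverse `g = b'` of the canonical link function. -/
noncomputable def invLink (ν : Measure ℝ) (η : ℝ) : ℝ :=
  deriv (cumulant ν) η

/-- The matrix of canonical parameters `η i j = θ i j + ⟨x i j, β⟩`. -/
def linearPredictor {n m : ℕ} (x : Fin n → Fin n → EuclideanSpace ℝ (Fin m))
    (Θ : Matrix (Fin n) (Fin n) ℝ) (β : EuclideanSpace ℝ (Fin m)) : Matrix (Fin n) (Fin n) ℝ :=
  Matrix.of fun i j => Θ i j + ∑ k, x i j k * β k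

/-- The log-likelihood of `(Θ, β)` given the adjacency matrix `A` and the covariates `x`,
with respect to the dominating measure `ν`; the summand `∑ log c(A i j)`, which does not depend on
`(Θ, β)`, is thereby absent. -/
noncomputable def logLikelihood (ν : Measure ℝ) {n m : ℕ}
    (x : Fin n → Fin n → EuclideanSpace ℝ (Fin m)) (A : Matrix (Fin n) (Fin n) ℝ)
    (q : Matrix (Fin n) (Fin n) ℝ × EuclideanSpace ℝ (Fin m)) : ℝ :=
  ∑ i, ∑ j, (linearPredictor x q.1 q.2 i j * A i j - cumulant ν (linearPredictor x q.1 q.2 i j))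

/-- The nuclear norm: the sum of the singular values. -/
noncomputable def nuclearNorm {n : ℕ} (M : Matrix (Fin n) (Fin n) ℝ) : ℝ :=
  ∑ k ∈ Finset.range n, (Matrix.toEuclideanLin M).singularValues k

/-- The Frobenius norm. -/
noncomputable def frobeniusNorm {n : ℕ} (M : Matrix (Fin n) (Fin n) ℝ) : ℝ :=
  Real.sqrt (∑ i, ∑ j, M i j ^ 2)

/-- The feasible set: nuclear norm of `Θ` at most `R`, Euclidean norm of `β` at most `Kβ`. -/
def feasible (n m : ℕ) (R Kβ : ℝ) : Set (Matrix (Fin n) (Fin n) ℝ × EuclideanSpace ℝ (Fin m)) :=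
  {q | nuclearNorm q.1 ≤ R ∧ ‖q.2‖ ≤ Kβ}

/-- `q = (Θ, β)` solves the nuclear-norm-constrained maximum likelihood problem. -/
def IsConstrainedMLE (ν : Measure ℝ) {n m : ℕ} (R Kβ : ℝ)
    (x : Fin n → Fin n → EuclideanSpace ℝ (Fin m)) (A : Matrix (Fin n) (Fin n) ℝ)
    (q : Matrix (Fin n) (Fin n) ℝ × EuclideanSpace ℝ (Fin m)) : Prop :=
  q ∈ feasible n m R Kβ ∧ IsMaxOn (logLikelihood ν x A) (feasible n m R Kβ) q

/-- The mean matrix `P = E[A]`. -/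
noncomputable def meanMatrix {Ω : Type*} [MeasurableSpace Ω] (μ : Measure Ω) {n : ℕ}
    (A : Ω → Matrix (Fin n) (Fin n) ℝ) : Matrix (Fin n) (Fin n) ℝ :=
  Matrix.of fun i j => ∫ ω, A ω i j ∂μ

/-- The estimated mean matrix `g(Θ + X ⊗ β)`, with `g` applied entrywise. -/
noncomputable def fittedMean (ν : Measure ℝ) {n m : ℕ}
    (x : Fin n → Fin n → EuclideanSpace ℝ (Fin m))
    (q : Matrix (Fin n) (Fin n) ℝ × EuclideanSpace ℝ (Fin m)) : Matrix (Fin n) (Fin n) ℝ :=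
  (linearPredictor x q.1 q.2).map (invLink ν)

end LowRankGLM

namespace LowRankGLM

/-! Write `H₀` for the true canonical parameters, `H` for the fitted ones, `Z = A - P` for the
noise, `D = b'(H) - b'(H₀)` for the error of the fitted means, `S = ⟨D, H - H₀⟩` for the symmetrized
divergence and `g = ⟨Z, H - H₀⟩`. The likelihood is concave, so first-order optimality tested at the
truth gives `S ≤ g`. Since `‖Z‖_op = O(√n)` and both nuclear norms are `O(n)`, duality yields `S =
O(n^{3/2})`. If `b'` were globally Lipschitz this would finish, because `‖D‖_F² ≤ Lip · S = o(n²)`.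
But `b'` may grow fast (as for Poisson data), and the constraint bounds the entries of the fitted
low-rank part only by `R = O(n)`.

Entries with `|H - H₀| ≤ B` are Lipschitz. For the others `|D i j| ≤ lam + ‖Z‖_op`, where `lam = ‖Z
- D‖_op` is the Lagrange multiplier of the nuclear norm constraint. Hence `‖D‖_F² ≤ (Lip_B + (lam +
‖Z‖_op) / B) S` (`frobeniusNorm_linkDiff_sq_le`), and it suffices to prove `lam · S = O(n²)`: then
`B` is taken large, and `n` large after it (`exists_frobeniusNorm_le_of_mul_le`).

If `lam = O(√n)` this is immediate. In general, comparing with a slightly shrunk truth gives `lam =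
O(n^{3/4})` (`IsStationary.opNorm_le_of_large_radius`). For `lam` in between, the estimator is
compared with the minimizer `p` of the noiseless divergence penalized at an integer level `l` near
`lam / 2`. This `p` is deterministic. Its gradient divided by `-l` is a contraction `G` with `‖G‖_F²
= O((g + err) / l)`, where `err` bounds the noise paired with the error of `p`; so the singular
values of `G` above `1/2` span deterministic subspaces `U`, `V` of small dimension. Off the block `U
× V` the noise can be added to `l G` at only second-order cost in the operator norm; on the block it
has size of the square root of the dimension, instead of `√n`. Solving the resulting inequality for
`g` gives `lam · g = O(n²)` (`IsStationary.matInner_noise_le`,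
`IsStationary.opNorm_mul_matInner_noise_le`). If the true low-rank part vanishes, `R` need not be of
order `n` and elementary arguments replace this one.

The probabilistic input is `IsNoise.measure_not_subspaceBound_le`: on fixed subspaces of dimension
at most `k ≥ L⁴`, with `L` of order `log n`, the noise has norm `O(√k)`. The entries are only
sub-exponential, so a plain net argument fails. Net vectors are split into large and small
coordinates. Pairs of small coordinates follow Kahn–Szemerédi: light pairs by Chernoff, heavy pairs
by a discrepancy bound over rectangles. Large coordinates are sparse and are handled by a
Hanson–Wright bound. The full space gives the operator norm, and a union bound over the `n` levels
gives the subspaces. -/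

/-- The trace inner product of two matrices. -/
noncomputable def matInner {n : ℕ} (Y T : Matrix (Fin n) (Fin n) ℝ) : ℝ := ∑ i, ∑ j, Y i j * T i j

/-- The bilinear form of a matrix. -/
noncomputable def bilin {n : ℕ} (Y : Matrix (Fin n) (Fin n) ℝ) (u v : EuclideanSpace ℝ (Fin n)) :
    ℝ := ∑ i, ∑ j, u i * Y i j * v j

/-- The operator norm for the Euclidean norms. -/
noncomputable def opNorm {n : ℕ} (Y : Matrix (Fin n) (Fin n) ℝ) : ℝ :=
  ‖LinearMap.toContinuousLinearMap (Matrix.toEuclideanLin Y)‖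

/-! ### Duality of the nuclear and operator norms -/

section LinearAlgebra

variable {n : ℕ} (Y T : Matrix (Fin n) (Fin n) ℝ) (u v : EuclideanSpace ℝ (Fin n))

theorem toEuclideanLin_coord (i : Fin n) :
    Matrix.toEuclideanLin Y v i = ∑ j, Y i j * v j := by
  simp [Matrix.toLpLin_apply, Matrix.mulVec, dotProduct]

theorem bilin_eq_inner : bilin Y u v = inner ℝ u (Matrix.toEuclideanLin Y v) := by
  simp only [bilin, PiLp.inner_apply, toEuclideanLin_coord, RCLike.inner_apply, conj_trivial]
  refine Finset.sum_congr rfl fun i _ => ?_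
  rw [Finset.sum_mul]
  exact Finset.sum_congr rfl fun j _ => by ring

theorem opNorm_nonneg : 0 ≤ opNorm Y := norm_nonneg _

theorem norm_apply_le_opNorm : ‖Matrix.toEuclideanLin Y v‖ ≤ opNorm Y * ‖v‖ :=
  (LinearMap.toContinuousLinearMap (Matrix.toEuclideanLin Y)).le_opNorm v

theorem bilin_le_opNorm : bilin Y u v ≤ opNorm Y * ‖u‖ * ‖v‖ := by
  rw [bilin_eq_inner]
  calc _ ≤ ‖u‖ * ‖Matrix.toEuclideanLin Y v‖ := real_inner_le_norm _ _
    _ ≤ ‖u‖ * (opNorm Y * ‖v‖) := by gcongr; exact norm_apply_le_opNorm Y v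
    _ = _ := by ring

variable {Y} in
theorem norm_apply_le_of_bilin_le {c : ℝ} (h : ∀ u v, bilin Y u v ≤ c * ‖u‖ * ‖v‖)
    (v : EuclideanSpace ℝ (Fin n)) : ‖Matrix.toEuclideanLin Y v‖ ≤ c * ‖v‖ := by
  have h1 := h (Matrix.toEuclideanLin Y v) v
  rw [bilin_eq_inner, real_inner_self_eq_norm_sq] at h1
  -- No sign of `c` is assumed. If `Y v = 0` with `v ≠ 0`, testing the form on `(v, v)` forces `c ≥
  -- 0`; otherwise one cancels `‖Y v‖`.
  rcases (norm_nonneg (Matrix.toEuclideanLin Y v)).eq_or_lt with h0 | h0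
  · by_contra! hc
    rw [← h0] at hc
    have hv : 0 < ‖v‖ := by
      rcases (norm_nonneg v).eq_or_lt with h2 | h2
      · rw [← h2] at hc; simp at hc
      · exact h2
    have := h v v
    have h3 := h (-v) v
    rw [bilin_eq_inner] at this h3
    have h4 : Matrix.toEuclideanLin Y v = 0 := norm_eq_zero.1 h0.symm
    rw [h4] at this
    simp only [inner_zero_right] at this
    nlinarith
  · refine le_of_mul_le_mul_left ?_ h0
    nlinarith

variable {Y} in
theorem opNorm_le {c : ℝ} (hc : 0 ≤ c) (h : ∀ u v, bilin Y u v ≤ c * ‖u‖ * ‖v‖) : opNorm Y ≤ c :=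
  ContinuousLinearMap.opNorm_le_bound _ hc fun v => norm_apply_le_of_bilin_le h v

/-- Parseval in each row: the trace `tr(Yᵀ T)` may be computed in any orthonormal basis, in
particular in the singular basis of `T`. -/
theorem matInner_eq_sum (e : OrthonormalBasis (Fin n) ℝ (EuclideanSpace ℝ (Fin n))) :
    matInner Y T
      = ∑ k, inner ℝ (Matrix.toEuclideanLin Y (e k)) (Matrix.toEuclideanLin T (e k)) := by
  have key : ∀ i, ∑ j, Y i j * T i j
      = ∑ k, Matrix.toEuclideanLin Y (e k) i * Matrix.toEuclideanLin T (e k) i := by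
    intro i
    have h := e.sum_inner_mul_inner (WithLp.toLp 2 (Y i)) (WithLp.toLp 2 (T i))
    simp only [PiLp.inner_apply, RCLike.inner_apply, conj_trivial] at h
    simp only [toEuclideanLin_coord]
    calc _ = ∑ j, T i j * Y i j := Finset.sum_congr rfl fun j _ => by ring
      _ = _ := h.symm
      _ = _ := by
        refine Finset.sum_congr rfl fun k _ => ?_
        congr 1
        exact Finset.sum_congr rfl fun j _ => by ring
  simp only [matInner, key, PiLp.inner_apply, RCLike.inner_apply, conj_trivial]
  rw [Finset.sum_comm]
  exact Finset.sum_congr rfl fun _ _ => Finset.sum_congr rfl fun _ _ => by ring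

/-- A singular value decomposition: an orthonormal basis with orthogonal images. -/
theorem exists_singularBasis :
    ∃ e : OrthonormalBasis (Fin n) ℝ (EuclideanSpace ℝ (Fin n)),
      (∀ i j, i ≠ j → inner ℝ (Matrix.toEuclideanLin T (e i)) (Matrix.toEuclideanLin T (e j)) = 0) ∧
      nuclearNorm T = ∑ i, ‖Matrix.toEuclideanLin T (e i)‖ := by
  set L := Matrix.toEuclideanLin T with hL
  have hn : Module.finrank ℝ (EuclideanSpace ℝ (Fin n)) = n := by simp
  have hS := L.isSymmetric_adjoint_comp_self
  set e := hS.eigenvectorBasis hn with he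
  -- The eigenbasis of `T* T` has orthogonal images, and the squared lengths of these are the
  -- eigenvalues.
  have hin : ∀ i j, inner ℝ (L (e i)) (L (e j)) = hS.eigenvalues hn j * inner ℝ (e i) (e j) := by
    intro i j
    rw [← LinearMap.adjoint_inner_right]
    have := hS.apply_eigenvectorBasis hn j
    rw [LinearMap.comp_apply] at this
    rw [← he] at this
    rw [this]
    simp [inner_smul_right]
  have hnorm : ∀ i, ‖L (e i)‖ = L.singularValues i := by
    intro i
    rw [L.singularValues_fin hn]
    have h1 := hin i i
    rw [real_inner_self_eq_norm_sq, real_inner_self_eq_norm_sq, e.orthonormal.1 i] at h1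
    rw [← Real.sqrt_sq (norm_nonneg (L (e i))), h1]
    simp
  refine ⟨e, ?_, ?_⟩
  · intro i j hij
    rw [hin, e.orthonormal.2 hij, mul_zero]
  · rw [nuclearNorm, Finset.sum_range]
    exact Finset.sum_congr rfl fun i _ => (hnorm i).symm

theorem nuclearNorm_nonneg : 0 ≤ nuclearNorm T :=
  Finset.sum_nonneg fun _ _ => LinearMap.singularValues_nonneg _ _

/-- Evaluate the trace in the singular basis of `T`. The hypothesis is stated on the form rather
than on `opNorm`, so that dual certificates can be used directly. -/
theorem matInner_le_nuclearNorm {c : ℝ} (h : ∀ u v, bilin Y u v ≤ c * ‖u‖ * ‖v‖) :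
    matInner Y T ≤ c * nuclearNorm T := by
  obtain ⟨e, -, hN⟩ := exists_singularBasis T
  rw [matInner_eq_sum Y T e, hN, Finset.mul_sum]
  refine Finset.sum_le_sum fun k _ => ?_
  calc _ ≤ ‖Matrix.toEuclideanLin Y (e k)‖ * ‖Matrix.toEuclideanLin T (e k)‖ :=
        real_inner_le_norm _ _
    _ ≤ c * ‖e k‖ * ‖Matrix.toEuclideanLin T (e k)‖ := by
        gcongr; exact norm_apply_le_of_bilin_le h _
    _ = _ := by rw [e.orthonormal.1 k, mul_one]

theorem matInner_le_opNorm_mul : matInner Y T ≤ opNorm Y * nuclearNorm T :=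
  matInner_le_nuclearNorm Y T (bilin_le_opNorm Y)

/-- The nuclear norm is attained by pairing with a contraction. -/
theorem exists_dual_certificate :
    ∃ Y : Matrix (Fin n) (Fin n) ℝ, (∀ u v, bilin Y u v ≤ 1 * ‖u‖ * ‖v‖) ∧
      matInner Y T = nuclearNorm T := by
  obtain ⟨e, horth, hN⟩ := exists_singularBasis T
  set L := Matrix.toEuclideanLin T with hL
  -- The isometric factor of the polar decomposition. With `0⁻¹ = 0`, basis vectors in the kernel
  -- are sent to `0`.
  let K : EuclideanSpace ℝ (Fin n) →ₗ[ℝ] EuclideanSpace ℝ (Fin n) :=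
    e.toBasis.constr ℝ fun i => ‖L (e i)‖⁻¹ • L (e i)
  have hK : ∀ i, K (e i) = ‖L (e i)‖⁻¹ • L (e i) := by
    intro i
    have := e.toBasis.constr_basis ℝ (fun i => ‖L (e i)‖⁻¹ • L (e i)) i
    rwa [OrthonormalBasis.coe_toBasis] at this
  refine ⟨Matrix.toEuclideanLin.symm K, ?_, ?_⟩
  · intro u v
    rw [bilin_eq_inner, LinearEquiv.apply_symm_apply, one_mul]
    refine (real_inner_le_norm _ _).trans ?_
    gcongr
    have h1 : K v = ∑ i, inner ℝ (e i) v • K (e i) := by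
      conv_lhs => rw [← e.sum_repr' v]
      simp
    have h2 : ‖K v‖ ^ 2 ≤ ‖v‖ ^ 2 := by
      rw [← real_inner_self_eq_norm_sq, h1, sum_inner]
      rw [← e.sum_sq_norm_inner_right v]
      refine Finset.sum_le_sum fun i _ => ?_
      rw [inner_sum, Finset.sum_eq_single i]
      · rw [inner_smul_left, inner_smul_right, hK, real_inner_self_eq_norm_sq, norm_smul]
        simp only [norm_inv, conj_trivial, Real.norm_eq_abs, sq_abs]
        have : (|‖L (e i)‖|⁻¹ * ‖L (e i)‖) ^ 2 ≤ 1 := by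
          rcases eq_or_ne ‖L (e i)‖ 0 with h0 | h0
          · simp [h0]
          · simp [abs_of_nonneg, inv_mul_cancel₀ h0]
        nlinarith [sq_nonneg (inner ℝ (e i) v : ℝ)]
      · intro j _ hji
        rw [inner_smul_left, inner_smul_right, hK, hK, inner_smul_left, inner_smul_right,
          horth i j hji.symm]
        simp
      · simp
    exact (sq_le_sq₀ (norm_nonneg _) (norm_nonneg _)).1 h2
  · rw [matInner_eq_sum _ T e, hN]
    refine Finset.sum_congr rfl fun i _ => ?_
    rw [LinearEquiv.apply_symm_apply, hK, inner_smul_left, real_inner_self_eq_norm_sq]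
    simp only [conj_trivial]
    rcases eq_or_ne ‖L (e i)‖ 0 with h0 | h0
    · rw [h0]; simp
    · field_simp

theorem matInner_add_right (Y A B : Matrix (Fin n) (Fin n) ℝ) :
    matInner Y (A + B) = matInner Y A + matInner Y B := by
  simp [matInner, mul_add, Finset.sum_add_distrib]

theorem matInner_sub_right (Y A B : Matrix (Fin n) (Fin n) ℝ) :
    matInner Y (A - B) = matInner Y A - matInner Y B := by
  simp [matInner, mul_sub, Finset.sum_sub_distrib]

theorem matInner_smul_right (c : ℝ) (Y A : Matrix (Fin n) (Fin n) ℝ) :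
    matInner Y (c • A) = c * matInner Y A := by
  simp only [matInner, Finset.mul_sum, Matrix.smul_apply, smul_eq_mul]
  exact Finset.sum_congr rfl fun _ _ => Finset.sum_congr rfl fun _ _ => by ring

theorem matInner_comm (A B : Matrix (Fin n) (Fin n) ℝ) : matInner A B = matInner B A := by
  simp only [matInner]
  exact Finset.sum_congr rfl fun _ _ => Finset.sum_congr rfl fun _ _ => by ring

theorem matInner_add_left (Y A B : Matrix (Fin n) (Fin n) ℝ) :
    matInner (A + B) Y = matInner A Y + matInner B Y := by
  rw [matInner_comm, matInner_add_right, matInner_comm, matInner_comm Y B]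

theorem matInner_sub_left (Y A B : Matrix (Fin n) (Fin n) ℝ) :
    matInner (A - B) Y = matInner A Y - matInner B Y := by
  rw [matInner_comm, matInner_sub_right, matInner_comm, matInner_comm Y B]

theorem matInner_smul_left (c : ℝ) (Y A : Matrix (Fin n) (Fin n) ℝ) :
    matInner (c • A) Y = c * matInner A Y := by
  rw [matInner_comm, matInner_smul_right, matInner_comm]

theorem matInner_self : matInner T T = frobeniusNorm T ^ 2 := by
  have h : 0 ≤ ∑ i, ∑ j, T i j ^ 2 :=
    Finset.sum_nonneg fun _ _ => Finset.sum_nonneg fun _ _ => sq_nonneg _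
  refine Eq.trans ?_ (Real.sq_sqrt h).symm
  simp [matInner, sq]

theorem frobeniusNorm_nonneg : 0 ≤ frobeniusNorm T := Real.sqrt_nonneg _

/-- By duality the nuclear norm is a maximum of linear functionals; pairing the certificate of the
sum with each summand suffices. -/
theorem nuclearNorm_add_le (A B : Matrix (Fin n) (Fin n) ℝ) :
    nuclearNorm (A + B) ≤ nuclearNorm A + nuclearNorm B := by
  obtain ⟨Y, hY, h⟩ := exists_dual_certificate (A + B)
  rw [← h, matInner_add_right]
  have h1 := matInner_le_nuclearNorm Y A hY
  have h2 := matInner_le_nuclearNorm Y B hY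
  linarith

theorem nuclearNorm_smul_of_nonneg {c : ℝ} (hc : 0 ≤ c) :
    nuclearNorm (c • T) = c * nuclearNorm T := by
  apply le_antisymm
  · obtain ⟨Y, hY, h⟩ := exists_dual_certificate (c • T)
    rw [← h, matInner_smul_right]
    have h1 := matInner_le_nuclearNorm Y T hY
    rw [one_mul] at h1
    gcongr
  · obtain ⟨Y, hY, h⟩ := exists_dual_certificate T
    have h1 := matInner_le_nuclearNorm Y (c • T) hY
    rw [matInner_smul_right, h, one_mul] at h1
    exact h1

theorem nuclearNorm_neg : nuclearNorm (-T) = nuclearNorm T := by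
  have key : ∀ S : Matrix (Fin n) (Fin n) ℝ, nuclearNorm (-S) ≤ nuclearNorm S := by
    intro S
    obtain ⟨Y, hY, h⟩ := exists_dual_certificate (-S)
    have h1 := matInner_le_nuclearNorm (-Y) S (c := 1) (fun u v => by
      have := hY (-u) v
      simpa [bilin, Finset.sum_neg_distrib] using this)
    have h2 : matInner (-Y) S = matInner Y (-S) := by simp [matInner]
    rw [← h, ← h2]; linarith
  refine le_antisymm (key T) ?_
  simpa using key (-T)

theorem nuclearNorm_zero : nuclearNorm (0 : Matrix (Fin n) (Fin n) ℝ) = 0 := by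
  have := nuclearNorm_smul_of_nonneg (0 : Matrix (Fin n) (Fin n) ℝ) le_rfl
  simpa using this

theorem nuclearNorm_convex (A B : Matrix (Fin n) (Fin n) ℝ) {t : ℝ} (h0 : 0 ≤ t) (h1 : t ≤ 1) :
    nuclearNorm ((1 - t) • A + t • B) ≤ (1 - t) * nuclearNorm A + t * nuclearNorm B := by
  refine (nuclearNorm_add_le _ _).trans ?_
  rw [nuclearNorm_smul_of_nonneg _ (by linarith), nuclearNorm_smul_of_nonneg _ h0]

theorem matInner_vecMulVec : matInner Y (Matrix.of fun i j => u i * v j) = bilin Y u v := by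
  simp only [matInner, bilin, Matrix.of_apply]
  exact Finset.sum_congr rfl fun _ _ => Finset.sum_congr rfl fun _ _ => by ring

theorem nuclearNorm_vecMulVec_le :
    nuclearNorm (Matrix.of fun i j => u i * v j : Matrix (Fin n) (Fin n) ℝ) ≤ ‖u‖ * ‖v‖ := by
  obtain ⟨Y, hY, h⟩ := exists_dual_certificate (Matrix.of fun i j => u i * v j)
  rw [← h, matInner_vecMulVec]
  simpa using hY u v

theorem sq_frobeniusNorm_eq_sum (e : OrthonormalBasis (Fin n) ℝ (EuclideanSpace ℝ (Fin n))) :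
    frobeniusNorm T ^ 2 = ∑ k, ‖Matrix.toEuclideanLin T (e k)‖ ^ 2 := by
  rw [← matInner_self, matInner_eq_sum T T e]
  simp

theorem opNorm_le_frobeniusNorm : opNorm T ≤ frobeniusNorm T := by
  refine opNorm_le (frobeniusNorm_nonneg T) fun u v => ?_
  have h1 : bilin T u v = ∑ p : Fin n × Fin n, T p.1 p.2 * (u p.1 * v p.2) := by
    rw [Fintype.sum_prod_type]
    exact Finset.sum_congr rfl fun _ _ => Finset.sum_congr rfl fun _ _ => by ring
  rw [h1]
  refine (Real.sum_mul_le_sqrt_mul_sqrt _ _ _).trans (le_of_eq ?_)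
  have h2 : ∑ p : Fin n × Fin n, (u p.1 * v p.2) ^ 2 = (‖u‖ * ‖v‖) ^ 2 := by
    rw [mul_pow, EuclideanSpace.norm_sq_eq, EuclideanSpace.norm_sq_eq, Fintype.sum_prod_type,
      Finset.sum_mul_sum]
    exact Finset.sum_congr rfl fun _ _ => Finset.sum_congr rfl fun _ _ => by simp [mul_pow]
  rw [h2, Real.sqrt_sq (by positivity), Fintype.sum_prod_type, frobeniusNorm]
  ring

/-- Duality with `Y = T` gives `‖T‖_F² ≤ ‖T‖_op ‖T‖_*`, and `‖T‖_op ≤ ‖T‖_F`. -/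
theorem frobeniusNorm_le_nuclearNorm : frobeniusNorm T ≤ nuclearNorm T := by
  have h := matInner_le_opNorm_mul T T
  rw [matInner_self] at h
  rcases (frobeniusNorm_nonneg T).eq_or_lt with h0 | h0
  · rw [← h0]; exact nuclearNorm_nonneg T
  · have := mul_le_mul_of_nonneg_right (opNorm_le_frobeniusNorm T) (nuclearNorm_nonneg T)
    refine le_of_mul_le_mul_left ?_ h0
    nlinarith

theorem abs_apply_le_frobeniusNorm (i j : Fin n) : |T i j| ≤ frobeniusNorm T := by
  rw [← Real.sqrt_sq_eq_abs]
  refine Real.sqrt_le_sqrt ?_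
  refine (Finset.single_le_sum (f := fun j => T i j ^ 2) (fun _ _ => sq_nonneg _)
    (Finset.mem_univ j)).trans ?_
  exact Finset.single_le_sum (f := fun i => ∑ j, T i j ^ 2)
    (fun _ _ => Finset.sum_nonneg fun _ _ => sq_nonneg _) (Finset.mem_univ i)

/-- The nonzero images of a singular basis are orthogonal, hence independent, so there are at most
`rank T` of them; then Cauchy–Schwarz. -/
theorem nuclearNorm_le_sqrt_rank : nuclearNorm T ≤ √(T.rank) * frobeniusNorm T := by
  classical
  obtain ⟨e, horth, hN⟩ := exists_singularBasis T
  set L := Matrix.toEuclideanLin T with hL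
  set s := Finset.univ.filter fun i => L (e i) ≠ 0 with hs
  have hcard : s.card ≤ T.rank := by
    have hr : T.rank = Module.finrank ℝ L.range := by
      rw [Matrix.rank_eq_finrank_range_toLin T (EuclideanSpace.basisFun (Fin n) ℝ).toBasis
        (EuclideanSpace.basisFun (Fin n) ℝ).toBasis, hL, Matrix.toEuclideanLin_eq_toLin_orthonormal]
    have hli : LinearIndependent ℝ fun i : s => (⟨L (e i), e i, rfl⟩ : L.range) := by
      refine LinearIndependent.of_comp L.range.subtype ?_
      refine linearIndependent_of_ne_zero_of_inner_eq_zero (𝕜 := ℝ) ?_ ?_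
      · intro i
        exact (Finset.mem_filter.1 i.2).2
      · intro i j hij
        exact horth i j fun h => hij (Subtype.ext h)
    have := hli.fintype_card_le_finrank
    rw [hr]
    simpa using this
  have h1 : ∑ i, ‖L (e i)‖ = ∑ i ∈ s, 1 * ‖L (e i)‖ := by
    simp only [one_mul]
    refine (Finset.sum_subset (Finset.subset_univ s) fun i _ hi => ?_).symm
    simpa [hs] using hi
  rw [hN, h1]
  refine (Real.sum_mul_le_sqrt_mul_sqrt _ _ _).trans ?_
  gcongr
  · simpa using hcard
  · rw [← Real.sqrt_sq (frobeniusNorm_nonneg T), sq_frobeniusNorm_eq_sum T e]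
    exact Real.sqrt_le_sqrt (Finset.sum_le_sum_of_subset_of_nonneg (Finset.subset_univ s)
      fun _ _ _ => sq_nonneg _)

end LinearAlgebra

/-! ### The cumulant function and the exponential family -/

section Cumulant

variable {ν : Measure ℝ}

theorem cumulant_eq_cgf (ν : Measure ℝ) : cumulant ν = cgf id ν := by
  ext η
  simp [cumulant, cgf, mgf]

theorem interior_integrableExpSet_id (hν : ∀ η : ℝ, Integrable (fun a : ℝ => Real.exp (η * a)) ν)
    (t : ℝ) : t ∈ interior (integrableExpSet id ν) := by
  have : integrableExpSet id ν = Set.univ := by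
    ext s
    simpa [integrableExpSet] using hν s
  simp [this]

theorem contDiff_cumulant (hν : ∀ η : ℝ, Integrable (fun a : ℝ => Real.exp (η * a)) ν) :
    ContDiff ℝ 2 (cumulant ν) := by
  rw [cumulant_eq_cgf, contDiff_iff_contDiffAt]
  intro t
  exact (analyticAt_cgf (interior_integrableExpSet_id hν t)).contDiffAt

/-- The second derivative of the cumulant is a variance under the tilted measure. -/
theorem monotone_invLink (hν : ∀ η : ℝ, Integrable (fun a : ℝ => Real.exp (η * a)) ν) :
    Monotone (deriv (cumulant ν)) := by
  have h2 : ContDiff ℝ 1 (deriv (cumulant ν)) :=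
    (contDiff_succ_iff_deriv (n := 1).1 (contDiff_cumulant hν)).2.2
  refine monotone_of_deriv_nonneg (h2.differentiable (by norm_num)) fun t => ?_
  have h := iteratedDeriv_two_cgf_eq_integral (interior_integrableExpSet_id hν t)
  rw [iteratedDeriv_succ, iteratedDeriv_one] at h
  rw [cumulant_eq_cgf, h]
  exact div_nonneg (integral_nonneg fun ω => by positivity) mgf_nonneg

/-- Makes the theory of exponentially tilted measures available; for `ν = 0` both sides vanish. -/
theorem expFamily_eq_tilted (hν : ∀ η : ℝ, Integrable (fun a : ℝ => Real.exp (η * a)) ν) (η : ℝ) :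
    expFamily ν η = ν.tilted (fun a => η * id a) := by
  rcases eq_zero_or_neZero ν with rfl | hμ
  · simp [expFamily]
  · unfold expFamily Measure.tilted
    congr 1
    ext a
    congr 1
    rw [Real.exp_sub, cumulant, Real.exp_log]
    · simp
    · exact integral_exp_pos (hν η)

theorem integral_id_expFamily (hν : ∀ η : ℝ, Integrable (fun a : ℝ => Real.exp (η * a)) ν)
    (η : ℝ) : ∫ a, a ∂(expFamily ν η) = deriv (cumulant ν) η := by
  rw [expFamily_eq_tilted hν, cumulant_eq_cgf]
  exact integral_tilted_mul_self (interior_integrableExpSet_id hν η)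

theorem integrable_exp_expFamily (hν : ∀ η : ℝ, Integrable (fun a : ℝ => Real.exp (η * a)) ν)
    (η t : ℝ) : Integrable (fun a => Real.exp (t * a)) (expFamily ν η) := by
  rw [expFamily_eq_tilted hν, integrable_tilted_iff (by simpa using hν η)]
  refine (hν (η + t)).congr (ae_of_all _ fun a => ?_)
  simp [← Real.exp_add]
  ring

theorem integral_exp_expFamily (hν : ∀ η : ℝ, Integrable (fun a : ℝ => Real.exp (η * a)) ν)
    (hν0 : ν ≠ 0) (η t : ℝ) : ∫ a, Real.exp (t * a) ∂(expFamily ν η) =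
      Real.exp (cumulant ν (η + t) - cumulant ν η) := by
  have := NeZero.mk hν0
  rw [expFamily_eq_tilted hν, integral_tilted, Real.exp_sub, cumulant, cumulant, Real.exp_log,
    Real.exp_log (integral_exp_pos (hν η)), ← integral_div]
  · refine integral_congr_ae (ae_of_all _ fun a => ?_)
    simp only [id, smul_eq_mul, add_mul, Real.exp_add]
    ring
  · exact integral_exp_pos (hν _)

end Cumulant

/-! ### Convexity, Bregman divergence and the sub-exponential bound -/

section ConvexFunction

variable {b : ℝ → ℝ}

theorem tangent_le (hb : Differentiable ℝ b) (hm : Monotone (deriv b)) (s t : ℝ) :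
    deriv b s * (t - s) ≤ b t - b s := by
  have hc : ConvexOn ℝ Set.univ b := hm.convexOn_univ_of_deriv hb
  rcases lt_trichotomy s t with h | h | h
  · have := hc.le_slope_of_hasDerivAt (Set.mem_univ s) (Set.mem_univ t) h (hb s).hasDerivAt
    rw [slope_def_field, le_div_iff₀ (by linarith)] at this
    exact this
  · simp [h]
  · have := hc.slope_le_of_hasDerivAt (Set.mem_univ t) (Set.mem_univ s) h (hb s).hasDerivAt
    rw [slope_def_field, div_le_iff₀ (by linarith)] at this
    linarith

theorem bregman_le (hb : Differentiable ℝ b) (hm : Monotone (deriv b)) (s t : ℝ) :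
    b t - b s - deriv b s * (t - s) ≤ (deriv b t - deriv b s) * (t - s) := by
  have := tangent_le hb hm t s
  linarith

theorem exists_lipschitz_deriv (hb : ContDiff ℝ 2 b) (K : ℝ) :
    ∃ C : ℝ, 0 ≤ C ∧ ∀ s t, |s| ≤ K → |t| ≤ K → |deriv b t - deriv b s| ≤ C * |t - s| := by
  have h1 : ContDiff ℝ 1 (deriv b) := (contDiff_succ_iff_deriv (n := 1).1 hb).2.2
  obtain ⟨C, hC⟩ := (h1.locallyLipschitz.locallyLipschitzOn.exists_lipschitzOnWith_of_compact
    (isCompact_Icc (a := -K) (b := K)))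
  refine ⟨C, C.2, fun s t hs ht => ?_⟩
  simpa [Real.dist_eq] using hC.dist_le_mul t (abs_le.1 ht) s (abs_le.1 hs)

/-- The logarithm of the centred moment generating function is the Bregman divergence `b (η + t) - b
η - t b' η`. For `|t| ≤ 1` it is quadratic in `t`, uniformly over `|η| ≤ K`, because `b'` is
Lipschitz on `[-K - 1, K + 1]`. -/
theorem exists_centered_mgf_bound {ν : Measure ℝ}
    (hν : ∀ η : ℝ, Integrable (fun a : ℝ => Real.exp (η * a)) ν) (hν0 : ν ≠ 0) (K : ℝ) :
    ∃ c : ℝ, 1 ≤ c ∧ ∀ η t, |η| ≤ K → |t| ≤ 1 →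
      ∫ a, Real.exp (t * (a - deriv (cumulant ν) η)) ∂(expFamily ν η) ≤ Real.exp (c * t ^ 2) := by
  obtain ⟨C, hC0, hC⟩ := exists_lipschitz_deriv (contDiff_cumulant hν) (K + 1)
  refine ⟨C + 1, by linarith, fun η t hη ht => ?_⟩
  have hd := (contDiff_cumulant hν).differentiable (by norm_num)
  have h1 := bregman_le hd (monotone_invLink hν) η (η + t)
  have h2 := hC η (η + t) (by linarith) ((abs_add_le _ _).trans (by linarith))
  have h3 : (deriv (cumulant ν) (η + t) - deriv (cumulant ν) η) * (η + t - η) ≤ C * t ^ 2 := by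
    refine (le_abs_self _).trans ?_
    rw [abs_mul]
    calc _ ≤ C * |η + t - η| * |η + t - η| := by gcongr
      _ = C * t ^ 2 := by rw [mul_assoc, ← abs_mul, abs_of_nonneg (mul_self_nonneg _)]; ring
  have h4 : ∀ a, Real.exp (t * (a - deriv (cumulant ν) η)) =
      Real.exp (-(t * deriv (cumulant ν) η)) * Real.exp (t * a) := fun a => by
    rw [← Real.exp_add]; ring_nf
  simp_rw [h4]
  rw [integral_const_mul, integral_exp_expFamily hν hν0, ← Real.exp_add]
  apply Real.exp_le_exp.2
  nlinarith [sq_nonneg t]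

end ConvexFunction

/-! ### Sums of independent sub-exponential variables -/

/-- Independent, measurable random variables that are centred and sub-exponential: the moment
generating functions are finite everywhere and at most `exp (c t ^ 2)` for `|t| ≤ 1`. -/
structure IsNoise {ι Ω : Type*} [MeasurableSpace Ω] (μ : Measure Ω) (c : ℝ) (Z : ι → Ω → ℝ) :
    Prop where
  measurable : ∀ p, Measurable (Z p)
  indep : iIndepFun Z μ
  integrable_exp : ∀ p t, Integrable (fun ω => Real.exp (t * Z p ω)) μ
  mgf_le : ∀ p t, |t| ≤ 1 → mgf (Z p) μ t ≤ Real.exp (c * t ^ 2)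

namespace IsNoise

variable {ι Ω : Type*} [MeasurableSpace Ω] {μ : Measure Ω} [IsProbabilityMeasure μ] {c : ℝ}
  {Z : ι → Ω → ℝ}

theorem mgf_sum_le (hZ : IsNoise μ c Z) (I : Finset ι) (W : ι → ℝ) (s : ℝ)
    (hs : ∀ p ∈ I, |s * W p| ≤ 1) :
    mgf (fun ω => ∑ p ∈ I, W p * Z p ω) μ s ≤ Real.exp (c * s ^ 2 * ∑ p ∈ I, W p ^ 2) := by
  have hind : iIndepFun (fun p ω => W p * Z p ω) μ :=
    hZ.indep.comp (fun p z => W p * z) (fun p => by fun_prop)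
  have hmeas : ∀ p, Measurable (fun ω => W p * Z p ω) := fun p =>
    (hZ.measurable p).const_mul _
  have h := hind.mgf_sum (t := s) hmeas I
  have hfun : (fun ω => ∑ p ∈ I, W p * Z p ω) = ∑ p ∈ I, fun ω => W p * Z p ω := by
    ext ω; simp
  rw [hfun, h, Finset.mul_sum, Real.exp_sum]
  refine Finset.prod_le_prod (fun p _ => mgf_nonneg) fun p hp => ?_
  have h1 : mgf (fun ω => W p * Z p ω) μ s = mgf (Z p) μ (s * W p) := by
    simp [mgf, mul_assoc]
  rw [h1]
  refine (hZ.mgf_le p _ (hs p hp)).trans (le_of_eq ?_)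
  congr 1; ring

theorem integrable_exp_sum (hZ : IsNoise μ c Z) (I : Finset ι) (W : ι → ℝ) (s : ℝ) :
    Integrable (fun ω => Real.exp (s * ∑ p ∈ I, W p * Z p ω)) μ := by
  have hind : iIndepFun (fun p ω => W p * Z p ω) μ :=
    hZ.indep.comp (fun p z => W p * z) (fun p => by fun_prop)
  have h := hind.integrable_exp_mul_sum (t := s) (s := I) (fun p => (hZ.measurable p).const_mul _)
    (fun p _ => by simpa [mul_assoc] using hZ.integrable_exp p (s * W p))
  simpa using h

/-- Chernoff's bound, with `s` left free: the moment bound holds only in the range `|s W p| ≤ 1`, so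
`s` cannot be optimized here. -/
theorem measure_sum_ge_le (hZ : IsNoise μ c Z) (I : Finset ι) (W : ι → ℝ) {s : ℝ} (hs0 : 0 ≤ s)
    (hs : ∀ p ∈ I, |s * W p| ≤ 1) (τ : ℝ) :
    μ.real {ω | τ ≤ ∑ p ∈ I, W p * Z p ω} ≤
      Real.exp (c * s ^ 2 * ∑ p ∈ I, W p ^ 2 - s * τ) := by
  refine (measure_ge_le_exp_mul_mgf τ hs0 (hZ.integrable_exp_sum I W s)).trans ?_
  rw [sub_eq_add_neg, Real.exp_add, mul_comm]
  have := hZ.mgf_sum_le I W s hs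
  have e : -s * τ = -(s * τ) := by ring
  rw [e]
  gcongr

theorem measure_abs_sum_ge_le (hZ : IsNoise μ c Z) (I : Finset ι) (W : ι → ℝ) {s : ℝ}
    (hs0 : 0 ≤ s) (hs : ∀ p ∈ I, |s * W p| ≤ 1) (τ : ℝ) :
    μ.real {ω | τ ≤ |∑ p ∈ I, W p * Z p ω|} ≤
      2 * Real.exp (c * s ^ 2 * ∑ p ∈ I, W p ^ 2 - s * τ) := by
  have h1 := hZ.measure_sum_ge_le I W hs0 hs τ
  have h2 := hZ.measure_sum_ge_le I (fun p => -W p) hs0 (by simpa using hs) τ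
  have h3 : {ω | τ ≤ |∑ p ∈ I, W p * Z p ω|} ⊆
      {ω | τ ≤ ∑ p ∈ I, W p * Z p ω} ∪ {ω | τ ≤ ∑ p ∈ I, -W p * Z p ω} := by
    intro ω hω
    rcases le_abs.1 (show τ ≤ |_| from hω) with h | h
    · exact Or.inl h
    · right
      simpa using h
  refine (measureReal_mono h3).trans ((measureReal_union_le _ _).trans ?_)
  simp only [neg_sq] at h2
  linarith

/-- Linear forms of size `ρ` exceed `t ρ` with exponentially small probability. -/
theorem measure_linear_ge_le (hZ : IsNoise μ c Z) (hc : 0 ≤ c) (I : Finset ι) (W : ι → ℝ) {ρ : ℝ}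
    (hρ : 0 < ρ) (hW : ∑ p ∈ I, W p ^ 2 ≤ ρ ^ 2) (t : ℝ) :
    μ.real {ω | t * ρ ≤ |∑ p ∈ I, W p * Z p ω|} ≤ 2 * Real.exp (c - t) := by
  -- Each `|W p| ≤ ρ`, so `s = 1 / ρ` is admissible, and it makes the quadratic term at most `c`.
  refine (hZ.measure_abs_sum_ge_le I W (s := ρ⁻¹) (by positivity) ?_ _).trans ?_
  · intro p hp
    have h1 : W p ^ 2 ≤ ρ ^ 2 :=
      (Finset.single_le_sum (f := fun p => W p ^ 2) (fun _ _ => sq_nonneg _) hp).trans hW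
    rw [abs_mul, abs_of_pos (inv_pos.2 hρ), inv_mul_le_iff₀ hρ, mul_one]
    exact abs_le_of_sq_le_sq' h1 hρ.le |> abs_le.2
  · have h2 : c * ρ⁻¹ ^ 2 * ∑ p ∈ I, W p ^ 2 ≤ c * ρ⁻¹ ^ 2 * ρ ^ 2 := by gcongr
    have h3 : c * ρ⁻¹ ^ 2 * ρ ^ 2 = c := by field_simp
    have h4 : ρ⁻¹ * (t * ρ) = t := by field_simp
    gcongr 2 * Real.exp ?_
    linarith

theorem measure_abs_ge_le (hZ : IsNoise μ c Z) (hc : 0 ≤ c) (p : ι) (t : ℝ) :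
    μ.real {ω | t ≤ |Z p ω|} ≤ 2 * Real.exp (c - t) := by
  simpa using hZ.measure_linear_ge_le hc {p} (fun _ => 1) one_pos (by simp) t

theorem integrable_exp_abs (hZ : IsNoise μ c Z) (p : ι) (s : ℝ) :
    Integrable (fun ω => Real.exp (s * |Z p ω|)) μ := by
  refine Integrable.mono' ((hZ.integrable_exp p s).add (hZ.integrable_exp p (-s)))
    ?_ (ae_of_all _ fun ω => ?_)
  · have := hZ.measurable p
    exact (by fun_prop : Measurable (fun ω => Real.exp (s * |Z p ω|))).aestronglyMeasurable
  · rw [Real.norm_eq_abs, abs_of_pos (Real.exp_pos _)]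
    have h1 := Real.exp_pos (s * Z p ω)
    have h2 := Real.exp_pos (-s * Z p ω)
    rcases abs_choice (Z p ω) with h | h <;> rw [h] <;> simp only [Pi.add_apply]
    · linarith
    · rw [show s * -Z p ω = -s * Z p ω by ring]; linarith

theorem mgf_abs_le (hZ : IsNoise μ c Z) (p : ι) :
    mgf (fun ω => |Z p ω|) μ 1 ≤ Real.exp (c + 1) := by
  have h1 := hZ.mgf_le p 1 (by simp)
  have h2 := hZ.mgf_le p (-1) (by simp)
  have h3 : mgf (fun ω => |Z p ω|) μ 1 ≤ mgf (Z p) μ 1 + mgf (Z p) μ (-1) := by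
    unfold mgf
    rw [← integral_add (hZ.integrable_exp p 1) (hZ.integrable_exp p (-1))]
    refine integral_mono (hZ.integrable_exp_abs p 1)
      ((hZ.integrable_exp p 1).add (hZ.integrable_exp p (-1))) fun ω => ?_
    have h1 := Real.exp_pos (1 * Z p ω)
    have h2 := Real.exp_pos (-1 * Z p ω)
    rcases abs_choice (Z p ω) with h | h <;> simp only [h]
    · linarith
    · rw [show 1 * -Z p ω = -1 * Z p ω by ring]; linarith
  -- The two signs cost a factor `2 ≤ e`, which turns `c` into `c + 1`.
  have h4 : (2 : ℝ) ≤ Real.exp 1 := by linarith [Real.add_one_le_exp (1 : ℝ)]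
  rw [Real.exp_add]
  norm_num at h1 h2
  nlinarith [Real.exp_pos c]

theorem integral_sq_le (hZ : IsNoise μ c Z) (p : ι) :
    Integrable (fun ω => Z p ω ^ 2) μ ∧ ∫ ω, Z p ω ^ 2 ∂μ ≤ 4 * Real.exp c := by
  have key : ∀ ω, Z p ω ^ 2 ≤ 2 * (Real.exp (1 * Z p ω) + Real.exp (-1 * Z p ω)) := fun ω => by
    have h := Real.quadratic_le_exp_of_nonneg (abs_nonneg (Z p ω))
    have h0 := abs_nonneg (Z p ω)
    rw [sq_abs] at h
    have h1 := Real.exp_pos (Z p ω)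
    have h2 := Real.exp_pos (-Z p ω)
    simp only [one_mul, neg_one_mul]
    rcases abs_choice (Z p ω) with h' | h' <;> rw [h'] at h h0 <;> linarith
  have hi := ((hZ.integrable_exp p 1).add (hZ.integrable_exp p (-1))).const_mul 2
  have hsq : Integrable (fun ω => Z p ω ^ 2) μ := by
    refine Integrable.mono' hi ((hZ.measurable p).pow_const 2).aestronglyMeasurable
      (ae_of_all _ fun ω => ?_)
    rw [Real.norm_eq_abs, abs_of_nonneg (sq_nonneg _)]
    exact key ω
  refine ⟨hsq, (integral_mono hsq hi key).trans ?_⟩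
  have h1 := hZ.mgf_le p 1 (by simp)
  have h2 := hZ.mgf_le p (-1) (by simp)
  simp only [mgf] at h1 h2
  simp only [Pi.add_apply]
  rw [integral_const_mul, integral_add (hZ.integrable_exp p 1) (hZ.integrable_exp p (-1))]
  norm_num at h1 h2 ⊢
  linarith

/-- Exponential Markov bound for sums of absolute values. -/
theorem measure_sum_abs_ge_le (hZ : IsNoise μ c Z) (I : Finset ι) (τ : ℝ) :
    μ.real {ω | (c + 1) * I.card + τ ≤ ∑ p ∈ I, |Z p ω|} ≤ Real.exp (-τ) := by
  have hind : iIndepFun (fun p ω => |Z p ω|) μ :=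
    hZ.indep.comp (fun p z => |z|) (fun p => by fun_prop)
  have hmeas : ∀ p, Measurable (fun ω => |Z p ω|) := fun p => by
    have := hZ.measurable p
    fun_prop
  have hfun : (fun ω => ∑ p ∈ I, |Z p ω|) = ∑ p ∈ I, fun ω => |Z p ω| := by
    ext ω; simp
  have hint := hind.integrable_exp_mul_sum (t := 1) (s := I) hmeas
    (fun p _ => hZ.integrable_exp_abs p 1)
  have h := measure_ge_le_exp_mul_mgf (X := fun ω => ∑ p ∈ I, |Z p ω|) (μ := μ) (t := 1)
    ((c + 1) * I.card + τ) zero_le_one (by simpa using hint)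
  refine h.trans ?_
  have hprod : mgf (fun ω => ∑ p ∈ I, |Z p ω|) μ 1 ≤ Real.exp ((c + 1) * I.card) := by
    rw [hfun, hind.mgf_sum hmeas]
    refine (Finset.prod_le_prod (fun p _ => mgf_nonneg) fun p _ => hZ.mgf_abs_le p).trans ?_
    rw [Finset.prod_const, ← Real.exp_nat_mul, mul_comm]
  calc _ ≤ Real.exp (-1 * ((c + 1) * I.card + τ)) * Real.exp ((c + 1) * I.card) := by gcongr
    _ = Real.exp (-τ) := by rw [← Real.exp_add]; congr 1; ring

theorem precomp {κ : Type*} (hZ : IsNoise μ c Z) {f : κ → ι} (hf : f.Injective) :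
    IsNoise μ c (fun k => Z (f k)) where
  measurable _ := hZ.measurable _
  indep := hZ.indep.precomp hf
  integrable_exp _ := hZ.integrable_exp _
  mgf_le _ := hZ.mgf_le _

/-- Functions of disjoint blocks of independent variables are independent. -/
theorem _root_.LowRankGLM.iIndepFun_of_disjoint_blocks [Fintype ι] {κ : Type*} [DecidableEq κ]
    (hm : ∀ p, Measurable (Z p)) (hi : iIndepFun Z μ) (blk : ι → κ)
    (F : κ → (ι → ℝ) → ℝ) (hF : ∀ k, Measurable (F k))
    (hdep : ∀ k (z z' : ι → ℝ), (∀ p, blk p = k → z p = z' p) → F k z = F k z') :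
    iIndepFun (fun k ω => F k (fun p => Z p ω)) μ := by
  classical
  rw [iIndepFun_iff_measure_inter_preimage_eq_mul]
  intro S sets hsets
  -- Each new block is split off from the union of the previous ones, using independence of two
  -- disjoint families. Coordinates outside a block are filled with `0`, harmless by `hdep`.
  induction S using Finset.induction_on with
  | empty => simp
  | insert k S hk ih =>
    have ih' := ih fun i hi => hsets i (Finset.mem_insert_of_mem hi)
    let A : Finset ι := Finset.univ.filter fun p => blk p = k
    let B : Finset ι := Finset.univ.filter fun p => blk p ∈ S
    have hAB : Disjoint A B := by
      rw [Finset.disjoint_left]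
      intro p hp hp'
      simp only [A, B, Finset.mem_filter, Finset.mem_univ, true_and] at hp hp'
      exact hk (hp ▸ hp')
    have hind := hi.indepFun_finset A B hAB hm
    let ext : ∀ T : Finset ι, (T → ℝ) → ι → ℝ := fun T w p => if h : p ∈ T then w ⟨p, h⟩ else 0
    have hext : ∀ T, Measurable (ext T) := fun T => by
      refine measurable_pi_lambda _ fun p => ?_
      by_cases h : p ∈ T
      · simpa [ext, h] using measurable_pi_apply _
      · simp [ext, h]
    have e1 : ∀ ω, F k (fun p => Z p ω) = F k (ext A fun p => Z p ω) := fun ω =>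
      hdep k _ _ fun p hp => by simp [ext, A, hp]
    have e2 : ∀ i ∈ S, ∀ ω, F i (fun p => Z p ω) = F i (ext B fun p => Z p ω) := fun i hi ω =>
      hdep i _ _ fun p hp => by simp [ext, B, hp, hi]
    rw [Finset.prod_insert hk, ← ih']
    have s1 : (fun ω => F k (fun p => Z p ω)) ⁻¹' sets k =
        (fun ω (p : A) => Z p ω) ⁻¹' ((fun w => F k (ext A w)) ⁻¹' sets k) := by
      ext ω
      simp only [Set.mem_preimage, e1]
    have s2 : (⋂ i ∈ S, (fun ω => F i (fun p => Z p ω)) ⁻¹' sets i) =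
        (fun ω (p : B) => Z p ω) ⁻¹' (⋂ i ∈ S, (fun w => F i (ext B w)) ⁻¹' sets i) := by
      ext ω
      simp only [Set.mem_preimage, Set.mem_iInter]
      exact forall₂_congr fun i hi => by rw [e2 i hi]
    rw [Finset.set_biInter_insert, s1, s2]
    refine hind.measure_inter_preimage_eq_mul _ _ ?_ ?_
    · exact ((hF k).comp (hext A)) (hsets k (Finset.mem_insert_self _ _))
    · exact Finset.measurableSet_biInter _ fun i hi =>
        ((hF i).comp (hext B)) (hsets i (Finset.mem_insert_of_mem hi))

/-- Contracting the rows with a vector of norm at most one leaves independent noise with the same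
constant `c`: different columns are disjoint blocks, and the variance proxies add up to `c ∑ w i ^ 2
≤ c`. -/
theorem rowSum {n : ℕ} {Z : Fin n × Fin n → Ω → ℝ} (hZ : IsNoise μ c Z) (hc : 0 ≤ c)
    (w : Fin n → ℝ) (hw : ∑ i, w i ^ 2 ≤ 1) :
    IsNoise μ c (fun (j : Fin n) ω => ∑ i, w i * Z (i, j) ω) := by
  have hcol : ∀ j : Fin n, IsNoise μ c (fun (i : Fin n) => Z (i, j)) := fun j =>
    hZ.precomp (f := fun i => (i, j)) fun a b h => (Prod.mk.inj h).1
  refine ⟨fun j => ?_, ?_, fun j t => ?_, fun j t ht => ?_⟩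
  · exact Finset.measurable_sum _ fun i _ => (hZ.measurable _).const_mul _
  · exact iIndepFun_of_disjoint_blocks (ι := Fin n × Fin n) hZ.measurable hZ.indep Prod.snd
      (fun j z => ∑ i, w i * z (i, j))
      (fun j => Finset.measurable_sum _ fun i _ => (measurable_pi_apply _).const_mul _)
      (fun j z z' h => Finset.sum_congr rfl fun i _ => by rw [h (i, j) rfl])
  · exact (hcol j).integrable_exp_sum Finset.univ w t
  · refine ((hcol j).mgf_sum_le Finset.univ w t fun i _ => ?_).trans ?_
    · have h1 : w i ^ 2 ≤ 1 :=
        (Finset.single_le_sum (f := fun i => w i ^ 2) (fun _ _ => sq_nonneg _)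
          (Finset.mem_univ i)).trans hw
      rw [abs_mul]
      exact mul_le_one₀ ht (abs_nonneg _) ((sq_le_one_iff_abs_le_one _).1 h1)
    · apply Real.exp_le_exp.2
      have : 0 ≤ c * t ^ 2 := by positivity
      nlinarith

end IsNoise

/-! ### Discrepancy of the absolute noise over rectangles -/

/-- By the binomial theorem the sum is `(1 + a) ^ n - 1 ≤ e ^ (n a) - 1`. -/
theorem sum_pow_card_nonempty_le {n : ℕ} {a : ℝ} (ha0 : 0 ≤ a) (ha : n * a ≤ 1) :
    ∑ A ∈ (Finset.univ : Finset (Finset (Fin n))).filter (·.Nonempty), a ^ A.card ≤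
      2 * (n * a) := by
  have h := Finset.sum_pow_mul_eq_add_pow a 1 (Finset.univ : Finset (Fin n))
  simp only [one_pow, mul_one, Finset.card_univ, Fintype.card_fin, Finset.powerset_univ] at h
  have h2 : (∑ A ∈ (Finset.univ : Finset (Finset (Fin n))).filter (·.Nonempty), a ^ A.card) + 1 =
      (a + 1) ^ n := by
    rw [← h, ← Finset.sum_filter_add_sum_filter_not Finset.univ (·.Nonempty)]
    congr 1
    have : (Finset.univ : Finset (Finset (Fin n))).filter (fun A => ¬ A.Nonempty) = {∅} := by
      ext A; simp [Finset.not_nonempty_iff_eq_empty]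
    rw [this]; simp
  have h3 : (a + 1) ^ n ≤ Real.exp (n * a) := by
    rw [Real.exp_nat_mul]
    gcongr
    exact Real.add_one_le_exp a
  have h4 := Real.abs_exp_sub_one_le (x := n * a) (by rwa [abs_of_nonneg (by positivity)])
  have h5 := le_of_abs_le h4
  rw [abs_of_nonneg (show 0 ≤ n * a by positivity)] at h5
  linarith

/-- All rectangles `A × B` carry a total absolute noise of order `|A| |B|`, up to the entropy
term `(|A| + |B|) ℓ`. -/
def Discrepancy {n : ℕ} (K ℓ : ℝ) (Y : Fin n → Fin n → ℝ) : Prop :=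
  ∀ A B : Finset (Fin n), ∑ i ∈ A, ∑ j ∈ B, |Y i j| ≤ K * (A.card * B.card) + (A.card + B.card) * ℓ

/-- Union bound over nonempty rectangles. The entropy term makes the probability for `A × B` at most
`exp (-ℓ |A|) exp (-ℓ |B|)`, so the sum factors into a square. -/
theorem IsNoise.measure_not_discrepancy_le {Ω : Type*} [MeasurableSpace Ω] {μ : Measure Ω}
    [IsProbabilityMeasure μ] {c : ℝ} {n : ℕ} {Z : Fin n × Fin n → Ω → ℝ} (hZ : IsNoise μ c Z)
    {ℓ : ℝ} (hℓ : n * Real.exp (-ℓ) ≤ 1) :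
    μ.real {ω | ¬ Discrepancy (c + 1) ℓ (fun i j => Z (i, j) ω)} ≤
      (2 * (n * Real.exp (-ℓ))) ^ 2 := by
  classical
  let P := (Finset.univ : Finset (Finset (Fin n))).filter (·.Nonempty)
  have hsub : {ω | ¬ Discrepancy (c + 1) ℓ (fun i j => Z (i, j) ω)} ⊆
      ⋃ AB ∈ P ×ˢ P, {ω | (c + 1) * (AB.1 ×ˢ AB.2).card + (AB.1.card + AB.2.card) * ℓ ≤
        ∑ p ∈ AB.1 ×ˢ AB.2, |Z p ω|} := by
    intro ω hω
    simp only [Discrepancy, Set.mem_ofPred_eq, not_forall, not_le] at hω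
    obtain ⟨A, B, hAB⟩ := hω
    -- For `ℓ ≥ 0` an empty side cannot violate the bound; `ℓ < 0` contradicts `hℓ` unless `n = 0`.
    rcases le_or_gt 0 ℓ with hl | hl
    · have hA : A.Nonempty := by
        by_contra h
        rw [Finset.not_nonempty_iff_eq_empty] at h
        subst h
        simp at hAB
        exact absurd hAB (not_lt.2 (by positivity))
      have hB : B.Nonempty := by
        by_contra h
        rw [Finset.not_nonempty_iff_eq_empty] at h
        subst h
        simp at hAB
        exact absurd hAB (not_lt.2 (by positivity))
      simp only [Set.mem_iUnion]
      refine ⟨(A, B), by simp [P, hA, hB], ?_⟩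
      simp only [Set.mem_ofPred_eq, Finset.sum_product, Finset.card_product, Nat.cast_mul]
      exact hAB.le
    · have h1 : 1 < Real.exp (-ℓ) := by simpa using hl
      rcases Nat.eq_zero_or_pos n with rfl | hn
      · have : A = ∅ := Subsingleton.elim _ _
        have : B = ∅ := Subsingleton.elim _ _
        simp_all
      · have : (1 : ℝ) ≤ n := by exact_mod_cast hn
        nlinarith
  refine (measureReal_mono hsub (measure_ne_top _ _)).trans ((measureReal_biUnion_finset_le _ _).trans ?_)
  have hS := sum_pow_card_nonempty_le (n := n) (Real.exp_pos (-ℓ)).le hℓ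
  calc _ ≤ ∑ AB ∈ P ×ˢ P, Real.exp (-ℓ) ^ AB.1.card * Real.exp (-ℓ) ^ AB.2.card := by
        refine Finset.sum_le_sum fun AB _ => (hZ.measure_sum_abs_ge_le _ _).trans (le_of_eq ?_)
        rw [← Real.exp_nat_mul, ← Real.exp_nat_mul, ← Real.exp_add]
        congr 1; ring
    _ = (∑ A ∈ P, Real.exp (-ℓ) ^ A.card) ^ 2 := by
        rw [Finset.sum_product, sq, Finset.sum_mul_sum]
    _ ≤ _ := by
        refine pow_le_pow_left₀ (Finset.sum_nonneg fun A _ => by positivity) hS 2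

/-! ### Heavy pairs: the Kahn–Szemerédi argument on dyadic levels -/

section DyadicLevels

theorem exists_dyadic_level {h x : ℝ} (hx0 : 0 < x) (hxh : x ≤ h) :
    ∃ l : ℕ, x ≤ h * (1 / 2) ^ l ∧ h * (1 / 2) ^ l ≤ 2 * x := by
  obtain ⟨l, h1, h2⟩ := exists_nat_pow_near (x := h / x) (y := (2 : ℝ))
    ((one_le_div hx0).2 hxh) one_lt_two
  refine ⟨l, ?_, ?_⟩
  · rw [one_div, inv_pow, ← div_eq_mul_inv, le_div_iff₀ (by positivity)]
    rw [le_div_iff₀ hx0] at h1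
    linarith
  · rw [one_div, inv_pow, ← div_eq_mul_inv, div_le_iff₀ (by positivity)]
    rw [div_lt_iff₀ hx0, pow_succ] at h2
    linarith

theorem exists_dyadic_levels {n : ℕ} (x : Fin n → ℝ) {h : ℝ} (hxh : ∀ i, x i ≤ h) :
    ∃ (lev : Fin n → ℕ) (N : ℕ), (∀ i, lev i < N) ∧
      ∀ i, 0 < x i → x i ≤ h * (1 / 2) ^ lev i ∧ h * (1 / 2) ^ lev i ≤ 2 * x i := by
  have : ∀ i, ∃ l : ℕ, 0 < x i → x i ≤ h * (1 / 2) ^ l ∧ h * (1 / 2) ^ l ≤ 2 * x i := fun i => by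
    by_cases hi : 0 < x i
    · obtain ⟨l, hl⟩ := exists_dyadic_level hi (hxh i)
      exact ⟨l, fun _ => hl⟩
    · exact ⟨0, fun h => absurd h hi⟩
  choose lev hlev using this
  exact ⟨lev, Finset.univ.sup lev + 1,
    fun i => Nat.lt_succ_of_le (Finset.le_sup (Finset.mem_univ i)), hlev⟩

/-- The indices of the positive entries on dyadic level `l`. -/
noncomputable def levelSet {n : ℕ} (x : Fin n → ℝ) (lev : Fin n → ℕ) (l : ℕ) : Finset (Fin n) :=
  Finset.univ.filter fun i => 0 < x i ∧ lev i = l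

theorem sum_eq_sum_levelSet {n : ℕ} (x : Fin n → ℝ) (lev : Fin n → ℕ) {N : ℕ}
    (hN : ∀ i, lev i < N) (f : Fin n → ℝ) (hf : ∀ i, ¬ 0 < x i → f i = 0) :
    ∑ i, f i = ∑ l ∈ Finset.range N, ∑ i ∈ levelSet x lev l, f i := by
  have h1 : ∑ i, f i = ∑ i ∈ Finset.univ.filter (fun i => 0 < x i), f i :=
    (Finset.sum_filter_of_ne fun i _ hi => by by_contra h; exact hi (hf i h)).symm
  rw [h1, ← Finset.sum_fiberwise_of_maps_to (t := Finset.range N) (g := lev)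
    (fun i _ => Finset.mem_range.2 (hN i))]
  refine Finset.sum_congr rfl fun l _ => Finset.sum_congr ?_ fun _ _ => rfl
  rw [Finset.filter_filter, levelSet]

/-- Rounding up to a dyadic level at most doubles an entry, so the rounded squares sum to at most
`4`. -/
theorem sum_card_levelSet_le {n : ℕ} {x : Fin n → ℝ} {h : ℝ} {lev : Fin n → ℕ} {N : ℕ}
    (hN : ∀ i, lev i < N) (h0 : 0 ≤ h) (hlev : ∀ i, 0 < x i → h * (1 / 2) ^ lev i ≤ 2 * x i)
    (hx : ∑ i, x i ^ 2 ≤ 1) :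
    ∑ l ∈ Finset.range N, ((levelSet x lev l).card : ℝ) * (h * (1 / 2) ^ l) ^ 2 ≤ 4 := by
  have h1 := sum_eq_sum_levelSet x lev hN (fun i => if 0 < x i then (h * (1 / 2) ^ lev i) ^ 2 else 0)
    (fun i hi => by simp [hi])
  have h2 : ∑ i, (if 0 < x i then (h * (1 / 2) ^ lev i) ^ 2 else 0) ≤ ∑ i, 4 * x i ^ 2 := by
    refine Finset.sum_le_sum fun i _ => ?_
    split_ifs with hi
    · have := hlev i hi
      calc _ ≤ (2 * x i) ^ 2 := by gcongr
        _ = _ := by ring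
    · positivity
  rw [← Finset.mul_sum] at h2
  have h3 : ∀ l ∈ Finset.range N, ((levelSet x lev l).card : ℝ) * (h * (1 / 2) ^ l) ^ 2 =
      ∑ i ∈ levelSet x lev l, (if 0 < x i then (h * (1 / 2) ^ lev i) ^ 2 else 0) := by
    intro l _
    rw [← nsmul_eq_mul, ← Finset.sum_const]
    refine Finset.sum_congr rfl fun i hi => ?_
    simp only [levelSet, Finset.mem_filter] at hi
    rw [if_pos hi.2.1, hi.2.2]
  rw [Finset.sum_congr rfl h3, ← h1]
  linarith

theorem sum_dyadic_le {h : ℝ} (h0 : 0 ≤ h) (N : ℕ) :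
    ∑ l ∈ Finset.range N, h * (1 / 2 : ℝ) ^ l ≤ 2 * h := by
  rw [← Finset.mul_sum]
  have := sum_geometric_two_le N
  nlinarith

theorem sum_sum_le_of_sum_le {A B p : ℕ → ℝ} {M N : ℕ} {r r' h : ℝ} (hA0 : ∀ l, 0 ≤ A l)
    (hB0 : ∀ l, 0 ≤ B l) (hp0 : ∀ l, 0 ≤ p l) (hA : ∑ l ∈ Finset.range M, A l ≤ 4)
    (hB : ∑ l ∈ Finset.range N, B l ≤ 4) (hpM : ∑ l ∈ Finset.range M, p l ≤ 2 * h)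
    (hpN : ∑ l ∈ Finset.range N, p l ≤ 2 * h) (hr : 0 ≤ r) (hr' : 0 ≤ r') :
    ∑ l ∈ Finset.range M, ∑ l' ∈ Finset.range N,
      (r * (A l * B l') + r' * (A l * p l') + r' * (p l * B l')) ≤ 16 * r + r' * (16 * h) := by
  have hfac : ∀ (r : ℝ) (f g : ℕ → ℝ), ∑ l ∈ Finset.range M, ∑ l' ∈ Finset.range N,
      r * (f l * g l') = r * ((∑ l ∈ Finset.range M, f l) * ∑ l ∈ Finset.range N, g l) := by
    intro r f g
    rw [Finset.sum_mul_sum, Finset.mul_sum]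
    exact Finset.sum_congr rfl fun l _ => (Finset.mul_sum _ _ _).symm
  simp only [Finset.sum_add_distrib]
  rw [hfac, hfac, hfac]
  have h1 := Finset.sum_nonneg fun l (_ : l ∈ Finset.range M) => hA0 l
  have h2 := Finset.sum_nonneg fun l (_ : l ∈ Finset.range N) => hB0 l
  have h3 := Finset.sum_nonneg fun l (_ : l ∈ Finset.range M) => hp0 l
  have h4 := Finset.sum_nonneg fun l (_ : l ∈ Finset.range N) => hp0 l
  have h0 : 0 ≤ 2 * h := h3.trans hpM
  have h5 : (∑ l ∈ Finset.range M, A l) * ∑ l ∈ Finset.range N, B l ≤ 4 * 4 := by gcongr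
  have h6 : (∑ l ∈ Finset.range M, A l) * ∑ l ∈ Finset.range N, p l ≤ 4 * (2 * h) := by gcongr
  have h7 : (∑ l ∈ Finset.range M, p l) * ∑ l ∈ Finset.range N, B l ≤ 2 * h * 4 := by gcongr
  have h8 := mul_le_mul_of_nonneg_left h5 hr
  have h9 := mul_le_mul_of_nonneg_left h6 hr'
  have h10 := mul_le_mul_of_nonneg_left h7 hr'
  linarith

/-- The Kahn–Szemerédi bound for heavy pairs. -/
theorem sum_heavy_le {n : ℕ} {K ℓ h s : ℝ} {Y : Fin n → Fin n → ℝ} (hY : Discrepancy K ℓ Y)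
    (hK : 0 ≤ K) (hℓ : 0 ≤ ℓ) (h0 : 0 ≤ h) (hh : h ^ 2 * ℓ ≤ 1) (hs : 0 ≤ s)
    {x y : Fin n → ℝ} (hx0 : ∀ i, 0 ≤ x i) (hy0 : ∀ i, 0 ≤ y i) (hx : ∑ i, x i ^ 2 ≤ 1)
    (hy : ∑ i, y i ^ 2 ≤ 1) (hxh : ∀ i, x i ≤ h) (hyh : ∀ i, y i ≤ h) :
    ∑ i, ∑ j, (if 1 < x i * y j * s then x i * y j * |Y i j| else 0) ≤ (16 * K + 16) * s := by
  obtain ⟨lx, M, hM, hlx⟩ := exists_dyadic_levels x hxh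
  obtain ⟨ly, N, hN, hly⟩ := exists_dyadic_levels y hyh
  set p : ℕ → ℝ := fun l => h * (1 / 2) ^ l with hp
  have hp0 : ∀ l, 0 ≤ p l := fun l => by positivity
  have hph : ∀ l, p l ≤ h := fun l =>
    mul_le_of_le_one_right h0 (pow_le_one₀ (by norm_num) (by norm_num))
  set a : ℕ → ℝ := fun l => (levelSet x lx l).card
  set b : ℕ → ℝ := fun l => (levelSet y ly l).card
  have ha0 : ∀ l, 0 ≤ a l := fun l => Nat.cast_nonneg _
  have hb0 : ∀ l, 0 ≤ b l := fun l => Nat.cast_nonneg _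
  have ha : ∑ l ∈ Finset.range M, a l * p l ^ 2 ≤ 4 :=
    sum_card_levelSet_le hM h0 (fun i hi => (hlx i hi).2) hx
  have hb : ∑ l ∈ Finset.range N, b l * p l ^ 2 ≤ 4 :=
    sum_card_levelSet_le hN h0 (fun i hi => (hly i hi).2) hy
  have hpM : ∑ l ∈ Finset.range M, p l ≤ 2 * h := sum_dyadic_le h0 M
  have hpN : ∑ l ∈ Finset.range N, p l ≤ 2 * h := sum_dyadic_le h0 N
  have e1 := sum_eq_sum_levelSet x lx hM
    (fun i => ∑ j, (if 1 < x i * y j * s then x i * y j * |Y i j| else 0)) (fun i hi => by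
      have : x i = 0 := le_antisymm (not_lt.1 hi) (hx0 i)
      simp [this])
  have e2 : ∀ i, ∑ j, (if 1 < x i * y j * s then x i * y j * |Y i j| else 0) =
      ∑ l ∈ Finset.range N, ∑ j ∈ levelSet y ly l,
        (if 1 < x i * y j * s then x i * y j * |Y i j| else 0) := fun i =>
    sum_eq_sum_levelSet y ly hN _ (fun j hj => by
      have : y j = 0 := le_antisymm (not_lt.1 hj) (hy0 j)
      simp [this])
  have hblock : ∀ l l', ∑ i ∈ levelSet x lx l, ∑ j ∈ levelSet y ly l',
      (if 1 < x i * y j * s then x i * y j * |Y i j| else 0) ≤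
      K * s * ((a l * p l ^ 2) * (b l' * p l' ^ 2)) + ℓ * s * h * ((a l * p l ^ 2) * p l') +
        ℓ * s * h * (p l * (b l' * p l' ^ 2)) := by
    intro l l'
    have hpp : ∀ i ∈ levelSet x lx l, ∀ j ∈ levelSet y ly l', x i * y j ≤ p l * p l' := by
      intro i hi j hj
      simp only [levelSet, Finset.mem_filter, Finset.mem_univ, true_and] at hi hj
      have h1 := (hlx i hi.1).1
      have h2 := (hly j hj.1).1
      rw [hi.2] at h1
      rw [hj.2] at h2
      exact mul_le_mul h1 h2 (hy0 j) (hp0 l)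
    -- A block whose rounded product is light contains no heavy pair. On a heavy block `p l * p l' ≤
    -- s * (p l * p l') ^ 2`, which turns the discrepancy bound into sums of level-set squares.
    by_cases hheavy : 1 < p l * p l' * s
    · have h1 : p l * p l' ≤ s * (p l ^ 2 * p l' ^ 2) := by
        have : 0 ≤ p l * p l' := mul_nonneg (hp0 l) (hp0 l')
        nlinarith
      have hpl : 0 ≤ p l * p l' := mul_nonneg (hp0 l) (hp0 l')
      calc _ ≤ ∑ i ∈ levelSet x lx l, ∑ j ∈ levelSet y ly l', p l * p l' * |Y i j| := by
            refine Finset.sum_le_sum fun i hi => Finset.sum_le_sum fun j hj => ?_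
            split_ifs
            · exact mul_le_mul_of_nonneg_right (hpp i hi j hj) (abs_nonneg _)
            · positivity
        _ = p l * p l' * ∑ i ∈ levelSet x lx l, ∑ j ∈ levelSet y ly l', |Y i j| := by
            simp_rw [Finset.mul_sum]
        _ ≤ p l * p l' * (K * (a l * b l') + (a l + b l') * ℓ) :=
            mul_le_mul_of_nonneg_left (hY _ _) hpl
        _ = (p l * p l') * (K * (a l * b l')) + p l * p l' * (a l * ℓ)
            + p l * p l' * (b l' * ℓ) := by ring
        _ ≤ s * (p l ^ 2 * p l' ^ 2) * (K * (a l * b l')) + (s * h * p l ^ 2 * p l') * (a l * ℓ)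
            + (s * h * p l' ^ 2 * p l) * (b l' * ℓ) := by
            have hkab : 0 ≤ K * (a l * b l') := by positivity
            -- In each entropy term one factor `p` is traded for its bound `h`; the factor `p` that
            -- stays unsquared sums geometrically.
            have h2 : p l * p l' ≤ s * h * p l ^ 2 * p l' := by
              have : p l ^ 2 * p l' ^ 2 ≤ p l ^ 2 * (p l' * h) := by
                have := hph l'
                have := hp0 l'
                rw [sq (p l')]
                gcongr
              nlinarith
            have h3 : p l * p l' ≤ s * h * p l' ^ 2 * p l := by
              have : p l ^ 2 * p l' ^ 2 ≤ (p l * h) * p l' ^ 2 := by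
                have := hph l
                have := hp0 l
                rw [sq (p l)]
                gcongr
              nlinarith
            have h4 : 0 ≤ a l * ℓ := mul_nonneg (ha0 l) hℓ
            have h5 : 0 ≤ b l' * ℓ := mul_nonneg (hb0 l') hℓ
            gcongr
        _ = _ := by ring
    · have : ∀ i ∈ levelSet x lx l, ∀ j ∈ levelSet y ly l', ¬ 1 < x i * y j * s := by
        intro i hi j hj hlt
        have := mul_le_mul_of_nonneg_right (hpp i hi j hj) hs
        linarith
      rw [Finset.sum_eq_zero fun i hi => Finset.sum_eq_zero fun j hj => if_neg (this i hi j hj)]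
      have := ha0 l
      have := hb0 l'
      have := hp0 l
      have := hp0 l'
      positivity
  have hfin := sum_sum_le_of_sum_le (A := fun l => a l * p l ^ 2) (B := fun l => b l * p l ^ 2)
    (p := p) (fun l => mul_nonneg (ha0 l) (sq_nonneg _)) (fun l => mul_nonneg (hb0 l) (sq_nonneg _))
    hp0 ha hb hpM hpN (mul_nonneg hK hs) (mul_nonneg (mul_nonneg hℓ hs) h0)
  have hexp : ∑ i, ∑ j, (if 1 < x i * y j * s then x i * y j * |Y i j| else 0) =
      ∑ l ∈ Finset.range M, ∑ l' ∈ Finset.range N, ∑ i ∈ levelSet x lx l, ∑ j ∈ levelSet y ly l',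
        (if 1 < x i * y j * s then x i * y j * |Y i j| else 0) := by
    rw [e1]
    refine Finset.sum_congr rfl fun l _ => ?_
    rw [Finset.sum_congr rfl fun i _ => e2 i]
    exact Finset.sum_comm
  have hsum : ∑ l ∈ Finset.range M, ∑ l' ∈ Finset.range N,
      ∑ i ∈ levelSet x lx l, ∑ j ∈ levelSet y ly l',
        (if 1 < x i * y j * s then x i * y j * |Y i j| else 0) ≤ _ :=
    Finset.sum_le_sum fun l _ => Finset.sum_le_sum fun l' _ => hblock l l'
  rw [hexp]
  refine (hsum.trans hfin).trans ?_
  -- The cap `h` on the entries pays for the entropy: `h ^ 2 * ℓ ≤ 1`.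
  have h1 : ℓ * s * h * (16 * h) = 16 * s * (h ^ 2 * ℓ) := by ring
  rw [h1]
  have h2 : 16 * s * (h ^ 2 * ℓ) ≤ 16 * s * 1 := by gcongr
  linarith

end DyadicLevels

/-! ### Half-nets -/

section Nets

variable {E : Type*} [NormedAddCommGroup E] [NormedSpace ℝ E] [FiniteDimensional ℝ E]

/-- A half-net of the unit ball of a finite-dimensional space. -/
def IsHalfNet {E : Type*} [NormedAddCommGroup E] (N : Finset E) : Prop :=
  (∀ v ∈ N, ‖v‖ ≤ 1) ∧ ∀ w : E, ‖w‖ ≤ 1 → ∃ v ∈ N, ‖w - v‖ ≤ 1 / 2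

variable (E) in
theorem exists_halfNet : ∃ N : Finset E, IsHalfNet N ∧ N.card ≤ 5 ^ Module.finrank ℝ E := by
  classical
  let p : ℕ → Prop := fun k => ∃ N : Finset E, N.card = k ∧ (∀ v ∈ N, ‖v‖ ≤ 1) ∧
    ∀ v ∈ N, ∀ w ∈ N, v ≠ w → 1 / 2 ≤ ‖v - w‖
  have hp0 : p 0 := ⟨∅, by simp⟩
  have hle : ∀ k, p k → k ≤ 5 ^ Module.finrank ℝ E := by
    rintro k ⟨N, rfl, h1, h2⟩
    -- Doubling turns a `1/2`-separated set in the unit ball into a `1`-separated set in the ball of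
    -- radius `2`, which has at most `5 ^ d` points.
    have hinj : Function.Injective (fun v : E => (2 : ℝ) • v) := smul_right_injective E two_ne_zero
    rw [← Finset.card_image_of_injective N hinj]
    refine Besicovitch.card_le_of_separated _ ?_ ?_
    · intro v hv
      obtain ⟨w, hw, rfl⟩ := Finset.mem_image.1 hv
      rw [norm_smul]
      have := h1 w hw
      norm_num
      linarith
    · intro v hv v' hv' hne
      obtain ⟨w, hw, rfl⟩ := Finset.mem_image.1 hv
      obtain ⟨w', hw', rfl⟩ := Finset.mem_image.1 hv'
      have := h2 w hw w' hw' (fun h => hne (by rw [h]))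
      rw [← smul_sub, norm_smul]
      norm_num
      linarith
  -- A separated set of maximal cardinality is a half-net: a far point could be added to it.
  obtain ⟨N, hN, h1, h2⟩ := Nat.findGreatest_spec (P := p)
    (Nat.zero_le (5 ^ Module.finrank ℝ E)) hp0
  have hmax : ∀ k, p k → k ≤ Nat.findGreatest p (5 ^ Module.finrank ℝ E) := fun k hk =>
    Nat.le_findGreatest (hle k hk) hk
  refine ⟨N, ⟨h1, fun w hw => ?_⟩, hle _ ⟨N, rfl, h1, h2⟩⟩
  by_contra! hfar
  have hwN : w ∉ N := fun h => by
    have := hfar w h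
    norm_num at this
  have := hmax (N.card + 1) ⟨insert w N, Finset.card_insert_of_notMem hwN, by
      simpa using ⟨hw, h1⟩, by
      intro v hv v' hv' hne
      rcases Finset.mem_insert.1 hv with h | hv
      · rcases Finset.mem_insert.1 hv' with h' | hv'
        · exact absurd (h.trans h'.symm) hne
        · rw [h]; exact (hfar v' hv').le
      · rcases Finset.mem_insert.1 hv' with h' | hv'
        · rw [h', norm_sub_rev]; exact (hfar v hv).le
        · exact h2 v hv v' hv' hne⟩
  omega

/-- Approximation by the net gives `‖T‖ ≤ M + ‖T‖ / 2`, hence `‖T‖ ≤ 2 M`. -/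
theorem IsHalfNet.norm_map_le {N : Finset E} (hN : IsHalfNet N) {F : Type*}
    [NormedAddCommGroup F] [NormedSpace ℝ F] (T : E →ₗ[ℝ] F) {M : ℝ}
    (hT : ∀ v ∈ N, ‖T v‖ ≤ M) (w : E) : ‖T w‖ ≤ 2 * M * ‖w‖ := by
  obtain ⟨v₀, hv₀, -⟩ := hN.2 0 (by simp)
  have hM : 0 ≤ M := (norm_nonneg _).trans (hT v₀ hv₀)
  let T' : E →L[ℝ] F := LinearMap.toContinuousLinearMap T
  have hTT : ∀ v, T' v = T v := fun v => rfl
  have h : ‖T'‖ ≤ M + ‖T'‖ / 2 := by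
    refine ContinuousLinearMap.opNorm_le_of_unit_norm (by positivity) fun w hw => ?_
    obtain ⟨v, hv, hwv⟩ := hN.2 w hw.le
    calc ‖T' w‖ = ‖T' v + T' (w - v)‖ := by rw [← map_add]; congr 2; abel
      _ ≤ ‖T' v‖ + ‖T' (w - v)‖ := norm_add_le _ _
      _ ≤ M + ‖T'‖ * (1 / 2) := by
          gcongr
          · exact hT v hv
          · exact (T'.le_opNorm _).trans (by gcongr)
      _ = _ := by ring
  calc ‖T w‖ = ‖T' w‖ := rfl
    _ ≤ ‖T'‖ * ‖w‖ := T'.le_opNorm w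
    _ ≤ 2 * M * ‖w‖ := by gcongr; linarith

end Nets

/-! ### A Hanson–Wright bound by predictable sums -/

variable {Ω : Type*} [MeasurableSpace Ω] {μ : Measure Ω} [IsProbabilityMeasure μ] {c : ℝ}

/-- Conditioning on `Y`: independence gives a product law and Tonelli integrates `X` out first.
Working with `∫⁻` removes all integrability questions. -/
theorem lintegral_mul_exp_le {α : Type*} [MeasurableSpace α] {Y : Ω → α} {X : Ω → ℝ}
    (hY : Measurable Y) (hX : Measurable X) (hYX : IndepFun Y X μ) {F : α → ENNReal}
    (hF : Measurable F) {ψ : α → ℝ} (hψ : Measurable ψ) {B : ENNReal}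
    (hB : ∀ a, ∫⁻ ω, ENNReal.ofReal (Real.exp (ψ a * X ω)) ∂μ ≤ B) :
    ∫⁻ ω, F (Y ω) * ENNReal.ofReal (Real.exp (ψ (Y ω) * X ω)) ∂μ ≤ (∫⁻ ω, F (Y ω) ∂μ) * B := by
  have := Measure.isProbabilityMeasure_map (μ := μ) hX.aemeasurable
  have := Measure.isProbabilityMeasure_map (μ := μ) hY.aemeasurable
  have hmap := (indepFun_iff_map_prod_eq_prod_map_map hY.aemeasurable hX.aemeasurable).1 hYX
  have hm : Measurable fun q : α × ℝ => F q.1 * ENNReal.ofReal (Real.exp (ψ q.1 * q.2)) := by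
    fun_prop
  calc _ = ∫⁻ q, F q.1 * ENNReal.ofReal (Real.exp (ψ q.1 * q.2)) ∂(μ.map fun ω => (Y ω, X ω)) := by
        rw [lintegral_map hm (hY.prodMk hX)]
    _ = ∫⁻ a, ∫⁻ x, F a * ENNReal.ofReal (Real.exp (ψ a * x)) ∂(μ.map X) ∂(μ.map Y) := by
        rw [hmap, lintegral_prod _ hm.aemeasurable]
    _ ≤ ∫⁻ a, F a * B ∂(μ.map Y) := by
        refine lintegral_mono fun a => ?_
        rw [lintegral_const_mul _ (by fun_prop), lintegral_map (by fun_prop) hX]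
        exact mul_le_mul_right (hB a) _
    _ = _ := by
        rw [lintegral_mul_const _ hF, lintegral_map hF hY]

theorem IsNoise.lintegral_exp_le {ι : Type*} {Z : ι → Ω → ℝ} (hZ : IsNoise μ c Z) (hc : 0 ≤ c)
    (p : ι) {a y : ℝ} (hay : |a| ≤ y) (hy : y ≤ 1) :
    ∫⁻ ω, ENNReal.ofReal (Real.exp (a * Z p ω)) ∂μ ≤ ENNReal.ofReal (Real.exp (c * y ^ 2)) := by
  rw [← ofReal_integral_eq_lintegral_ofReal (hZ.integrable_exp p a)
    (ae_of_all _ fun ω => (Real.exp_pos _).le)]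
  refine ENNReal.ofReal_le_ofReal ((hZ.mgf_le p a (hay.trans hy)).trans ?_)
  have : a ^ 2 ≤ y ^ 2 := sq_le_sq' (abs_le.1 hay).1 (abs_le.1 hay).2
  gcongr

/-- Exponential moments of sums with predictable coefficients. -/
theorem IsNoise.lintegral_exp_predictable_le {n : ℕ} {ξ : Fin n → Ω → ℝ} (hξ : IsNoise μ c ξ)
    (hc : 0 ≤ c) (Φ : Fin n → (Fin n → ℝ) → ℝ) (hΦ : ∀ i, Measurable (Φ i))
    (hdep : ∀ i (z z' : Fin n → ℝ), (∀ j < i, z j = z' j) → Φ i z = Φ i z') {y : Fin n → ℝ}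
    (hy : ∀ i z, |Φ i z| ≤ y i) (hy1 : ∀ i, y i ≤ 1) :
    ∫⁻ ω, ENNReal.ofReal (Real.exp (∑ i, Φ i (fun j => ξ j ω) * ξ i ω)) ∂μ ≤
      ENNReal.ofReal (Real.exp (c * ∑ i, y i ^ 2)) := by
  -- The variables are revealed one at a time. The coefficient of the newest one depends only on its
  -- predecessors, so integrating it out costs a factor `exp (c * y i ^ 2)`.
  have key : ∀ m : ℕ, m ≤ n → ∫⁻ ω, ENNReal.ofReal (Real.exp
      (∑ i ∈ Finset.univ.filter (fun i : Fin n => i.val < m), Φ i (fun j => ξ j ω) * ξ i ω)) ∂μ ≤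
      ENNReal.ofReal (Real.exp
        (c * ∑ i ∈ Finset.univ.filter (fun i : Fin n => i.val < m), y i ^ 2)) := by
    intro m
    induction m with
    | zero => simp
    | succ m ih =>
      intro hm
      have ih' := ih (by omega)
      let i₀ : Fin n := ⟨m, by omega⟩
      let S : Finset (Fin n) := Finset.univ.filter (fun i : Fin n => i.val < m)
      have hi₀ : i₀ ∉ S := by simp [S, i₀]
      have hS : Finset.univ.filter (fun i : Fin n => i.val < m + 1) = insert i₀ S := by
        ext i
        simp only [Finset.mem_filter, Finset.mem_univ, true_and, Finset.mem_insert, S, i₀, Fin.ext_iff]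
        omega
      let ext : (S → ℝ) → Fin n → ℝ := fun w j => if h : j ∈ S then w ⟨j, h⟩ else 0
      have hext : Measurable ext := by
        refine measurable_pi_lambda _ fun j => ?_
        by_cases h : j ∈ S
        · simpa [ext, h] using measurable_pi_apply _
        · simp [ext, h]
      let Y : Ω → (S → ℝ) := fun ω i => ξ i ω
      have hYm : Measurable Y := measurable_pi_lambda _ fun i => hξ.measurable _
      have hextY : ∀ ω, ∀ j ∈ S, ext (Y ω) j = ξ j ω := fun ω j hj => by simp [ext, Y, hj]
      have hind : IndepFun Y (ξ i₀) μ := by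
        have h := hξ.indep.indepFun_finset S {i₀} (by simpa using hi₀) hξ.measurable
        have hm₀ : Measurable fun v : (({i₀} : Finset (Fin n)) → ℝ) => v ⟨i₀, by simp⟩ :=
          measurable_pi_apply _
        exact h.comp measurable_id hm₀
      have hΦS : ∀ i : Fin n, i.val ≤ m → ∀ ω, Φ i (fun j => ξ j ω) = Φ i (ext (Y ω)) := by
        intro i hi ω
        refine hdep i _ _ fun j hj => (hextY ω j ?_).symm
        simp only [S, Finset.mem_filter, Finset.mem_univ, true_and]
        exact lt_of_lt_of_le hj hi
      let F : (S → ℝ) → ENNReal := fun w =>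
        ENNReal.ofReal (Real.exp (∑ i ∈ S, Φ i (ext w) * ext w i))
      have hF : Measurable F := by
        have h1 : Measurable fun w => ∑ i ∈ S, Φ i (ext w) * ext w i :=
          Finset.measurable_sum _ fun i _ => ((hΦ i).comp hext).mul
            ((measurable_pi_apply i).comp hext)
        fun_prop
      have hFY : ∀ ω, F (Y ω) = ENNReal.ofReal (Real.exp
          (∑ i ∈ S, Φ i (fun j => ξ j ω) * ξ i ω)) := by
        intro ω
        simp only [F]
        congr 2
        refine Finset.sum_congr rfl fun i hi => ?_
        have : i.val < m := by simpa [S] using hi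
        rw [hextY ω i hi, hΦS i this.le]
      have h := lintegral_mul_exp_le hYm (hξ.measurable i₀) hind hF
        (ψ := fun w => Φ i₀ (ext w)) ((hΦ i₀).comp hext)
        (B := ENNReal.ofReal (Real.exp (c * y i₀ ^ 2)))
        (fun w => hξ.lintegral_exp_le hc i₀ (hy i₀ _) (hy1 i₀))
      rw [hS, Finset.sum_insert hi₀, mul_add, Real.exp_add, ENNReal.ofReal_mul (Real.exp_pos _).le,
        mul_comm]
      refine le_trans (le_of_eq ?_) (h.trans (mul_le_mul_left (le_of_eq_of_le ?_ ih') _))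
      · refine lintegral_congr fun ω => ?_
        rw [Finset.sum_insert hi₀, Real.exp_add, ENNReal.ofReal_mul (Real.exp_pos _).le, mul_comm,
          hFY, hΦS i₀ le_rfl]
      · exact lintegral_congr fun ω => hFY ω
  simpa using key n le_rfl

theorem IsNoise.measure_predictable_ge_le {n : ℕ} {ξ : Fin n → Ω → ℝ} (hξ : IsNoise μ c ξ)
    (hc : 0 ≤ c) (Φ : Fin n → (Fin n → ℝ) → ℝ) (hΦ : ∀ i, Measurable (Φ i))
    (hdep : ∀ i (z z' : Fin n → ℝ), (∀ j < i, z j = z' j) → Φ i z = Φ i z') {y : Fin n → ℝ}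
    (hy : ∀ i z, |Φ i z| ≤ y i) (hy1 : ∀ i, y i ≤ 1) (τ : ℝ) :
    μ.real {ω | τ ≤ ∑ i, Φ i (fun j => ξ j ω) * ξ i ω} ≤ Real.exp (c * ∑ i, y i ^ 2 - τ) := by
  have h := hξ.lintegral_exp_predictable_le hc Φ hΦ hdep hy hy1
  have hz : Measurable fun ω => fun j => ξ j ω := measurable_pi_lambda _ hξ.measurable
  have hm : Measurable fun ω => ∑ i, Φ i (fun j => ξ j ω) * ξ i ω :=
    Finset.measurable_sum _ fun i _ => ((hΦ i).comp hz).mul (hξ.measurable i)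
  have hmark := mul_meas_ge_le_lintegral (μ := μ)
    (f := fun ω => ENNReal.ofReal (Real.exp (∑ i, Φ i (fun j => ξ j ω) * ξ i ω)))
    (by fun_prop) (ENNReal.ofReal (Real.exp τ))
  have hset : {ω | τ ≤ ∑ i, Φ i (fun j => ξ j ω) * ξ i ω} = {ω | ENNReal.ofReal (Real.exp τ) ≤
      ENNReal.ofReal (Real.exp (∑ i, Φ i (fun j => ξ j ω) * ξ i ω))} := by
    ext ω
    simp only [Set.mem_ofPred_eq]
    rw [ENNReal.ofReal_le_ofReal_iff (Real.exp_pos _).le, Real.exp_le_exp]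
  rw [← hset] at hmark
  have h2 := hmark.trans h
  have h3 := ENNReal.toReal_mono (by simp) h2
  rw [ENNReal.toReal_mul, ENNReal.toReal_ofReal (Real.exp_pos _).le,
    ENNReal.toReal_ofReal (Real.exp_pos _).le] at h3
  rw [Real.exp_sub, le_div_iff₀ (Real.exp_pos _), mul_comm]
  exact h3

/-- The truncated diagonal part of a quadratic form in the noise. -/
theorem IsNoise.measure_truncated_sq_ge_le {n : ℕ} {ξ : Fin n → Ω → ℝ} (hξ : IsNoise μ c ξ)
    {a : Fin n → ℝ} (ha0 : ∀ i, 0 ≤ a i) (ha1 : ∀ i, a i ≤ 1) {t : ℝ} (ht : 0 < t) (k : ℝ)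
    (hk : ∑ i, a i ≤ k) :
    μ.real {ω | (8 * Real.exp c + 1) * k ≤ ∑ i, min (ξ i ω ^ 2) (t ^ 2) * a i} ≤
      Real.exp (-k / t ^ 2) := by
  -- This exponent keeps the truncated summands in `[0, 1]`, where `exp z ≤ 1 + 2 z`; with the
  -- second moment at most `4 exp c` this produces the constant `8 exp c`.
  set s : ℝ := (t ^ 2)⁻¹ with hs
  have hs0 : 0 < s := by positivity
  let X : Fin n → Ω → ℝ := fun i ω => min (ξ i ω ^ 2) (t ^ 2) * a i
  have hXm : ∀ i, Measurable (X i) := fun i => by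
    have := hξ.measurable i
    fun_prop
  have hX0 : ∀ i ω, 0 ≤ X i ω := fun i ω => mul_nonneg (by positivity) (ha0 i)
  have hX1 : ∀ i ω, s * X i ω ≤ 1 := fun i ω => by
    have h1 : X i ω ≤ t ^ 2 * 1 := mul_le_mul (min_le_right _ _) (ha1 i) (ha0 i) (by positivity)
    calc s * X i ω ≤ s * (t ^ 2 * 1) := by gcongr
      _ = 1 := by rw [hs]; field_simp
  have hind : iIndepFun X μ := hξ.indep.comp (fun i z => min (z ^ 2) (t ^ 2) * a i)
    (fun i => by fun_prop)
  have hint : ∀ i, Integrable (fun ω => Real.exp (s * X i ω)) μ := fun i =>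
    Integrable.of_bound (by have := hXm i; fun_prop) (Real.exp 1) (ae_of_all _ fun ω => by
      rw [Real.norm_eq_abs, abs_of_pos (Real.exp_pos _)]
      exact Real.exp_le_exp.2 (hX1 i ω))
  have hmgf : ∀ i, mgf (X i) μ s ≤ Real.exp (8 * Real.exp c * s * a i) := fun i => by
    have hsq := hξ.integral_sq_le i
    have hpt : ∀ ω, Real.exp (s * X i ω) ≤ 1 + 2 * s * a i * ξ i ω ^ 2 := fun ω => by
      have h0 : 0 ≤ s * X i ω := mul_nonneg hs0.le (hX0 i ω)
      have h1 := le_of_abs_le (Real.abs_exp_sub_one_le (x := s * X i ω)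
        (by rw [abs_of_nonneg h0]; exact hX1 i ω))
      rw [abs_of_nonneg h0] at h1
      have h2 : X i ω ≤ ξ i ω ^ 2 * a i := mul_le_mul_of_nonneg_right (min_le_left _ _) (ha0 i)
      have h3 : s * X i ω ≤ s * (ξ i ω ^ 2 * a i) := by gcongr
      linarith
    calc mgf (X i) μ s ≤ ∫ ω, (1 + 2 * s * a i * ξ i ω ^ 2) ∂μ :=
          integral_mono (hint i) ((integrable_const _).add (hsq.1.const_mul _)) hpt
      _ = 1 + 2 * s * a i * ∫ ω, ξ i ω ^ 2 ∂μ := by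
          rw [integral_add (integrable_const _) (hsq.1.const_mul _), integral_const_mul]
          simp
      _ ≤ 1 + 2 * s * a i * (4 * Real.exp c) := by
          have := ha0 i
          gcongr
          exact hsq.2
      _ ≤ _ := by
          have := Real.add_one_le_exp (8 * Real.exp c * s * a i)
          linarith
  have hfun : (fun ω => ∑ i, min (ξ i ω ^ 2) (t ^ 2) * a i) = ∑ i, X i := by
    ext ω; simp [X]
  have hsum : mgf (∑ i, X i) μ s ≤ Real.exp (8 * Real.exp c * s * k) := by
    rw [hind.mgf_sum hXm]
    refine (Finset.prod_le_prod (fun i _ => mgf_nonneg) fun i _ => hmgf i).trans ?_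
    rw [← Real.exp_sum, ← Finset.mul_sum]
    gcongr
  have hint' := hind.integrable_exp_mul_sum (t := s) (s := Finset.univ) hXm (fun i _ => hint i)
  have h := measure_ge_le_exp_mul_mgf (μ := μ) ((8 * Real.exp c + 1) * k) hs0.le hint'
  rw [← hfun] at h hsum
  refine h.trans ?_
  calc _ ≤ Real.exp (-s * ((8 * Real.exp c + 1) * k)) * Real.exp (8 * Real.exp c * s * k) := by
        gcongr
    _ = Real.exp (-k / t ^ 2) := by
        rw [← Real.exp_add, hs]
        congr 1
        field_simp
        ring

theorem sum_sum_symm_eq {n : ℕ} (f : Fin n → Fin n → ℝ) (hf : ∀ i j, f i j = f j i) :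
    ∑ i, ∑ j, f i j =
      ∑ i, f i i + 2 * ∑ i, ∑ j ∈ Finset.univ.filter (fun j => j < i), f i j := by
  have h1 : ∀ i, ∑ j, f i j = f i i + ∑ j, (if j < i then f i j else 0) +
      ∑ j, (if i < j then f i j else 0) := fun i => by
    have : f i i = ∑ j, if j = i then f i j else 0 := by simp
    rw [this, ← Finset.sum_add_distrib, ← Finset.sum_add_distrib]
    refine Finset.sum_congr rfl fun j _ => ?_
    rcases lt_trichotomy i j with h | h | h
    · simp [h, h.ne', h.not_gt]
    · simp [h]
    · simp [h, h.ne, h.not_gt]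
  have h2 : ∑ i, ∑ j, (if i < j then f i j else 0) = ∑ i, ∑ j, (if j < i then f i j else 0) := by
    rw [Finset.sum_comm]
    exact Finset.sum_congr rfl fun i _ => Finset.sum_congr rfl fun j _ => by rw [hf]
  simp_rw [h1, Finset.sum_add_distrib, h2, Finset.sum_filter]
  ring

theorem abs_clip_le {x y : ℝ} (hy : 0 ≤ y) : |max (-y) (min x y)| ≤ y := by
  rw [abs_le]
  exact ⟨le_max_left _ _, max_le (by linarith) (min_le_right _ _)⟩

theorem clip_eq_self {x y : ℝ} (h : |x| ≤ y) : max (-y) (min x y) = x := by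
  rw [min_eq_left (abs_le.1 h).2, max_eq_right (abs_le.1 h).1]

/-- A Hanson–Wright type bound: the norm of a random combination of the vectors `p i`. -/
theorem IsNoise.measure_norm_sq_sum_gt_le {n : ℕ} {ξ : Fin n → Ω → ℝ} (hξ : IsNoise μ c ξ)
    (hc : 1 ≤ c) {E : Type*} [NormedAddCommGroup E] [InnerProductSpace ℝ E] (p : Fin n → E)
    (hp : ∀ i, ∑ j, (inner ℝ (p j) (p i)) ^ 2 ≤ ‖p i‖ ^ 2) (hp1 : ∀ i, ‖p i‖ ≤ 1) {k t : ℝ}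
    (hk : ∑ i, ‖p i‖ ^ 2 ≤ k) (ht : 1 ≤ t) :
    μ.real {ω | (8 * Real.exp c + 3) * k < ‖∑ i, ξ i ω • p i‖ ^ 2} ≤
      4 * n * Real.exp (c - t) + Real.exp (-k / t ^ 2) + Real.exp (-k / (4 * c * t ^ 2)) := by
  have hc0 : 0 ≤ c := by linarith
  have ht0 : 0 < t := by linarith
  -- Minimizes `c (θ t) ^ 2 k - θ k`, with minimal value `-k / (4 c t ^ 2)`.
  set θ : ℝ := (2 * c * t ^ 2)⁻¹ with hθ
  have hθ0 : 0 < θ := by positivity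
  -- Half of the off-diagonal part of the quadratic form, written as a sum with predictable
  -- coefficients `w i`. Clipping at `t ‖p i‖` makes them bounded; by `hp`, clipping is active only
  -- with probability `2 exp (c - t)` for each `i`.
  let w : Fin n → (Fin n → ℝ) → ℝ := fun i z =>
    ∑ j ∈ Finset.univ.filter (fun j => j < i), inner ℝ (p j) (p i) * z j
  let cl : Fin n → (Fin n → ℝ) → ℝ := fun i z =>
    max (-(t * ‖p i‖)) (min (w i z) (t * ‖p i‖))
  let E₁ : Fin n → Set Ω := fun i => {ω | t ≤ |ξ i ω|}
  let E₂ : Fin n → Set Ω := fun i => {ω | 0 < ‖p i‖ ∧ t * ‖p i‖ ≤ |w i (fun j => ξ j ω)|}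
  let E₃ : Set Ω := {ω | (8 * Real.exp c + 1) * k ≤ ∑ i, min (ξ i ω ^ 2) (t ^ 2) * ‖p i‖ ^ 2}
  let E₄ : Set Ω := {ω | θ * k ≤ ∑ i, (θ * cl i (fun j => ξ j ω)) * ξ i ω}
  have hsub : {ω | (8 * Real.exp c + 3) * k < ‖∑ i, ξ i ω • p i‖ ^ 2} ⊆
      (((⋃ i ∈ Finset.univ, E₁ i) ∪ ⋃ i ∈ Finset.univ, E₂ i) ∪ E₃) ∪ E₄ := by
    intro ω hω
    by_contra hcon
    simp only [Set.mem_union, Set.mem_iUnion, Finset.mem_univ, exists_prop, true_and, not_or,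
      not_exists] at hcon
    obtain ⟨⟨⟨h1, h2⟩, h3⟩, h4⟩ := hcon
    simp only [E₁, E₂, E₃, E₄, Set.mem_ofPred_eq, not_le, not_and] at h1 h2 h3 h4 hω
    have hmin : ∀ i, min (ξ i ω ^ 2) (t ^ 2) = ξ i ω ^ 2 := fun i => by
      refine min_eq_left ?_
      rw [← sq_abs]
      have := h1 i
      gcongr
    have hcl : ∀ i, cl i (fun j => ξ j ω) = w i (fun j => ξ j ω) := fun i => by
      refine clip_eq_self ?_
      rcases (norm_nonneg (p i)).eq_or_lt with h | h
      · have : p i = 0 := norm_eq_zero.1 h.symm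
        simp [w, this]
      · exact (h2 i h).le
    -- Outside the exceptional events the diagonal contributes at most `(8 exp c + 1) k` and twice
    -- the triangular sum at most `2 k`.
    have hexp : ‖∑ i, ξ i ω • p i‖ ^ 2 = ∑ i, ξ i ω ^ 2 * ‖p i‖ ^ 2 +
        2 * ∑ i, w i (fun j => ξ j ω) * ξ i ω := by
      rw [← real_inner_self_eq_norm_sq, sum_inner]
      simp_rw [inner_sum, real_inner_smul_left, real_inner_smul_right]
      rw [sum_sum_symm_eq _ fun i j => by rw [real_inner_comm]; ring]
      congr 1
      · refine Finset.sum_congr rfl fun i _ => ?_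
        rw [real_inner_self_eq_norm_sq]; ring
      · congr 1
        refine Finset.sum_congr rfl fun i _ => ?_
        rw [Finset.sum_mul]
        refine Finset.sum_congr rfl fun j _ => ?_
        rw [real_inner_comm]; ring
    simp_rw [hmin] at h3
    simp_rw [hcl, mul_assoc, ← Finset.mul_sum] at h4
    have h5 := lt_of_mul_lt_mul_left h4 hθ0.le
    rw [hexp] at hω
    linarith
  have b1 : ∀ i, μ.real (E₁ i) ≤ 2 * Real.exp (c - t) := fun i => hξ.measure_abs_ge_le hc0 i t
  have b2 : ∀ i, μ.real (E₂ i) ≤ 2 * Real.exp (c - t) := fun i => by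
    by_cases h : 0 < ‖p i‖
    · refine (measureReal_mono (fun ω hω => hω.2)).trans
        (hξ.measure_linear_ge_le hc0 (Finset.univ.filter (fun j => j < i))
          (fun j => inner ℝ (p j) (p i)) h (le_trans ?_ (hp i)) t)
      exact Finset.sum_le_sum_of_subset_of_nonneg (Finset.filter_subset _ _)
        fun _ _ _ => sq_nonneg _
    · have : E₂ i = ∅ := by
        ext ω; simp only [E₂, Set.mem_ofPred_eq, h, false_and, Set.mem_empty_iff_false]
      rw [this]
      simp
      positivity
  have b3 : μ.real E₃ ≤ Real.exp (-k / t ^ 2) :=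
    hξ.measure_truncated_sq_ge_le (fun i => sq_nonneg _)
      (fun i => pow_le_one₀ (norm_nonneg _) (hp1 i)) ht0 k hk
  have b4 : μ.real E₄ ≤ Real.exp (-k / (4 * c * t ^ 2)) := by
    have hw : ∀ i, Measurable (w i) := fun i =>
      Finset.measurable_sum _ fun j _ => (measurable_pi_apply j).const_mul _
    have hclm : ∀ i, Measurable (cl i) := fun i =>
      measurable_const.max ((hw i).min measurable_const)
    refine (hξ.measure_predictable_ge_le hc0 (fun i z => θ * cl i z)
      (fun i => (hclm i).const_mul _) ?_ (y := fun i => θ * (t * ‖p i‖)) ?_ ?_ _).trans ?_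
    · intro i z z' h
      simp only [cl]
      have : w i z = w i z' := Finset.sum_congr rfl fun j hj => by
        rw [h j (by simpa using hj)]
      rw [this]
    · intro i z
      rw [abs_mul, abs_of_pos hθ0]
      exact mul_le_mul_of_nonneg_left (abs_clip_le (by positivity)) hθ0.le
    · intro i
      have h1 : θ * (t * ‖p i‖) ≤ θ * (t * 1) := by
        have := hp1 i
        gcongr
      refine h1.trans ?_
      rw [hθ, inv_mul_le_iff₀ (by positivity)]
      nlinarith [mul_le_mul hc ht (by norm_num) hc0]
    · apply Real.exp_le_exp.2
      have e : ∑ i, (θ * (t * ‖p i‖)) ^ 2 = (θ * t) ^ 2 * ∑ i, ‖p i‖ ^ 2 := by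
        rw [Finset.mul_sum]
        exact Finset.sum_congr rfl fun i _ => by ring
      rw [e]
      have h1 : c * ((θ * t) ^ 2 * ∑ i, ‖p i‖ ^ 2) ≤ c * ((θ * t) ^ 2 * k) := by gcongr
      have h2 : c * ((θ * t) ^ 2 * k) - θ * k = -k / (4 * c * t ^ 2) := by
        rw [hθ]; field_simp; ring
      linarith
  refine (measureReal_mono hsub (measure_ne_top _ _)).trans ?_
  have u1 := measureReal_biUnion_finset_le (μ := μ) Finset.univ E₁
  have u2 := measureReal_biUnion_finset_le (μ := μ) Finset.univ E₂
  have u3 := Finset.sum_le_sum fun i (_ : i ∈ (Finset.univ : Finset (Fin n))) => b1 i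
  have u4 := Finset.sum_le_sum fun i (_ : i ∈ (Finset.univ : Finset (Fin n))) => b2 i
  simp only [Finset.sum_const, Finset.card_univ, Fintype.card_fin, nsmul_eq_mul] at u3 u4
  have v1 := measureReal_union_le (μ := μ)
    (((⋃ i ∈ Finset.univ, E₁ i) ∪ ⋃ i ∈ Finset.univ, E₂ i) ∪ E₃) E₄
  have v2 := measureReal_union_le (μ := μ)
    ((⋃ i ∈ Finset.univ, E₁ i) ∪ ⋃ i ∈ Finset.univ, E₂ i) E₃
  have v3 := measureReal_union_le (μ := μ)
    (⋃ i ∈ Finset.univ, E₁ i) (⋃ i ∈ Finset.univ, E₂ i)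
  linarith

/-! ### Bilinear forms on nets -/

section Bilinear

variable {n : ℕ} (Y : Matrix (Fin n) (Fin n) ℝ) (u u' v v' : EuclideanSpace ℝ (Fin n))

/-- `bilin Y u` as a linear map. -/
noncomputable def bilinRight : EuclideanSpace ℝ (Fin n) →ₗ[ℝ] ℝ :=
  (innerₛₗ ℝ u) ∘ₗ Matrix.toEuclideanLin Y

theorem bilinRight_apply : bilinRight Y u v = bilin Y u v := by
  rw [bilin_eq_inner]; rfl

theorem bilin_transpose : bilin Y.transpose v u = bilin Y u v := by
  unfold bilin
  rw [Finset.sum_comm]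
  refine Finset.sum_congr rfl fun i _ => Finset.sum_congr rfl fun j _ => ?_
  rw [Matrix.transpose_apply]; ring

theorem bilin_add_right : bilin Y u (v + v') = bilin Y u v + bilin Y u v' := by
  simp only [← bilinRight_apply, map_add]

theorem bilin_add_left : bilin Y (u + u') v = bilin Y u v + bilin Y u' v := by
  simp only [← bilin_transpose Y, bilin_add_right]

variable {Y} in
theorem abs_bilin_le_of_halfNet_right {V : Submodule ℝ (EuclideanSpace ℝ (Fin n))} {N : Finset V}
    (hN : IsHalfNet N) {M : ℝ} (h : ∀ v ∈ N, |bilin Y u v| ≤ M) (hv : v ∈ V) :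
    |bilin Y u v| ≤ 2 * M * ‖v‖ := by
  have := hN.norm_map_le ((bilinRight Y u) ∘ₗ V.subtype) (M := M)
    (fun v hv => by simpa [bilinRight_apply] using h v hv) ⟨v, hv⟩
  simpa [bilinRight_apply] using this

variable {Y} in
theorem abs_bilin_le_of_halfNet_left {U : Submodule ℝ (EuclideanSpace ℝ (Fin n))} {N : Finset U}
    (hN : IsHalfNet N) {M : ℝ} (h : ∀ u ∈ N, |bilin Y u v| ≤ M) (hu : u ∈ U) :
    |bilin Y u v| ≤ 2 * M * ‖u‖ := by
  rw [← bilin_transpose]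
  exact abs_bilin_le_of_halfNet_right v u hN (fun u hu => by rw [bilin_transpose]; exact h u hu) hu

end Bilinear

theorem natPow_five_le_exp (k : ℕ) : (5 : ℝ) ^ k ≤ Real.exp (2 * k) := by
  have h : (5 : ℝ) ≤ Real.exp 2 := by
    have h1 := Real.exp_one_gt_d9
    have h2 : Real.exp 2 = Real.exp 1 * Real.exp 1 := by rw [← Real.exp_add]; norm_num
    nlinarith
  calc (5 : ℝ) ^ k ≤ Real.exp 2 ^ k := by gcongr
    _ = _ := by rw [← Real.exp_nat_mul]; ring_nf

/-! ### Noise on sparse vectors against a subspace -/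

variable {Ω : Type*} [MeasurableSpace Ω] {μ : Measure Ω} [IsProbabilityMeasure μ] {c : ℝ}

/-- The failure probability in the bound for quadratic forms. -/
noncomputable def quadFail (n : ℕ) (c k t : ℝ) : ℝ :=
  4 * n * Real.exp (c - t) + Real.exp (-k / t ^ 2) + Real.exp (-k / (4 * c * t ^ 2))

theorem quadFail_nonneg (n : ℕ) (c k t : ℝ) : 0 ≤ quadFail n c k t := by
  unfold quadFail; positivity

/-- Linear forms in the noise, uniformly over the unit ball of a subspace. -/
theorem IsNoise.measure_exists_inner_gt_le {n : ℕ} {ξ : Fin n → Ω → ℝ} (hξ : IsNoise μ c ξ)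
    (hc : 1 ≤ c) (V : Submodule ℝ (EuclideanSpace ℝ (Fin n))) {k t : ℝ}
    (hk : (Module.finrank ℝ V : ℝ) ≤ k) (ht : 1 ≤ t) :
    μ.real {ω | ¬ ∀ v ∈ V, |∑ j, ξ j ω * v j| ≤ Real.sqrt ((8 * Real.exp c + 3) * k) * ‖v‖} ≤
      quadFail n c k t := by
  -- Projections of the coordinate vectors: the supremum over the unit ball of `V` is `‖∑ j, ξ j • p
  -- j‖`. They form a Parseval frame of `V`, so the hypothesis on inner products is an equality and
  -- `∑ ‖p j‖ ^ 2 = dim V`.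
  let p : Fin n → V := fun j => V.orthogonalProjectionOnto (EuclideanSpace.single j 1)
  have hpin : ∀ j (w : V), inner ℝ (p j) w = (w : EuclideanSpace ℝ (Fin n)) j := fun j w => by
    have := Submodule.inner_orthogonalProjectionOnto_eq_of_mem_right w
      (EuclideanSpace.single j (1 : ℝ))
    exact this.trans (by simp [EuclideanSpace.inner_single_left])
  have hnorm : ∀ w : V, ‖w‖ ^ 2 = ∑ j, ((w : EuclideanSpace ℝ (Fin n)) j) ^ 2 := fun w => by
    have h := EuclideanSpace.norm_sq_eq (w : EuclideanSpace ℝ (Fin n))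
    simp only [Real.norm_eq_abs, sq_abs] at h
    exact h
  have hp : ∀ i, ∑ j, (inner ℝ (p j) (p i)) ^ 2 ≤ ‖p i‖ ^ 2 := fun i => by
    rw [hnorm]
    exact le_of_eq (Finset.sum_congr rfl fun j _ => by rw [hpin])
  have hp1 : ∀ i, ‖p i‖ ≤ 1 := fun i =>
    (V.norm_orthogonalProjectionOnto_apply_le _).trans (by simp)
  have hpk : ∑ i, ‖p i‖ ^ 2 ≤ k := by
    refine le_trans (le_of_eq ?_) hk
    let f := stdOrthonormalBasis ℝ V
    have h1 : ∀ i, ‖p i‖ ^ 2 = ∑ a, ((f a : EuclideanSpace ℝ (Fin n)) i) ^ 2 := fun i => by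
      rw [← f.sum_sq_inner_left]
      exact Finset.sum_congr rfl fun a _ => by rw [hpin]
    simp_rw [h1]
    rw [Finset.sum_comm]
    simp_rw [← hnorm]
    simp
  refine (measureReal_mono ?_ (measure_ne_top _ _)).trans
    (hξ.measure_norm_sq_sum_gt_le hc p hp hp1 hpk ht)
  intro ω hω
  simp only [Set.mem_ofPred_eq, not_forall, not_le] at hω ⊢
  obtain ⟨v, hv, hlt⟩ := hω
  have h1 : ∑ j, ξ j ω * v j = inner ℝ (∑ j, ξ j ω • p j) (⟨v, hv⟩ : V) := by
    rw [sum_inner]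
    exact Finset.sum_congr rfl fun j _ => by
      have h := real_inner_smul_left (p j) (⟨v, hv⟩ : V) (ξ j ω)
      rw [hpin] at h
      exact h.symm
  have h2 := abs_real_inner_le_norm (∑ j, ξ j ω • p j) (⟨v, hv⟩ : V)
  rw [← h1] at h2
  have h3 : Real.sqrt ((8 * Real.exp c + 3) * k) < ‖∑ j, ξ j ω • p j‖ := by
    by_contra! hle
    have := mul_le_mul_of_nonneg_right hle (norm_nonneg (⟨v, hv⟩ : V))
    have h4 : ‖(⟨v, hv⟩ : V)‖ = ‖v‖ := rfl
    rw [h4] at this h2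
    linarith
  exact (Real.sqrt_lt' ((Real.sqrt_nonneg _).trans_lt h3)).1 h3

/-- The bilinear form of `Y` is at most `M` on pairs of a vector with at most `L` nonzero
coordinates and a vector in `V`. -/
def SparseBound {n : ℕ} (Y : Matrix (Fin n) (Fin n) ℝ)
    (V : Submodule ℝ (EuclideanSpace ℝ (Fin n))) (L : ℕ) (M : ℝ) : Prop :=
  ∀ u : EuclideanSpace ℝ (Fin n), (Finset.univ.filter fun i => u i ≠ 0).card ≤ L →
    ∀ v ∈ V, |bilin Y u v| ≤ M * ‖u‖ * ‖v‖

/-- The matrix of the noise variables. -/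
def noiseMatrix {n : ℕ} (Z : Fin n × Fin n → Ω → ℝ) (ω : Ω) : Matrix (Fin n) (Fin n) ℝ :=
  Matrix.of fun i j => Z (i, j) ω

/-- The span of `L` coordinate vectors. -/
def coordSpan {n L : ℕ} (σ : Fin L → Fin n) : Submodule ℝ (EuclideanSpace ℝ (Fin n)) :=
  Submodule.span ℝ (Set.range fun a => EuclideanSpace.single (σ a) (1 : ℝ))

theorem finrank_coordSpan_le {n L : ℕ} (σ : Fin L → Fin n) :
    Module.finrank ℝ (coordSpan σ) ≤ L := by
  have := finrank_range_le_card (R := ℝ) fun a => EuclideanSpace.single (σ a) (1 : ℝ)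
  exact this.trans (le_of_eq (Fintype.card_fin L))

/-- Spans are indexed by maps `Fin L → Fin n`, repetitions allowed, so that there are `n ^ L` of
them; unused slots get the default index `0`. -/
theorem exists_mem_coordSpan {n L : ℕ} (u : EuclideanSpace ℝ (Fin n)) (hn : 0 < n)
    (hu : (Finset.univ.filter fun i => u i ≠ 0).card ≤ L) :
    ∃ σ : Fin L → Fin n, u ∈ coordSpan σ := by
  classical
  let S := Finset.univ.filter fun i => u i ≠ 0
  let σ : Fin L → Fin n := fun a => if h : a.val < S.card then S.equivFin.symm ⟨a, h⟩ else ⟨0, hn⟩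
  refine ⟨σ, ?_⟩
  have hu' : u = ∑ i ∈ S, u i • EuclideanSpace.single i (1 : ℝ) := by
    ext j
    simp only [WithLp.ofLp_sum, Finset.sum_apply, WithLp.ofLp_smul, Pi.smul_apply, smul_eq_mul,
      PiLp.ofLp_single, Pi.single_apply, mul_ite, mul_one, mul_zero]
    rw [Finset.sum_ite_eq]
    split_ifs with h
    · rfl
    · simpa [S] using h
  rw [hu']
  refine Submodule.sum_mem _ fun i hi => Submodule.smul_mem _ _ (Submodule.subset_span ?_)
  refine ⟨⟨(S.equivFin ⟨i, hi⟩).val, lt_of_lt_of_le (S.equivFin ⟨i, hi⟩).2 hu⟩, ?_⟩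
  simp [σ]

/-- For a fixed `u` in the unit ball the contracted rows are again noise, and the Hanson–Wright
bound is uniform over `V`. The union runs over the `n ^ L` coordinate spans and a half-net of at
most `5 ^ L` points in each. -/
theorem IsNoise.measure_not_sparseBound_le {n : ℕ} {Z : Fin n × Fin n → Ω → ℝ}
    (hZ : IsNoise μ c Z) (hc : 1 ≤ c) (hn : 0 < n) (V : Submodule ℝ (EuclideanSpace ℝ (Fin n)))
    (L : ℕ) {k t : ℝ} (hk : (Module.finrank ℝ V : ℝ) ≤ k) (ht : 1 ≤ t) :
    μ.real {ω | ¬ SparseBound (noiseMatrix Z ω) V L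
      (2 * Real.sqrt ((8 * Real.exp c + 3) * k))} ≤ n ^ L * (5 ^ L * quadFail n c k t) := by
  classical
  have hnet : ∀ σ : Fin L → Fin n, ∃ N : Finset (coordSpan σ), IsHalfNet N ∧ N.card ≤ 5 ^ L :=
    fun σ => by
      obtain ⟨N, hN, hc⟩ := exists_halfNet (coordSpan σ)
      exact ⟨N, hN, hc.trans (Nat.pow_le_pow_right (by norm_num) (finrank_coordSpan_le σ))⟩
  choose N hN hNc using hnet
  set C := Real.sqrt ((8 * Real.exp c + 3) * k) with hC
  let B : EuclideanSpace ℝ (Fin n) → Set Ω := fun w =>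
    {ω | ¬ ∀ v ∈ V, |∑ j, (∑ i, w i * Z (i, j) ω) * v j| ≤ C * ‖v‖}
  have hB : ∀ w : EuclideanSpace ℝ (Fin n), ‖w‖ ≤ 1 → μ.real (B w) ≤ quadFail n c k t :=
    fun w hw => by
      refine (hZ.rowSum (by linarith) w ?_).measure_exists_inner_gt_le hc V hk ht
      have h := EuclideanSpace.norm_sq_eq w
      simp only [Real.norm_eq_abs, sq_abs] at h
      rw [← h]
      exact pow_le_one₀ (norm_nonneg _) hw
  have hbil : ∀ (w v : EuclideanSpace ℝ (Fin n)) ω,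
      ∑ j, (∑ i, w i * Z (i, j) ω) * v j = bilin (noiseMatrix Z ω) w v := fun w v ω => by
    unfold bilin
    rw [Finset.sum_comm]
    exact Finset.sum_congr rfl fun j _ => by rw [Finset.sum_mul]; rfl
  have hsub : {ω | ¬ SparseBound (noiseMatrix Z ω) V L (2 * C)} ⊆
      ⋃ σ ∈ (Finset.univ : Finset (Fin L → Fin n)), ⋃ w : coordSpan σ, ⋃ _ : w ∈ N σ, B w := by
    intro ω hω
    by_contra hcon
    simp only [Set.mem_iUnion, Finset.mem_univ, exists_prop, true_and, not_exists, not_and, B,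
      Set.mem_ofPred_eq, not_not] at hcon
    refine hω fun u hu v hv => ?_
    obtain ⟨σ, hσ⟩ := exists_mem_coordSpan u hn hu
    have h := abs_bilin_le_of_halfNet_left (Y := noiseMatrix Z ω) u v (hN σ) (M := C * ‖v‖)
      (fun w hw => by rw [← hbil]; exact hcon σ w hw v hv) hσ
    linarith
  refine (measureReal_mono hsub (measure_ne_top _ _)).trans
    ((measureReal_biUnion_finset_le _ _).trans ?_)
  have h1 : ∀ σ ∈ (Finset.univ : Finset (Fin L → Fin n)), μ.real (⋃ w : coordSpan σ, ⋃ _ : w ∈ N σ, B w) ≤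
      5 ^ L * quadFail n c k t := fun σ _ => by
    refine (measureReal_biUnion_finset_le _ _).trans ?_
    refine (Finset.sum_le_sum fun (w : coordSpan σ) hw => hB w ((hN σ).1 w hw)).trans ?_
    rw [Finset.sum_const, nsmul_eq_mul]
    have := quadFail_nonneg n c k t
    gcongr
    exact_mod_cast hNc σ
  refine (Finset.sum_le_sum h1).trans (le_of_eq ?_)
  simp

/-! ### Splitting vectors into large and small coordinates -/

section Splitting

variable {n : ℕ}

/-- The part of `u` with coordinates of modulus larger than `1 / √L`. -/
noncomputable def peakPart (L : ℕ) (u : EuclideanSpace ℝ (Fin n)) : EuclideanSpace ℝ (Fin n) :=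
  WithLp.toLp 2 fun i => if 1 < L * u i ^ 2 then u i else 0

/-- The part of `u` with coordinates of modulus at most `1 / √L`. -/
noncomputable def flatPart (L : ℕ) (u : EuclideanSpace ℝ (Fin n)) : EuclideanSpace ℝ (Fin n) :=
  WithLp.toLp 2 fun i => if 1 < L * u i ^ 2 then 0 else u i

variable (L : ℕ) (u v : EuclideanSpace ℝ (Fin n))

theorem peakPart_add_flatPart : peakPart L u + flatPart L u = u := by
  ext i
  simp only [peakPart, flatPart, PiLp.add_apply]
  split_ifs <;> simp

theorem norm_sq_eq_sum : ‖u‖ ^ 2 = ∑ i, u i ^ 2 := by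
  have h := EuclideanSpace.norm_sq_eq u
  simpa only [Real.norm_eq_abs, sq_abs] using h

variable {u v} in
theorem sum_sq_le_one (hu : ‖u‖ ≤ 1) : ∑ i, u i ^ 2 ≤ 1 := by
  rw [← norm_sq_eq_sum]
  exact pow_le_one₀ (norm_nonneg _) hu

theorem norm_peakPart_le : ‖peakPart L u‖ ≤ ‖u‖ := by
  refine le_of_sq_le_sq ?_ (norm_nonneg _)
  rw [norm_sq_eq_sum, norm_sq_eq_sum]
  refine Finset.sum_le_sum fun i _ => ?_
  simp only [peakPart]
  split_ifs
  · rfl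
  · simpa using sq_nonneg (u i)

theorem norm_flatPart_le : ‖flatPart L u‖ ≤ ‖u‖ := by
  refine le_of_sq_le_sq ?_ (norm_nonneg _)
  rw [norm_sq_eq_sum, norm_sq_eq_sum]
  refine Finset.sum_le_sum fun i _ => ?_
  simp only [flatPart]
  split_ifs
  · simpa using sq_nonneg (u i)
  · rfl

theorem abs_flatPart_le (hL : 1 ≤ L) (i : Fin n) : |flatPart L u i| ≤ (Real.sqrt L)⁻¹ := by
  have hL0 : (0 : ℝ) < L := by exact_mod_cast hL
  simp only [flatPart]
  split_ifs with h
  · simp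
  · rw [not_lt] at h
    rw [← Real.sqrt_inv]
    refine Real.abs_le_sqrt ?_
    rw [← one_div, le_div_iff₀ hL0]
    linarith

/-- The coordinates of modulus larger than `1 / √L`. -/
noncomputable def peakSet : Finset (Fin n) := Finset.univ.filter fun i => 1 < L * u i ^ 2

variable {u} in
theorem card_peakSet_le (hu : ‖u‖ ≤ 1) : (peakSet L u).card ≤ L := by
  have h1 : ((peakSet L u).card : ℝ) ≤ ∑ i ∈ peakSet L u, L * u i ^ 2 := by
    rw [← nsmul_one, ← Finset.sum_const]
    refine Finset.sum_le_sum fun i hi => ?_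
    exact (Finset.mem_filter.1 hi).2.le
  have h2 : ∑ i ∈ peakSet L u, L * u i ^ 2 ≤ ∑ i, L * u i ^ 2 :=
    Finset.sum_le_sum_of_subset_of_nonneg (Finset.subset_univ _) fun _ _ _ => by positivity
  rw [← Finset.mul_sum Finset.univ] at h2
  have h3 := mul_le_mul_of_nonneg_left (sum_sq_le_one hu) (Nat.cast_nonneg (α := ℝ) L)
  have h4 : ((peakSet L u).card : ℝ) ≤ L := by linarith
  exact_mod_cast h4

variable {u} in
theorem card_support_peakPart_le (hu : ‖u‖ ≤ 1) :
    (Finset.univ.filter fun i => peakPart L u i ≠ 0).card ≤ L := by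
  refine (Finset.card_le_card ?_).trans (card_peakSet_le L hu)
  intro i
  simp only [Finset.mem_filter, Finset.mem_univ, true_and, peakPart, peakSet]
  intro h
  by_contra hc
  simp [hc] at h

variable {u v} in
-- At most `L` coordinates exceed `1 / √L` on each side, so discrepancy on one rectangle suffices.
theorem abs_bilin_peakPart_le {Y : Matrix (Fin n) (Fin n) ℝ} {K : ℝ} (hK : 0 ≤ K)
    (hY : Discrepancy K L (fun i j => Y i j)) (hu : ‖u‖ ≤ 1) (hv : ‖v‖ ≤ 1) :
    |bilin Y (peakPart L u) (peakPart L v)| ≤ (K + 2) * (L : ℝ) ^ 2 := by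
  have hcoord : ∀ (w : EuclideanSpace ℝ (Fin n)), ‖w‖ ≤ 1 → ∀ i, |w i| ≤ 1 := fun w hw i =>
    (PiLp.norm_apply_le w i).trans hw
  have h1 : |bilin Y (peakPart L u) (peakPart L v)| ≤
      ∑ i ∈ peakSet L u, ∑ j ∈ peakSet L v, |Y i j| := by
    have e : bilin Y (peakPart L u) (peakPart L v) =
        ∑ i ∈ peakSet L u, ∑ j ∈ peakSet L v, u i * Y i j * v j := by
      unfold bilin peakSet
      rw [Finset.sum_filter]
      refine Finset.sum_congr rfl fun i _ => ?_
      simp only [peakPart]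
      split_ifs with h
      · rw [Finset.sum_filter]
        refine Finset.sum_congr rfl fun j _ => ?_
        split_ifs <;> simp
      · simp
    rw [e]
    refine (Finset.abs_sum_le_sum_abs _ _).trans (Finset.sum_le_sum fun i _ => ?_)
    refine (Finset.abs_sum_le_sum_abs _ _).trans (Finset.sum_le_sum fun j _ => ?_)
    rw [abs_mul, abs_mul]
    calc |u i| * |Y i j| * |v j| ≤ 1 * |Y i j| * 1 := by
          gcongr
          · exact hcoord u hu i
          · exact hcoord v hv j
      _ = |Y i j| := by ring
  have h2 := hY (peakSet L u) (peakSet L v)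
  have h3 : ((peakSet L u).card : ℝ) ≤ L := by exact_mod_cast card_peakSet_le L hu
  have h4 : ((peakSet L v).card : ℝ) ≤ L := by exact_mod_cast card_peakSet_le L hv
  calc _ ≤ K * ((peakSet L u).card * (peakSet L v).card) +
        ((peakSet L u).card + (peakSet L v).card) * L := h1.trans h2
    _ ≤ K * (L * L) + (L + L) * L := by gcongr
    _ = _ := by ring

/-- The coefficients of the light pairs of `u` and `v` on scale `s`. -/
noncomputable def lightCoeff (s : ℝ) (p : Fin n × Fin n) : ℝ :=
  if 1 < |u p.1| * |v p.2| * s then 0 else u p.1 * v p.2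

variable {u v} in
theorem sum_lightCoeff_sq_le (s : ℝ) (hu : ‖u‖ ≤ 1) (hv : ‖v‖ ≤ 1) :
    ∑ p, lightCoeff u v s p ^ 2 ≤ 1 := by
  calc ∑ p, lightCoeff u v s p ^ 2 ≤ ∑ p : Fin n × Fin n, u p.1 ^ 2 * v p.2 ^ 2 := by
        refine Finset.sum_le_sum fun p _ => ?_
        unfold lightCoeff
        split_ifs
        · rw [zero_pow two_ne_zero]; positivity
        · exact le_of_eq (by ring)
    _ = (∑ i, u i ^ 2) * ∑ j, v j ^ 2 := by
        rw [Fintype.sum_prod_type, Finset.sum_mul_sum]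
    _ ≤ 1 * 1 := by
        gcongr
        · exact sum_sq_le_one hu
        · exact sum_sq_le_one hv
    _ = 1 := one_mul 1

theorem abs_lightCoeff_le {s : ℝ} (hs : 0 ≤ s) (p : Fin n × Fin n) :
    |s * lightCoeff u v s p| ≤ 1 := by
  unfold lightCoeff
  split_ifs with h
  · simp
  · rw [abs_mul, abs_mul, abs_of_nonneg hs]
    linarith

variable {u v} in
-- Light pairs are covered by the hypothesis `hτ`. Heavy pairs use the Kahn–Szemerédi bound with cap
-- `h = 1 / √L`, exactly the cap for which `h ^ 2 * L = 1`.
theorem abs_bilin_flatPart_le {Y : Matrix (Fin n) (Fin n) ℝ} {K s τ : ℝ} (hK : 0 ≤ K)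
    (hL : 1 ≤ L) (hs : 0 ≤ s) (hY : Discrepancy K L (fun i j => Y i j)) (hu : ‖u‖ ≤ 1)
    (hv : ‖v‖ ≤ 1) (hτ : |∑ p, lightCoeff (flatPart L u) (flatPart L v) s p * Y p.1 p.2| ≤ τ) :
    |bilin Y (flatPart L u) (flatPart L v)| ≤ τ + (16 * K + 16) * s := by
  set x := flatPart L u with hx
  set y := flatPart L v with hy
  have hL0 : (0 : ℝ) < L := by exact_mod_cast hL
  have hheavy := sum_heavy_le hY hK hL0.le (h := (Real.sqrt L)⁻¹) (by positivity)
    (by rw [inv_pow, Real.sq_sqrt hL0.le, inv_mul_cancel₀ hL0.ne']) hs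
    (x := fun i => |x i|) (y := fun j => |y j|) (fun i => abs_nonneg _) (fun j => abs_nonneg _)
    (by simpa using sum_sq_le_one ((norm_flatPart_le L u).trans hu))
    (by simpa using sum_sq_le_one ((norm_flatPart_le L v).trans hv))
    (fun i => abs_flatPart_le L u hL i) (fun j => abs_flatPart_le L v hL j)
  have e : bilin Y x y = ∑ p, lightCoeff x y s p * Y p.1 p.2 +
      ∑ i, ∑ j, (if 1 < |x i| * |y j| * s then x i * y j * Y i j else 0) := by
    rw [Fintype.sum_prod_type, ← Finset.sum_add_distrib]
    unfold bilin
    refine Finset.sum_congr rfl fun i _ => ?_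
    rw [← Finset.sum_add_distrib]
    refine Finset.sum_congr rfl fun j _ => ?_
    unfold lightCoeff
    split_ifs <;> ring
  have h2 : |∑ i, ∑ j, (if 1 < |x i| * |y j| * s then x i * y j * Y i j else 0)| ≤
      (16 * K + 16) * s := by
    refine le_trans ?_ hheavy
    refine (Finset.abs_sum_le_sum_abs _ _).trans (Finset.sum_le_sum fun i _ => ?_)
    refine (Finset.abs_sum_le_sum_abs _ _).trans (Finset.sum_le_sum fun j _ => ?_)
    split_ifs
    · rw [abs_mul, abs_mul]
    · simp
  rw [e]
  exact (abs_add_le _ _).trans (add_le_add hτ h2)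

end Splitting

/-! ### Noise on a pair of fixed subspaces -/

/-- The bilinear form of `Y` is at most `M` on unit vectors of `U` and `V`. -/
def SubspaceBound {n : ℕ} (Y : Matrix (Fin n) (Fin n) ℝ)
    (U V : Submodule ℝ (EuclideanSpace ℝ (Fin n))) (M : ℝ) : Prop :=
  ∀ u ∈ U, ∀ v ∈ V, |bilin Y u v| ≤ M * ‖u‖ * ‖v‖

/-- The constant in the uniform bound of the noise on subspaces. -/
noncomputable def subspaceConst (c : ℝ) : ℝ :=
  4 * (18 * c + 40 + 4 * Real.sqrt (8 * Real.exp c + 3))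

/-- On net points the flat-flat part costs `17 c + 37`, the peak-peak part `c + 3` (as `L ^ 2 ≤ √k`)
and each sparse part `2 √(8 exp c + 3)`, all in units of `√k`. The outer factor `4` is the price of
two half-nets. -/
theorem subspaceBound_of_halfNets {n : ℕ} {Y : Matrix (Fin n) (Fin n) ℝ} {c : ℝ} (hc : 1 ≤ c)
    {U V : Submodule ℝ (EuclideanSpace ℝ (Fin n))} {L : ℕ} (hL : 1 ≤ L) {k : ℝ}
    (hk : (L : ℝ) ^ 4 ≤ k) {N : Finset U} {N' : Finset V} (hN : IsHalfNet N) (hN' : IsHalfNet N')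
    (hY : Discrepancy (c + 1) L (fun i j => Y i j))
    (hV : SparseBound Y V L (2 * Real.sqrt ((8 * Real.exp c + 3) * k)))
    (hU : SparseBound Y.transpose U L (2 * Real.sqrt ((8 * Real.exp c + 3) * k)))
    (hlight : ∀ u ∈ N, ∀ v ∈ N', |∑ p, lightCoeff (flatPart L (u : EuclideanSpace ℝ (Fin n)))
      (flatPart L (v : EuclideanSpace ℝ (Fin n))) (Real.sqrt k) p * Y p.1 p.2| ≤
        (c + 5) * Real.sqrt k) :
    SubspaceBound Y U V (subspaceConst c * Real.sqrt k) := by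
  have hk0 : 0 ≤ k := le_trans (by positivity) hk
  set s := Real.sqrt k with hs
  have hs0 : 0 ≤ s := Real.sqrt_nonneg _
  set a := Real.sqrt (8 * Real.exp c + 3) with ha
  have ha0 : 0 ≤ a := Real.sqrt_nonneg _
  have hM : Real.sqrt ((8 * Real.exp c + 3) * k) = a * s := Real.sqrt_mul (by positivity) k
  rw [hM] at hV hU
  have hLs : (L : ℝ) ^ 2 ≤ s := by
    refine Real.le_sqrt_of_sq_le ?_
    rw [← pow_mul]
    exact hk
  have hnet : ∀ (u : U) (_ : u ∈ N) (v : V) (_ : v ∈ N'), |bilin Y u v| ≤ (18 * c + 40 + 4 * a) * s := by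
    intro u hu v hv
    have hu1 : ‖(u : EuclideanSpace ℝ (Fin n))‖ ≤ 1 := hN.1 u hu
    have hv1 : ‖(v : EuclideanSpace ℝ (Fin n))‖ ≤ 1 := hN'.1 v hv
    set u' : EuclideanSpace ℝ (Fin n) := (u : EuclideanSpace ℝ (Fin n)) with hu'
    set v' : EuclideanSpace ℝ (Fin n) := (v : EuclideanSpace ℝ (Fin n)) with hv'
    have h1 := abs_bilin_flatPart_le L (by linarith) hL hs0 hY hu1 hv1 (hlight u hu v hv)
    have h2 := abs_bilin_peakPart_le L (by linarith) hY hu1 hv1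
    have h3 := hV (peakPart L u') (card_support_peakPart_le L hu1) v' v.2
    have h4 := hU (peakPart L v') (card_support_peakPart_le L hv1) u' u.2
    rw [bilin_transpose] at h4
    have hM0 : 0 ≤ 2 * (a * s) := by positivity
    have h3' : 2 * (a * s) * ‖peakPart L u'‖ * ‖v'‖ ≤ 2 * (a * s) * 1 * 1 := by
      have := (norm_peakPart_le L u').trans hu1
      gcongr
    have h4' : 2 * (a * s) * ‖peakPart L v'‖ * ‖u'‖ ≤ 2 * (a * s) * 1 * 1 := by
      have := (norm_peakPart_le L v').trans hv1
      gcongr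
    have e1 := bilin_add_left Y (peakPart L u') (flatPart L u') v'
    have e2 := bilin_add_right Y (flatPart L u') (peakPart L v') (flatPart L v')
    have e3 := bilin_add_left Y (peakPart L u') (flatPart L u') (peakPart L v')
    rw [peakPart_add_flatPart] at e1 e2 e3
    -- Inclusion–exclusion leaves the full vectors `u'`, `v'` opposite the peaks: they lie in the
    -- subspaces, whereas their flat parts need not.
    have e : bilin Y u' v' = bilin Y (flatPart L u') (flatPart L v') +
        bilin Y (peakPart L u') v' + bilin Y u' (peakPart L v') -
          bilin Y (peakPart L u') (peakPart L v') := by linarith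
    have h2' : (c + 1 + 2) * (L : ℝ) ^ 2 ≤ (c + 1 + 2) * s := by gcongr
    rw [abs_le] at h1 h2 h3 h4 ⊢
    constructor <;> rw [e] <;> linarith
  intro u hu v hv
  have h1 : ∀ v ∈ N', |bilin Y u v| ≤ 2 * ((18 * c + 40 + 4 * a) * s) * ‖u‖ := fun v hv =>
    abs_bilin_le_of_halfNet_left u v hN (fun u hu => hnet u hu v hv) hu
  refine (abs_bilin_le_of_halfNet_right u v hN' h1 hv).trans (le_of_eq ?_)
  unfold subspaceConst
  ring

variable {Ω : Type*} [MeasurableSpace Ω] {μ : Measure Ω} [IsProbabilityMeasure μ] {c : ℝ}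

/-- With high probability the noise is of order `√k` on two fixed subspaces of dimension at
most `k`. -/
theorem IsNoise.measure_not_subspaceBound_le {n : ℕ} {Z : Fin n × Fin n → Ω → ℝ}
    (hZ : IsNoise μ c Z) (hc : 1 ≤ c) (hn : 0 < n)
    (U V : Submodule ℝ (EuclideanSpace ℝ (Fin n))) {L k : ℕ} (hL : 1 ≤ L) (hk : L ^ 4 ≤ k)
    (hU : Module.finrank ℝ U ≤ k) (hV : Module.finrank ℝ V ≤ k) {t : ℝ} (ht : 1 ≤ t) :
    μ.real {ω | Discrepancy (c + 1) L (fun i j => Z (i, j) ω) ∧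
      ¬ SubspaceBound (noiseMatrix Z ω) U V (subspaceConst c * Real.sqrt k)} ≤
      2 * (n ^ L * (5 ^ L * quadFail n c k t)) + 2 * Real.exp (-k) := by
  classical
  obtain ⟨N, hN, hNc⟩ := exists_halfNet U
  obtain ⟨N', hN', hNc'⟩ := exists_halfNet V
  set s := Real.sqrt k with hs
  have hs0 : 0 ≤ s := Real.sqrt_nonneg _
  have hss : s ^ 2 = k := Real.sq_sqrt (Nat.cast_nonneg k)
  have hZt : IsNoise μ c (fun p => Z (Prod.swap p)) := hZ.precomp Prod.swap_injective
  have hkU : (Module.finrank ℝ U : ℝ) ≤ (k : ℝ) := by exact_mod_cast hU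
  have hkV : (Module.finrank ℝ V : ℝ) ≤ (k : ℝ) := by exact_mod_cast hV
  have b1 := hZ.measure_not_sparseBound_le hc hn V L hkV ht
  have b2 := hZt.measure_not_sparseBound_le hc hn U L hkU ht
  let G : U × V → Fin n × Fin n → ℝ := fun q =>
    lightCoeff (flatPart L (q.1 : EuclideanSpace ℝ (Fin n)))
      (flatPart L (q.2 : EuclideanSpace ℝ (Fin n))) s
  let B : U × V → Set Ω := fun q => {ω | (c + 5) * s ≤ |∑ p, G q p * Z p ω|}
  -- Chernoff at the scale `s = √k`, where light coefficients are admissible by definition. The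
  -- exponent `-5 k` beats the `exp (4 k)` pairs of net points.
  have hB : ∀ q ∈ N ×ˢ N', μ.real (B q) ≤ 2 * Real.exp (-5 * k) := by
    intro q hq
    rw [Finset.mem_product] at hq
    have hu := (norm_flatPart_le L (q.1 : EuclideanSpace ℝ (Fin n))).trans (hN.1 q.1 hq.1)
    have hv := (norm_flatPart_le L (q.2 : EuclideanSpace ℝ (Fin n))).trans (hN'.1 q.2 hq.2)
    refine (hZ.measure_abs_sum_ge_le Finset.univ (G q) hs0
      (fun p _ => abs_lightCoeff_le _ _ hs0 p) _).trans ?_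
    have h1 := sum_lightCoeff_sq_le s hu hv
    have h2 : c * s ^ 2 * ∑ p, G q p ^ 2 ≤ c * s ^ 2 * 1 := by gcongr
    gcongr 2 * Real.exp ?_
    have h3 : s * ((c + 5) * s) = (c + 5) * s ^ 2 := by ring
    rw [h3]
    rw [hss] at h2 ⊢
    linarith
  have b3 : μ.real (⋃ q ∈ N ×ˢ N', B q) ≤ 2 * Real.exp (-k) := by
    refine (measureReal_biUnion_finset_le _ _).trans ((Finset.sum_le_sum hB).trans ?_)
    rw [Finset.sum_const, nsmul_eq_mul, Finset.card_product, Nat.cast_mul]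
    have hc1 : (N.card : ℝ) ≤ Real.exp (2 * k) := by
      refine le_trans ?_ (natPow_five_le_exp k)
      exact_mod_cast hNc.trans (Nat.pow_le_pow_right (by norm_num) hU)
    have hc2 : (N'.card : ℝ) ≤ Real.exp (2 * k) := by
      refine le_trans ?_ (natPow_five_le_exp k)
      exact_mod_cast hNc'.trans (Nat.pow_le_pow_right (by norm_num) hV)
    calc (N.card : ℝ) * N'.card * (2 * Real.exp (-5 * k)) ≤
          Real.exp (2 * k) * Real.exp (2 * k) * (2 * Real.exp (-5 * k)) := by gcongr
      _ = 2 * Real.exp (-k) := by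
          rw [mul_left_comm, ← Real.exp_add, ← Real.exp_add]
          congr 2; ring
  have hsub : {ω | Discrepancy (c + 1) L (fun i j => Z (i, j) ω) ∧
      ¬ SubspaceBound (noiseMatrix Z ω) U V (subspaceConst c * s)} ⊆
      ({ω | ¬ SparseBound (noiseMatrix Z ω) V L (2 * Real.sqrt ((8 * Real.exp c + 3) * k))} ∪
      {ω | ¬ SparseBound (noiseMatrix (fun p => Z (Prod.swap p)) ω) U L
        (2 * Real.sqrt ((8 * Real.exp c + 3) * k))}) ∪ ⋃ q ∈ N ×ˢ N', B q := by
    rintro ω ⟨hD, hS⟩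
    by_contra hcon
    simp only [Set.mem_union, Set.mem_ofPred_eq, not_or, not_not, Set.mem_iUnion, exists_prop,
      not_exists, not_and, B, not_le] at hcon
    obtain ⟨⟨h1, h2⟩, h3⟩ := hcon
    refine hS (subspaceBound_of_halfNets hc hL (by exact_mod_cast hk) hN hN' hD h1 h2 ?_)
    intro u hu v hv
    exact (h3 (u, v) (Finset.mem_product.2 ⟨hu, hv⟩)).le
  refine (measureReal_mono hsub (measure_ne_top _ _)).trans ?_
  have v1 := measureReal_union_le (μ := μ)
    ({ω | ¬ SparseBound (noiseMatrix Z ω) V L (2 * Real.sqrt ((8 * Real.exp c + 3) * k))} ∪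
      {ω | ¬ SparseBound (noiseMatrix (fun p => Z (Prod.swap p)) ω) U L
        (2 * Real.sqrt ((8 * Real.exp c + 3) * k))}) (⋃ q ∈ N ×ˢ N', B q)
  have v2 := measureReal_union_le (μ := μ)
    {ω | ¬ SparseBound (noiseMatrix Z ω) V L (2 * Real.sqrt ((8 * Real.exp c + 3) * k))}
    {ω | ¬ SparseBound (noiseMatrix (fun p => Z (Prod.swap p)) ω) U L
        (2 * Real.sqrt ((8 * Real.exp c + 3) * k))}
  linarith

/-! ### The linear predictor -/

section Predictor

variable {n m : ℕ} (x : Fin n → Fin n → EuclideanSpace ℝ (Fin m))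

theorem linearPredictor_sub (Θ Θ' : Matrix (Fin n) (Fin n) ℝ) (β β' : EuclideanSpace ℝ (Fin m)) :
    linearPredictor x Θ' β' - linearPredictor x Θ β =
      (Θ' - Θ) + linearPredictor x 0 (β' - β) := by
  ext i j
  simp only [linearPredictor, Matrix.sub_apply, Matrix.add_apply, Matrix.of_apply,
    Matrix.zero_apply, PiLp.sub_apply, mul_sub, Finset.sum_sub_distrib]
  ring

theorem linearPredictor_convex (q q' : Matrix (Fin n) (Fin n) ℝ × EuclideanSpace ℝ (Fin m))
    (t : ℝ) : linearPredictor x ((1 - t) • q + t • q').1 ((1 - t) • q + t • q').2 =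
      linearPredictor x q.1 q.2 +
        t • (linearPredictor x q'.1 q'.2 - linearPredictor x q.1 q.2) := by
  have h : ∀ i j, ∑ k, x i j k * ((1 - t) * q.2 k + t * q'.2 k) =
      (1 - t) * ∑ k, x i j k * q.2 k + t * ∑ k, x i j k * q'.2 k := fun i j => by
    rw [Finset.mul_sum, Finset.mul_sum, ← Finset.sum_add_distrib]
    exact Finset.sum_congr rfl fun k _ => by ring
  ext i j
  simp only [linearPredictor, Matrix.sub_apply, Matrix.add_apply, Matrix.of_apply,
    Matrix.smul_apply, smul_eq_mul, Prod.fst_add, Prod.snd_add, Prod.smul_fst, Prod.smul_snd,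
    PiLp.add_apply, PiLp.smul_apply, h]
  ring

theorem abs_linearPredictor_zero_le {Kx : ℝ} (hx : ∀ i j, ‖x i j‖ ≤ Kx)
    (δ : EuclideanSpace ℝ (Fin m)) (i j : Fin n) : |linearPredictor x 0 δ i j| ≤ Kx * ‖δ‖ := by
  have h1 : linearPredictor x 0 δ i j = inner ℝ (x i j) δ := by
    simp only [linearPredictor, Matrix.of_apply, Matrix.zero_apply, zero_add, PiLp.inner_apply,
      RCLike.inner_apply, conj_trivial]
    exact Finset.sum_congr rfl fun k _ => mul_comm _ _
  rw [h1]
  exact (abs_real_inner_le_norm _ _).trans (by gcongr; exact hx i j)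

end Predictor

/-! ### Bregman divergences and first-order conditions -/

section Bregman

variable {n : ℕ} (b : ℝ → ℝ) (H₀ H H' : Matrix (Fin n) (Fin n) ℝ)

/-- The sum of the entrywise Bregman divergences of `b` from `H₀`. -/
noncomputable def bregSum : ℝ :=
  ∑ i, ∑ j, (b (H i j) - b (H₀ i j) - deriv b (H₀ i j) * (H i j - H₀ i j))

/-- The entrywise difference of the derivative of `b`. -/
noncomputable def linkDiff : Matrix (Fin n) (Fin n) ℝ :=
  Matrix.of fun i j => deriv b (H i j) - deriv b (H₀ i j)

variable {b}

theorem bregSum_nonneg (hb : Differentiable ℝ b) (hm : Monotone (deriv b)) :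
    0 ≤ bregSum b H₀ H :=
  Finset.sum_nonneg fun i _ => Finset.sum_nonneg fun j _ => by
    linarith [tangent_le hb hm (H₀ i j) (H i j)]

variable (b) in
theorem bregSum_self : bregSum b H₀ H₀ = 0 := by simp [bregSum]

/-- The gradient inequality for the convex function `bregSum b H₀`, whose gradient at `H` is the
link difference. -/
theorem bregSum_add_le (hb : Differentiable ℝ b) (hm : Monotone (deriv b)) :
    bregSum b H₀ H + matInner (linkDiff b H₀ H) (H' - H) ≤ bregSum b H₀ H' := by
  unfold bregSum matInner
  rw [← Finset.sum_add_distrib]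
  refine Finset.sum_le_sum fun i _ => ?_
  rw [← Finset.sum_add_distrib]
  refine Finset.sum_le_sum fun j _ => ?_
  have := tangent_le hb hm (H i j) (H' i j)
  simp only [linkDiff, Matrix.of_apply, Matrix.sub_apply]
  linarith

theorem bregSum_le_matInner (hb : Differentiable ℝ b) (hm : Monotone (deriv b)) :
    bregSum b H₀ H ≤ matInner (linkDiff b H₀ H) (H - H₀) := by
  have h := bregSum_add_le H₀ H H₀ hb hm
  rw [bregSum_self, matInner_sub_right] at h
  rw [matInner_sub_right]
  linarith

theorem linkDiff_mul_nonneg (hm : Monotone (deriv b)) (i j : Fin n) :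
    0 ≤ linkDiff b H₀ H i j * (H i j - H₀ i j) := by
  simp only [linkDiff, Matrix.of_apply]
  rcases le_total (H₀ i j) (H i j) with h | h
  · exact mul_nonneg (sub_nonneg.2 (hm h)) (sub_nonneg.2 h)
  · exact mul_nonneg_of_nonpos_of_nonpos (sub_nonpos.2 (hm h)) (sub_nonpos.2 h)

theorem matInner_linkDiff_nonneg (hm : Monotone (deriv b)) :
    0 ≤ matInner (linkDiff b H₀ H) (H - H₀) :=
  Finset.sum_nonneg fun i _ => Finset.sum_nonneg fun j _ => linkDiff_mul_nonneg H₀ H hm i j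

theorem hasDerivAt_bregSum_line (hb : Differentiable ℝ b) (Δ : Matrix (Fin n) (Fin n) ℝ) :
    HasDerivAt (fun t : ℝ => bregSum b H₀ (H + t • Δ)) (matInner (linkDiff b H₀ H) Δ) 0 := by
  unfold bregSum matInner
  refine HasDerivAt.fun_sum fun i _ => HasDerivAt.fun_sum fun j _ => ?_
  simp only [Matrix.add_apply, Matrix.smul_apply, smul_eq_mul, linkDiff, Matrix.of_apply]
  have h1 : HasDerivAt (fun t : ℝ => H i j + t * Δ i j) (Δ i j) 0 := by
    simpa using ((hasDerivAt_id (0 : ℝ)).mul_const (Δ i j)).const_add (H i j)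
  have h2 : HasDerivAt (fun t : ℝ => b (H i j + t * Δ i j)) (deriv b (H i j) * Δ i j) 0 := by
    have h3 : HasDerivAt b (deriv b (H i j)) (H i j + 0 * Δ i j) := by
      simpa using (hb (H i j)).hasDerivAt
    exact h3.comp (0 : ℝ) h1
  have h4 := (h2.sub_const (b (H₀ i j))).sub ((h1.sub_const (H₀ i j)).const_mul (deriv b (H₀ i j)))
  rw [sub_mul]
  exact h4

theorem nonneg_of_le_add_mul {φ : ℝ → ℝ} {d a : ℝ} (hφ : HasDerivAt φ d 0)
    (h : ∀ t ∈ Set.Ioc (0 : ℝ) 1, φ 0 ≤ φ t + t * a) : 0 ≤ d + a := by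
  have hs := hφ.tendsto_slope_zero_right
  have h1 : Tendsto (fun t => t⁻¹ • (φ (0 + t) - φ 0) + a) (𝓝[>] 0) (𝓝 (d + a)) :=
    hs.add_const a
  refine ge_of_tendsto h1 ?_
  filter_upwards [Ioc_mem_nhdsGT (zero_lt_one' ℝ)] with t ht
  have h2 := h t ht
  have h3 : 0 ≤ t⁻¹ * (φ t - φ 0 + t * a) :=
    mul_nonneg (inv_nonneg.2 ht.1.le) (by linarith)
  have h4 : t⁻¹ * (φ t - φ 0 + t * a) = t⁻¹ * (φ t - φ 0) + a := by
    have := ht.1.ne'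
    field_simp
  rw [zero_add, smul_eq_mul]
  linarith

/-- First-order optimality along a segment, up to a linear penalty. -/
theorem first_order_of_segment (hb : Differentiable ℝ b) (Y Δ : Matrix (Fin n) (Fin n) ℝ) {a : ℝ}
    (h : ∀ t ∈ Set.Ioc (0 : ℝ) 1, bregSum b H₀ H - matInner Y H ≤
      bregSum b H₀ (H + t • Δ) - matInner Y (H + t • Δ) + t * a) :
    0 ≤ matInner (linkDiff b H₀ H - Y) Δ + a := by
  have h1 : HasDerivAt (fun t : ℝ => matInner Y (H + t • Δ)) (matInner Y Δ) 0 := by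
    have : (fun t : ℝ => matInner Y (H + t • Δ)) = fun t => matInner Y H + t * matInner Y Δ := by
      ext t
      rw [matInner_add_right, matInner_smul_right]
    rw [this]
    simpa using ((hasDerivAt_id (0 : ℝ)).mul_const (matInner Y Δ)).const_add (matInner Y H)
  have h2 := nonneg_of_le_add_mul ((hasDerivAt_bregSum_line H₀ H hb Δ).sub h1) (a := a)
    (fun t ht => by simpa using h t ht)
  rw [matInner_sub_left]
  exact h2

/-- The part of the squared error carried by entries with a bounded deviation is controlled by
the symmetrized divergence; the remaining part gains from a large threshold. -/
theorem frobeniusNorm_linkDiff_sq_le (hm : Monotone (deriv b)) {B Lip M : ℝ} (hB : 0 < B)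
    (hLip : 0 ≤ Lip) (hM : 0 ≤ M)
    (hsmall : ∀ i j, |H i j - H₀ i j| ≤ B → |linkDiff b H₀ H i j| ≤ Lip * |H i j - H₀ i j|)
    (hlarge : ∀ i j, |linkDiff b H₀ H i j| ≤ M) :
    frobeniusNorm (linkDiff b H₀ H) ^ 2 ≤
      (Lip + M / B) * matInner (linkDiff b H₀ H) (H - H₀) := by
  rw [← matInner_self]
  unfold matInner
  rw [Finset.mul_sum]
  refine Finset.sum_le_sum fun i _ => ?_
  rw [Finset.mul_sum]
  refine Finset.sum_le_sum fun j _ => ?_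
  have h0 := linkDiff_mul_nonneg H₀ H hm i j
  have habs : linkDiff b H₀ H i j * (H - H₀) i j =
      |linkDiff b H₀ H i j| * |H i j - H₀ i j| := by
    rw [Matrix.sub_apply, ← abs_mul, abs_of_nonneg h0]
  rw [habs, ← abs_mul_abs_self (linkDiff b H₀ H i j)]
  set d := |linkDiff b H₀ H i j|
  set e := |H i j - H₀ i j|
  have hd : 0 ≤ d := abs_nonneg _
  have he : 0 ≤ e := abs_nonneg _
  have hMB : 0 ≤ M / B := div_nonneg hM hB.le
  -- A small deviation uses the Lipschitz bound. For a large one `d ≤ M < (M / B) e`-type reasoning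
  -- applies: the bounded error is dominated by the deviation divided by the threshold.
  rcases le_or_gt e B with h | h
  · have h1 := hsmall i j h
    calc d * d ≤ d * (Lip * e) := by gcongr
      _ = Lip * (d * e) := by ring
      _ ≤ (Lip + M / B) * (d * e) := by gcongr; linarith
  · have h1 : M ≤ M / B * e := by
      rw [div_mul_eq_mul_div, le_div_iff₀ hB]
      gcongr
    calc d * d ≤ d * (M / B * e) := by gcongr; exact (hlarge i j).trans h1
      _ = M / B * (d * e) := by ring
      _ ≤ (Lip + M / B) * (d * e) := by gcongr; linarith

end Bregman

/-! ### Optimality conditions of the constrained estimator -/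

section Stationary

variable {n m : ℕ}

theorem abs_apply_le_opNorm (Y : Matrix (Fin n) (Fin n) ℝ) (i j : Fin n) : |Y i j| ≤ opNorm Y := by
  have key : ∀ s : ℝ, |s| = 1 → s * Y i j ≤ opNorm Y := fun s hs => by
    have h := bilin_le_opNorm Y (EuclideanSpace.single i s) (EuclideanSpace.single j 1)
    simpa [bilin, hs, Pi.single_apply] using h
  rw [abs_le']
  exact ⟨by simpa using key 1 (by simp), by simpa using key (-1) (by simp)⟩

/-- Converse half of duality: test the functional on rank-one matrices scaled to nuclear norm `R`.
-/
theorem mul_opNorm_le {Y : Matrix (Fin n) (Fin n) ℝ} {R a : ℝ} (hR : 0 ≤ R)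
    (h : ∀ T, nuclearNorm T ≤ R → matInner Y T ≤ a) : R * opNorm Y ≤ a := by
  have ha : 0 ≤ a := by simpa [matInner] using h 0 (by simpa [nuclearNorm_zero] using hR)
  rcases hR.eq_or_lt with rfl | hR
  · simpa using ha
  rw [← le_div_iff₀' hR]
  refine opNorm_le (by positivity) fun u v => ?_
  rcases (mul_nonneg (norm_nonneg u) (norm_nonneg v)).eq_or_lt with h0 | h0
  · have h1 := bilin_le_opNorm Y u v
    rw [mul_assoc, ← h0] at h1 ⊢
    simpa using h1
  · have h1 := h ((R / (‖u‖ * ‖v‖)) • Matrix.of fun i j => u i * v j) (by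
      rw [nuclearNorm_smul_of_nonneg _ (by positivity)]
      have h2 := nuclearNorm_vecMulVec_le u v
      calc _ ≤ R / (‖u‖ * ‖v‖) * (‖u‖ * ‖v‖) := by gcongr
        _ = R := div_mul_cancel₀ _ h0.ne')
    rw [matInner_smul_right, matInner_vecMulVec] at h1
    rw [mul_assoc, div_mul_eq_mul_div, le_div_iff₀ hR]
    rw [div_mul_eq_mul_div, div_le_iff₀ h0] at h1
    linarith

/-- The first-order conditions of the constrained estimation problem, in terms of the noise `Z`
around the mean given by the canonical parameters `H₀`. -/
structure IsStationary (b : ℝ → ℝ) (x : Fin n → Fin n → EuclideanSpace ℝ (Fin m))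
    (H₀ Z : Matrix (Fin n) (Fin n) ℝ) (R Kβ : ℝ)
    (q : Matrix (Fin n) (Fin n) ℝ × EuclideanSpace ℝ (Fin m)) : Prop where
  mem : q ∈ feasible n m R Kβ
  first_order : ∀ q' ∈ feasible n m R Kβ,
    0 ≤ matInner (linkDiff b H₀ (linearPredictor x q.1 q.2) - Z)
      (linearPredictor x q'.1 q'.2 - linearPredictor x q.1 q.2)

theorem convex_mem_feasible {R Kβ : ℝ} {q q' : Matrix (Fin n) (Fin n) ℝ × EuclideanSpace ℝ (Fin m)}
    (hq : q ∈ feasible n m R Kβ) (hq' : q' ∈ feasible n m R Kβ) {t : ℝ} (h0 : 0 ≤ t) (h1 : t ≤ 1) :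
    (1 - t) • q + t • q' ∈ feasible n m R Kβ := by
  have h1' : 0 ≤ 1 - t := by linarith
  refine ⟨?_, ?_⟩
  · refine (nuclearNorm_add_le _ _).trans ?_
    rw [Prod.smul_fst, Prod.smul_fst, nuclearNorm_smul_of_nonneg _ h1',
      nuclearNorm_smul_of_nonneg _ h0]
    have := hq.1
    have := hq'.1
    nlinarith
  · refine (norm_add_le _ _).trans ?_
    rw [Prod.smul_snd, Prod.smul_snd, norm_smul, norm_smul, Real.norm_of_nonneg h1',
      Real.norm_of_nonneg h0]
    have := hq.2
    have := hq'.2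
    nlinarith

/-- Up to a constant in `q`, the negative log-likelihood is the divergence from `H₀` minus the
pairing with the noise; this is the only place where data and noise are exchanged. -/
theorem logLikelihood_eq (ν : Measure ℝ) (x : Fin n → Fin n → EuclideanSpace ℝ (Fin m))
    (A H₀ : Matrix (Fin n) (Fin n) ℝ)
    (q : Matrix (Fin n) (Fin n) ℝ × EuclideanSpace ℝ (Fin m)) :
    logLikelihood ν x A q =
      ∑ i, ∑ j, (deriv (cumulant ν) (H₀ i j) * H₀ i j - cumulant ν (H₀ i j)) -
        (bregSum (cumulant ν) H₀ (linearPredictor x q.1 q.2) -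
          matInner (A - H₀.map (deriv (cumulant ν))) (linearPredictor x q.1 q.2)) := by
  unfold logLikelihood bregSum matInner
  simp only [← Finset.sum_sub_distrib]
  refine Finset.sum_congr rfl fun i _ => Finset.sum_congr rfl fun j _ => ?_
  simp only [Matrix.sub_apply, Matrix.map_apply]
  ring

theorem IsConstrainedMLE.isStationary {ν : Measure ℝ} (hb : Differentiable ℝ (cumulant ν))
    {x : Fin n → Fin n → EuclideanSpace ℝ (Fin m)} {A : Matrix (Fin n) (Fin n) ℝ} {R Kβ : ℝ}
    {q : Matrix (Fin n) (Fin n) ℝ × EuclideanSpace ℝ (Fin m)}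
    (hq : IsConstrainedMLE ν R Kβ x A q) (H₀ : Matrix (Fin n) (Fin n) ℝ) :
    IsStationary (cumulant ν) x H₀ (A - H₀.map (deriv (cumulant ν))) R Kβ q := by
  refine ⟨hq.1, fun q' hq' => ?_⟩
  have h := first_order_of_segment H₀ (linearPredictor x q.1 q.2) hb
    (A - H₀.map (deriv (cumulant ν)))
    (linearPredictor x q'.1 q'.2 - linearPredictor x q.1 q.2) (a := 0) (fun t ht => by
      have h1 := hq.2 (convex_mem_feasible hq.1 hq' ht.1.le ht.2)
      simp only [Set.mem_ofPred_eq] at h1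
      rw [logLikelihood_eq ν x A H₀, logLikelihood_eq ν x A H₀, linearPredictor_convex] at h1
      linarith)
  linarith

namespace IsStationary

variable {b : ℝ → ℝ} {x : Fin n → Fin n → EuclideanSpace ℝ (Fin m)}
  {H₀ Z : Matrix (Fin n) (Fin n) ℝ} {R Kβ : ℝ}
  {q : Matrix (Fin n) (Fin n) ℝ × EuclideanSpace ℝ (Fin m)}

/-- Complementary slackness: with `β` frozen, the fitted low-rank part maximizes the linear
functional given by the score over the nuclear ball, and that maximum is `R` times the operator
norm. -/
theorem mul_opNorm_le_matInner (h : IsStationary b x H₀ Z R Kβ q) :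
    R * opNorm (Z - linkDiff b H₀ (linearPredictor x q.1 q.2)) ≤
      matInner (Z - linkDiff b H₀ (linearPredictor x q.1 q.2)) q.1 := by
  have hR : 0 ≤ R := (nuclearNorm_nonneg _).trans h.mem.1
  refine mul_opNorm_le hR fun T hT => ?_
  have h1 := h.first_order (T, q.2) ⟨hT, h.mem.2⟩
  simp only [linearPredictor_sub, sub_self] at h1
  have h2 : linearPredictor x 0 (0 : EuclideanSpace ℝ (Fin m)) = 0 := by
    ext i j; simp [linearPredictor]
  rw [h2, add_zero, matInner_sub_left, matInner_sub_right, matInner_sub_right] at h1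
  rw [matInner_sub_left, matInner_sub_left]
  linarith

/-- Constrained optimality implies penalized optimality, with the score's operator norm as the
penalty level. -/
theorem penalized_le (h : IsStationary b x H₀ Z R Kβ q) (hb : Differentiable ℝ b)
    (hm : Monotone (deriv b)) (q' : Matrix (Fin n) (Fin n) ℝ × EuclideanSpace ℝ (Fin m))
    (hq' : ‖q'.2‖ ≤ Kβ) :
    bregSum b H₀ (linearPredictor x q.1 q.2) - matInner Z (linearPredictor x q.1 q.2 - H₀) +
        opNorm (Z - linkDiff b H₀ (linearPredictor x q.1 q.2)) * R ≤
      bregSum b H₀ (linearPredictor x q'.1 q'.2) - matInner Z (linearPredictor x q'.1 q'.2 - H₀) +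
        opNorm (Z - linkDiff b H₀ (linearPredictor x q.1 q.2)) * nuclearNorm q'.1 := by
  set D := linkDiff b H₀ (linearPredictor x q.1 q.2)
  -- Convexity of the divergence, optimality in the `β` direction, and slackness together with
  -- duality in the low-rank direction add up to the claim.
  have h1 := h.mul_opNorm_le_matInner
  have h2 := matInner_le_opNorm_mul (Z - D) q'.1
  have h3 := h.first_order (q.1, q'.2) ⟨h.mem.1, hq'⟩
  have h4 := bregSum_add_le H₀ (linearPredictor x q.1 q.2) (linearPredictor x q'.1 q'.2) hb hm
  simp only [linearPredictor_sub, sub_self, zero_add] at h3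
  have e1 : matInner Z (linearPredictor x q'.1 q'.2 - H₀) =
      matInner Z (linearPredictor x q.1 q.2 - H₀) +
        matInner Z (linearPredictor x q'.1 q'.2 - linearPredictor x q.1 q.2) := by
    simp only [matInner_sub_right]; ring
  rw [e1]
  rw [linearPredictor_sub, matInner_add_right, matInner_sub_right] at h4 ⊢
  simp only [matInner_sub_left, matInner_sub_right] at h1 h2 h3 ⊢
  linarith

/-- The basic inequality `S ≤ g`: the first-order condition tested at the truth. -/
theorem matInner_linkDiff_le {q₀ : Matrix (Fin n) (Fin n) ℝ × EuclideanSpace ℝ (Fin m)}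
    (h : IsStationary b x (linearPredictor x q₀.1 q₀.2) Z R Kβ q)
    (hq₀ : q₀ ∈ feasible n m R Kβ) :
    matInner (linkDiff b (linearPredictor x q₀.1 q₀.2) (linearPredictor x q.1 q.2))
        (linearPredictor x q.1 q.2 - linearPredictor x q₀.1 q₀.2) ≤
      matInner Z (linearPredictor x q.1 q.2 - linearPredictor x q₀.1 q₀.2) := by
  have h1 := h.first_order q₀ hq₀
  simp only [matInner_sub_left, matInner_sub_right] at h1 ⊢
  linarith

end IsStationary

end Stationary

/-! ### Spectral cuts and second-order perturbation -/

section SpectralCut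

variable {n : ℕ}

theorem linearMap_eq_sum (f : EuclideanSpace ℝ (Fin n) →ₗ[ℝ] ℝ) (v : EuclideanSpace ℝ (Fin n)) :
    f v = ∑ j, v j * f (EuclideanSpace.single j 1) := by
  have h := (EuclideanSpace.basisFun (Fin n) ℝ).sum_repr v
  conv_lhs => rw [← h]
  simp [map_sum]

/-- The compression of a matrix to a pair of subspaces. -/
noncomputable def compress (Z : Matrix (Fin n) (Fin n) ℝ)
    (U V : Submodule ℝ (EuclideanSpace ℝ (Fin n))) : Matrix (Fin n) (Fin n) ℝ :=
  Matrix.of fun i j => bilin Z (U.starProjection (EuclideanSpace.single i 1))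
    (V.starProjection (EuclideanSpace.single j 1))

theorem bilin_compress (Z : Matrix (Fin n) (Fin n) ℝ)
    (U V : Submodule ℝ (EuclideanSpace ℝ (Fin n))) (u v : EuclideanSpace ℝ (Fin n)) :
    bilin (compress Z U V) u v = bilin Z (U.starProjection u) (V.starProjection v) := by
  have h1 : ∀ w, bilin Z w (V.starProjection v) =
      ∑ j, v j * bilin Z w (V.starProjection (EuclideanSpace.single j 1)) := fun w => by
    have := linearMap_eq_sum ((bilinRight Z w) ∘ₗ V.starProjection.toLinearMap) v
    simpa [bilinRight_apply] using this
  have h2 : ∀ w, bilin Z (U.starProjection u) w =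
      ∑ i, u i * bilin Z (U.starProjection (EuclideanSpace.single i 1)) w := fun w => by
    have := linearMap_eq_sum ((bilinRight Z.transpose w) ∘ₗ U.starProjection.toLinearMap) u
    simpa [bilinRight_apply, bilin_transpose] using this
  rw [h2]
  unfold bilin compress
  refine Finset.sum_congr rfl fun i _ => ?_
  have h3 := h1 (U.starProjection (EuclideanSpace.single i 1))
  unfold bilin at h3
  rw [h3, Finset.mul_sum]
  refine Finset.sum_congr rfl fun j _ => ?_
  simp only [Matrix.of_apply]
  unfold bilin
  ring

theorem SubspaceBound.matInner_compress_le {Z : Matrix (Fin n) (Fin n) ℝ}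
    {U V : Submodule ℝ (EuclideanSpace ℝ (Fin n))} {M : ℝ} (hM : 0 ≤ M)
    (h : SubspaceBound Z U V M) (T : Matrix (Fin n) (Fin n) ℝ) :
    matInner (compress Z U V) T ≤ M * nuclearNorm T := by
  refine matInner_le_nuclearNorm _ _ fun u v => ?_
  rw [bilin_compress]
  refine (le_abs_self _).trans ((h _ (U.starProjection_apply_mem u) _
    (V.starProjection_apply_mem v)).trans ?_)
  have h1 := U.norm_starProjection_apply_le u
  have h2 := V.norm_starProjection_apply_le v
  gcongr

/-- A contraction has block structure with respect to a pair of subspaces of dimension at most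
four times its squared Frobenius norm, and the complementary block has norm at most one half. -/
theorem exists_spectral_cut (G : Matrix (Fin n) (Fin n) ℝ) (hG : opNorm G ≤ 1) :
    ∃ U V : Submodule ℝ (EuclideanSpace ℝ (Fin n)),
      (Module.finrank ℝ U : ℝ) ≤ 4 * frobeniusNorm G ^ 2 ∧
      (Module.finrank ℝ V : ℝ) ≤ 4 * frobeniusNorm G ^ 2 ∧
      ∀ u v, bilin G u v ≤ ‖U.starProjection u‖ * ‖V.starProjection v‖ +
        1 / 2 * (‖u - U.starProjection u‖ * ‖v - V.starProjection v‖) := by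
  classical
  obtain ⟨e, horth, -⟩ := exists_singularBasis G
  set T := Matrix.toEuclideanLin G
  -- The right singular vectors with singular value above `1/2` span `V`, and `U = G V`. Chebyshev's
  -- inequality for the squared singular values bounds their number.
  let S : Finset (Fin n) := Finset.univ.filter fun k => 1 / 2 < ‖T (e k)‖
  let V : Submodule ℝ (EuclideanSpace ℝ (Fin n)) := Submodule.span ℝ (S.image e)
  let U : Submodule ℝ (EuclideanSpace ℝ (Fin n)) := V.map T
  have hS : (S.card : ℝ) ≤ 4 * frobeniusNorm G ^ 2 := by
    rw [sq_frobeniusNorm_eq_sum G e, Finset.mul_sum]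
    calc (S.card : ℝ) = ∑ k ∈ S, (1 : ℝ) := by simp
      _ ≤ ∑ k ∈ S, 4 * ‖T (e k)‖ ^ 2 := by
          refine Finset.sum_le_sum fun k hk => ?_
          have := (Finset.mem_filter.1 hk).2
          nlinarith
      _ ≤ _ := Finset.sum_le_sum_of_subset_of_nonneg (Finset.subset_univ _)
          fun _ _ _ => by positivity
  have hV : Module.finrank ℝ V ≤ S.card :=
    (finrank_span_finset_le_card (R := ℝ) (S.image e)).trans Finset.card_image_le
  have hU : Module.finrank ℝ U ≤ S.card := (Submodule.finrank_map_le T V).trans hV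
  refine ⟨U, V, le_trans (by exact_mod_cast hU) hS, le_trans (by exact_mod_cast hV) hS,
    fun u v => ?_⟩
  set v₁ := V.starProjection v with hv₁
  set v₂ := v - v₁ with hv₂
  set u₁ := U.starProjection u with hu₁
  have hv₁V : v₁ ∈ V := V.starProjection_apply_mem v
  have heV : ∀ k ∈ S, e k ∈ V := fun k hk =>
    Submodule.subset_span (by simpa using Finset.mem_image_of_mem e hk)
  have hv₂e : ∀ k ∈ S, inner ℝ (e k) v₂ = 0 := fun k hk => by
    rw [real_inner_comm]
    exact V.starProjection_inner_eq_zero v _ (heV k hk)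
  have hTv₂ : T v₂ = ∑ k, inner ℝ (e k) v₂ • T (e k) := by
    conv_lhs => rw [← e.sum_repr' v₂]
    rw [map_sum]
    exact Finset.sum_congr rfl fun k _ => by rw [map_smul]
  have hTe : ∀ k, inner ℝ (T (e k)) (T v₂) = inner ℝ (e k) v₂ * ‖T (e k)‖ ^ 2 := fun k => by
    rw [hTv₂, inner_sum]
    rw [Finset.sum_eq_single k]
    · rw [real_inner_smul_right, real_inner_self_eq_norm_sq]
    · intro j _ hj
      rw [real_inner_smul_right, horth k j hj.symm, mul_zero]
    · simp
  -- Orthogonality of the singular images makes the form block diagonal: `G` maps the complement of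
  -- `V` into the complement of `U`.
  have hTU : ∀ w ∈ U, inner ℝ w (T v₂) = 0 := by
    rintro _ ⟨w, hw, rfl⟩
    refine Submodule.span_induction (p := fun w _ => inner ℝ (T w) (T v₂) = 0)
      ?_ ?_ ?_ ?_ hw
    · intro w hw
      obtain ⟨k, hk, rfl⟩ := Finset.mem_image.1 (Finset.mem_coe.1 hw)
      rw [hTe, hv₂e k hk, zero_mul]
    · simp
    · intro a b _ _ ha hb
      rw [map_add, inner_add_left, ha, hb, add_zero]
    · intro a b _ hb
      rw [map_smul, real_inner_smul_left, hb, mul_zero]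
  have hnorm₂ : ‖T v₂‖ ≤ 1 / 2 * ‖v₂‖ := by
    refine le_of_sq_le_sq ?_ (by positivity)
    have h1 : ‖T v₂‖ ^ 2 = ∑ k, inner ℝ (e k) v₂ ^ 2 * ‖T (e k)‖ ^ 2 := by
      rw [← real_inner_self_eq_norm_sq]
      nth_rewrite 1 [hTv₂]
      rw [sum_inner]
      refine Finset.sum_congr rfl fun k _ => ?_
      rw [real_inner_smul_left, hTe]; ring
    have h2 : ‖v₂‖ ^ 2 = ∑ k, inner ℝ (e k) v₂ ^ 2 := (e.sum_sq_inner_right v₂).symm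
    rw [h1, mul_pow, h2, Finset.mul_sum]
    refine Finset.sum_le_sum fun k _ => ?_
    by_cases hk : k ∈ S
    · rw [hv₂e k hk]; simp
    · have h3 : ‖T (e k)‖ ≤ 1 / 2 := by
        by_contra! h
        exact hk (Finset.mem_filter.2 ⟨Finset.mem_univ _, h⟩)
      have h4 : ‖T (e k)‖ ^ 2 ≤ (1 / 2) ^ 2 := by gcongr
      nlinarith [sq_nonneg (inner ℝ (e k) v₂)]
  have hTv₁ : T v₁ ∈ U := ⟨v₁, hv₁V, rfl⟩
  have e1 : bilin G u v = inner ℝ u₁ (T v₁) + inner ℝ (u - u₁) (T v₂) := by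
    rw [bilin_eq_inner]
    have h1 : T v = T v₁ + T v₂ := by rw [← map_add]; congr 1; simp [hv₂]
    have h2 : inner ℝ (u - u₁) (T v₁) = 0 := U.starProjection_inner_eq_zero u _ hTv₁
    have h3 : inner ℝ u₁ (T v₂) = 0 := hTU _ (U.starProjection_apply_mem u)
    rw [inner_sub_left] at h2 ⊢
    change inner ℝ u (T v) = _
    rw [h1, inner_add_right, h3]
    linarith
  rw [e1]
  refine add_le_add ?_ ?_
  · refine (real_inner_le_norm _ _).trans ?_
    gcongr
    exact (norm_apply_le_opNorm G v₁).trans (mul_le_of_le_one_left (norm_nonneg _) hG)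
  · refine (real_inner_le_norm _ _).trans ?_
    calc _ ≤ ‖u - u₁‖ * (1 / 2 * ‖v₂‖) := by gcongr
      _ = _ := by ring

theorem bilin_le_of_unit {Y : Matrix (Fin n) (Fin n) ℝ} {a : ℝ}
    (h : ∀ u v, ‖u‖ = 1 → ‖v‖ = 1 → bilin Y u v ≤ a) (u v : EuclideanSpace ℝ (Fin n)) :
    bilin Y u v ≤ a * ‖u‖ * ‖v‖ := by
  rcases eq_or_ne u 0 with rfl | hu
  · simp [bilin]
  rcases eq_or_ne v 0 with rfl | hv
  · simp [bilin]
  have hu' := norm_pos_iff.2 hu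
  have hv' := norm_pos_iff.2 hv
  have h1 := h (‖u‖⁻¹ • u) (‖v‖⁻¹ • v) (norm_smul_inv_norm hu) (norm_smul_inv_norm hv)
  have h2 : bilin Y (‖u‖⁻¹ • u) (‖v‖⁻¹ • v) = ‖u‖⁻¹ * ‖v‖⁻¹ * bilin Y u v := by
    unfold bilin
    simp only [Finset.mul_sum, PiLp.smul_apply, smul_eq_mul]
    exact Finset.sum_congr rfl fun i _ => Finset.sum_congr rfl fun j _ => by ring
  rw [h2, ← mul_inv, inv_mul_le_iff₀ (by positivity)] at h1
  linarith

theorem norm_sq_starProjection_add (V : Submodule ℝ (EuclideanSpace ℝ (Fin n)))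
    (v : EuclideanSpace ℝ (Fin n)) :
    ‖V.starProjection v‖ ^ 2 + ‖v - V.starProjection v‖ ^ 2 = ‖v‖ ^ 2 := by
  have h := V.starProjection_inner_eq_zero v _ (V.starProjection_apply_mem v)
  have h2 := norm_add_sq_real (v - V.starProjection v) (V.starProjection v)
  rw [h, sub_add_cancel] at h2
  linarith

/-- The unperturbed form falls short of `l` by at least `l (a'² + b'²) / 4`, owing to the factor
`1/2` on the lower block. The perturbation is linear in `a'`, `b'` apart from a small `a' b'` term,
so completing squares leaves only `4 p² / l`. -/
theorem block_form_le {a a' b b' l p : ℝ} (ha : 0 ≤ a) (ha' : 0 ≤ a') (hb : 0 ≤ b) (hb' : 0 ≤ b')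
    (hab : a ^ 2 + a' ^ 2 = 1) (hbb : b ^ 2 + b' ^ 2 = 1) (hl : 0 < l) (hp : 0 ≤ p)
    (hpl : p ≤ l / 4) :
    l * (a * b + 1 / 2 * (a' * b')) + p * (a * b' + a' * b + a' * b') ≤ l + 4 * p ^ 2 / l := by
  have ha1 : a ≤ 1 := by nlinarith
  have hb1 : b ≤ 1 := by nlinarith
  have h1 : a * b ≤ 1 - (a' ^ 2 + b' ^ 2) / 2 := by nlinarith [sq_nonneg (a - b)]
  have h2 : a' * b' ≤ (a' ^ 2 + b' ^ 2) / 2 := by nlinarith [sq_nonneg (a' - b')]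
  have h3 : a * b' + a' * b ≤ b' + a' := by nlinarith
  have key : ∀ y : ℝ, p * y ≤ l * y ^ 2 / 8 + 2 * p ^ 2 / l := fun y => by
    have : l * y ^ 2 / 8 + 2 * p ^ 2 / l - p * y = (l * y - 4 * p) ^ 2 / (8 * l) := by
      field_simp; ring
    have h : 0 ≤ (l * y - 4 * p) ^ 2 / (8 * l) := by positivity
    linarith
  have h4 := key a'
  have h5 := key b'
  have h6 : p * (a * b' + a' * b) ≤ p * (b' + a') := by gcongr
  have h7 : p * (a' * b') ≤ l / 4 * (a' * b') := by gcongr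
  have h8 : 4 * p ^ 2 / l = 2 * p ^ 2 / l + 2 * p ^ 2 / l := by ring
  nlinarith

/-- Adding to a contraction (at scale `l`) a perturbation that vanishes on the top block increases
the norm only to second order. -/
theorem bilin_add_smul_sub_compress_le {G Z : Matrix (Fin n) (Fin n) ℝ}
    {U V : Submodule ℝ (EuclideanSpace ℝ (Fin n))}
    (hG : ∀ u v, bilin G u v ≤ ‖U.starProjection u‖ * ‖V.starProjection v‖ +
        1 / 2 * (‖u - U.starProjection u‖ * ‖v - V.starProjection v‖)) {l κ z : ℝ} (hl : 0 < l)
    (hκ : 0 ≤ κ) (hz : opNorm Z ≤ z) (hκz : κ * z ≤ l / 4) (u v : EuclideanSpace ℝ (Fin n)) :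
    bilin (l • G + κ • (Z - compress Z U V)) u v ≤ (l + 4 * (κ * z) ^ 2 / l) * ‖u‖ * ‖v‖ := by
  refine bilin_le_of_unit (fun u v hu hv => ?_) u v
  have hz0 : 0 ≤ z := (opNorm_nonneg Z).trans hz
  have e1 : bilin (l • G + κ • (Z - compress Z U V)) u v =
      l * bilin G u v + κ * (bilin Z u v - bilin (compress Z U V) u v) := by
    simp only [← matInner_vecMulVec, matInner_add_left, matInner_smul_left, matInner_sub_left]
  rw [e1, bilin_compress]
  set u₁ := U.starProjection u with hu₁
  set v₁ := V.starProjection v with hv₁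
  have e2 : bilin Z u v - bilin Z u₁ v₁ =
      bilin Z u₁ (v - v₁) + bilin Z (u - u₁) v₁ + bilin Z (u - u₁) (v - v₁) := by
    have f1 := bilin_add_left Z u₁ (u - u₁) v
    have f2 := bilin_add_right Z u₁ v₁ (v - v₁)
    have f3 := bilin_add_right Z (u - u₁) v₁ (v - v₁)
    simp only [add_sub_cancel] at f1 f2 f3
    linarith
  have hZ : ∀ u v, bilin Z u v ≤ z * (‖u‖ * ‖v‖) := fun u v => by
    refine (bilin_le_opNorm Z u v).trans ?_
    rw [mul_assoc]
    gcongr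
  have h1 := hZ u₁ (v - v₁)
  have h2 := hZ (u - u₁) v₁
  have h3 := hZ (u - u₁) (v - v₁)
  have p1 := norm_sq_starProjection_add U u
  have p2 := norm_sq_starProjection_add V v
  rw [hu, one_pow] at p1
  rw [hv, one_pow] at p2
  have h4 := block_form_le (norm_nonneg _) (norm_nonneg _) (norm_nonneg _) (norm_nonneg _) p1 p2 hl
    (mul_nonneg hκ hz0) hκz
  refine le_trans ?_ h4
  rw [e2]
  have h5 : bilin Z u₁ (v - v₁) + bilin Z (u - u₁) v₁ + bilin Z (u - u₁) (v - v₁) ≤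
      z * (‖u₁‖ * ‖v - v₁‖ + ‖u - u₁‖ * ‖v₁‖ + ‖u - u₁‖ * ‖v - v₁‖) := by linarith
  calc _ ≤ l * (‖u₁‖ * ‖v₁‖ + 1 / 2 * (‖u - u₁‖ * ‖v - v₁‖)) +
        κ * (z * (‖u₁‖ * ‖v - v₁‖ + ‖u - u₁‖ * ‖v₁‖ + ‖u - u₁‖ * ‖v - v₁‖)) := by
        gcongr
        exact hG u v
    _ = _ := by ring

end SpectralCut

/-! ### The noiseless penalized problem -/

section PenalizedMinimizer

variable {n m : ℕ}

/-- `q` minimizes the Bregman divergence from `H₀` plus `l` times the nuclear norm. -/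
structure IsPenalizedMin (b : ℝ → ℝ) (x : Fin n → Fin n → EuclideanSpace ℝ (Fin m))
    (H₀ : Matrix (Fin n) (Fin n) ℝ) (l Kβ : ℝ)
    (q : Matrix (Fin n) (Fin n) ℝ × EuclideanSpace ℝ (Fin m)) : Prop where
  norm_le : ‖q.2‖ ≤ Kβ
  le : ∀ q' : Matrix (Fin n) (Fin n) ℝ × EuclideanSpace ℝ (Fin m), ‖q'.2‖ ≤ Kβ →
    bregSum b H₀ (linearPredictor x q.1 q.2) + l * nuclearNorm q.1 ≤
      bregSum b H₀ (linearPredictor x q'.1 q'.2) + l * nuclearNorm q'.1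

theorem continuous_nuclearNorm : Continuous (nuclearNorm (n := n)) := by
  have hfrob : ∀ A : Matrix (Fin n) (Fin n) ℝ, nuclearNorm A ≤ √n * frobeniusNorm A := fun A => by
    refine (nuclearNorm_le_sqrt_rank A).trans ?_
    have h : (A.rank : ℝ) ≤ n := by exact_mod_cast (A.rank_le_width)
    have := frobeniusNorm_nonneg A
    gcongr
  have hlip : ∀ A B : Matrix (Fin n) (Fin n) ℝ,
      |nuclearNorm B - nuclearNorm A| ≤ √n * frobeniusNorm (B - A) := fun A B => by
    have h1 := nuclearNorm_add_le A (B - A)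
    have h2 := nuclearNorm_add_le B (-(B - A))
    rw [nuclearNorm_neg] at h2
    have h3 := hfrob (B - A)
    rw [add_sub_cancel] at h1
    rw [show B + -(B - A) = A by abel] at h2
    rw [abs_le]
    constructor <;> linarith
  rw [continuous_iff_continuousAt]
  intro A
  rw [ContinuousAt, tendsto_iff_dist_tendsto_zero]
  have hc : Continuous fun B : Matrix (Fin n) (Fin n) ℝ => √n * frobeniusNorm (B - A) := by
    unfold frobeniusNorm
    refine continuous_const.mul (Real.continuous_sqrt.comp ?_)
    refine continuous_finsetSum _ fun i _ => continuous_finsetSum _ fun j _ => ?_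
    exact ((continuous_id.matrix_elem i j).sub continuous_const).pow 2
  have h0 : √n * frobeniusNorm (A - A) = 0 := by simp [frobeniusNorm]
  have hlim := hc.tendsto A
  rw [h0] at hlim
  exact squeeze_zero (fun _ => dist_nonneg) (fun B => by rw [Real.dist_eq]; exact hlip A B) hlim

theorem isCompact_feasible (R Kβ : ℝ) : IsCompact (feasible n m R Kβ) := by
  have hK : IsCompact ((Set.pi Set.univ fun _ : Fin n => Set.pi Set.univ fun _ : Fin n =>
      Set.Icc (-R) R : Set (Matrix (Fin n) (Fin n) ℝ)) ×ˢ
        Metric.closedBall (0 : EuclideanSpace ℝ (Fin m)) Kβ) :=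
    (isCompact_univ_pi fun _ => isCompact_univ_pi fun _ => isCompact_Icc).prod
      (isCompact_closedBall _ _)
  refine hK.of_isClosed_subset ?_ ?_
  · exact (isClosed_le (continuous_nuclearNorm.comp continuous_fst) continuous_const).inter
      (isClosed_le continuous_snd.norm continuous_const)
  · rintro ⟨T, β⟩ ⟨h1, h2⟩
    refine ⟨fun i _ j _ => ?_, by simpa using h2⟩
    have := ((abs_apply_le_frobeniusNorm T i j).trans (frobeniusNorm_le_nuclearNorm T)).trans h1
    exact abs_le.1 this

theorem continuous_linearPredictor_apply (x : Fin n → Fin n → EuclideanSpace ℝ (Fin m))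
    (i j : Fin n) : Continuous fun q : Matrix (Fin n) (Fin n) ℝ × EuclideanSpace ℝ (Fin m) =>
      linearPredictor x q.1 q.2 i j := by
  simp only [linearPredictor, Matrix.of_apply]
  refine (continuous_fst.matrix_elem i j).add (continuous_finsetSum _ fun k _ => ?_)
  exact continuous_const.mul ((EuclideanSpace.proj k).continuous.comp continuous_snd)

variable {b : ℝ → ℝ} {x : Fin n → Fin n → EuclideanSpace ℝ (Fin m)}

theorem exists_isPenalizedMin (hb : Differentiable ℝ b) (hm : Monotone (deriv b)) {l Kβ R : ℝ}
    (hl : 0 < l) {q₀ : Matrix (Fin n) (Fin n) ℝ × EuclideanSpace ℝ (Fin m)}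
    (hq₀ : q₀ ∈ feasible n m R Kβ) :
    ∃ q, IsPenalizedMin b x (linearPredictor x q₀.1 q₀.2) l Kβ q := by
  set H₀ := linearPredictor x q₀.1 q₀.2
  have hcont : Continuous fun q : Matrix (Fin n) (Fin n) ℝ × EuclideanSpace ℝ (Fin m) =>
      bregSum b H₀ (linearPredictor x q.1 q.2) + l * nuclearNorm q.1 := by
    refine Continuous.add ?_ (continuous_const.mul (continuous_nuclearNorm.comp continuous_fst))
    unfold bregSum
    refine continuous_finsetSum _ fun i _ => continuous_finsetSum _ fun j _ => ?_
    have h := continuous_linearPredictor_apply x i j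
    exact ((hb.continuous.comp h).sub continuous_const).sub
      (continuous_const.mul (h.sub continuous_const))
  obtain ⟨q, hq, hmin⟩ := (isCompact_feasible R Kβ).exists_isMinOn ⟨q₀, hq₀⟩ hcont.continuousOn
  refine ⟨q, hq.2, fun q' hq' => ?_⟩
  -- Minimizing over the compact feasible set suffices: outside it the penalty alone exceeds the
  -- objective at the truth, where the divergence is zero.
  by_cases h : nuclearNorm q'.1 ≤ R
  · exact hmin ⟨h, hq'⟩
  · have h1 := hmin hq₀
    simp only [Set.mem_ofPred_eq] at h1
    have h2 : bregSum b H₀ (linearPredictor x q₀.1 q₀.2) = 0 := bregSum_self b _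
    have h3 := bregSum_nonneg H₀ (linearPredictor x q'.1 q'.2) hb hm
    have h4 : l * nuclearNorm q₀.1 ≤ l * nuclearNorm q'.1 := by
      have := hq₀.1
      gcongr
      linarith
    linarith

namespace IsPenalizedMin

variable {H₀ : Matrix (Fin n) (Fin n) ℝ} {l Kβ R : ℝ}
  {q : Matrix (Fin n) (Fin n) ℝ × EuclideanSpace ℝ (Fin m)}

/-- The nuclear norm is not differentiable, so only the divergence is differentiated along the
segment; the penalty enters by its convexity. -/
theorem first_order (h : IsPenalizedMin b x H₀ l Kβ q) (hb : Differentiable ℝ b) (hl : 0 ≤ l)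
    (q' : Matrix (Fin n) (Fin n) ℝ × EuclideanSpace ℝ (Fin m)) (hq' : ‖q'.2‖ ≤ Kβ) :
    0 ≤ matInner (linkDiff b H₀ (linearPredictor x q.1 q.2))
      (linearPredictor x q'.1 q'.2 - linearPredictor x q.1 q.2) +
        l * (nuclearNorm q'.1 - nuclearNorm q.1) := by
  have h1 := first_order_of_segment H₀ (linearPredictor x q.1 q.2) hb 0
    (linearPredictor x q'.1 q'.2 - linearPredictor x q.1 q.2)
    (a := l * (nuclearNorm q'.1 - nuclearNorm q.1)) (fun t ht => by
      have hmem := convex_mem_feasible (R := max (nuclearNorm q.1) (nuclearNorm q'.1))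
        (q := q) (q' := q') ⟨le_max_left _ _, h.norm_le⟩ ⟨le_max_right _ _, hq'⟩ ht.1.le ht.2
      have h1 := h.le _ hmem.2
      rw [linearPredictor_convex] at h1
      have h2 := nuclearNorm_convex q.1 q'.1 ht.1.le ht.2
      have h3 := mul_le_mul_of_nonneg_left h2 hl
      have h0 : ∀ T : Matrix (Fin n) (Fin n) ℝ, matInner 0 T = 0 := fun T => by simp [matInner]
      rw [h0, h0]
      simp only [Prod.fst_add, Prod.smul_fst] at h1
      nlinarith)
  rwa [sub_zero] at h1

theorem opNorm_le (h : IsPenalizedMin b x H₀ l Kβ q) (hb : Differentiable ℝ b) (hl : 0 ≤ l) :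
    opNorm (linkDiff b H₀ (linearPredictor x q.1 q.2)) ≤ l := by
  have := mul_opNorm_le (Y := linkDiff b H₀ (linearPredictor x q.1 q.2)) zero_le_one (a := l)
    fun T hT => by
      have h1 := h.first_order hb hl (q.1 - T, q.2) h.norm_le
      have h2 : linearPredictor x 0 (0 : EuclideanSpace ℝ (Fin m)) = 0 := by
        ext i j; simp [linearPredictor]
      have h3 := nuclearNorm_add_le q.1 (-T)
      rw [nuclearNorm_neg, ← sub_eq_add_neg] at h3
      simp only [linearPredictor_sub, sub_self, h2, add_zero, matInner_sub_right] at h1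
      nlinarith
  linarith

/-- The subgradient condition tested at zero low-rank part: `-D / l` attains the nuclear norm of the
minimizer. -/
theorem matInner_le (h : IsPenalizedMin b x H₀ l Kβ q) (hb : Differentiable ℝ b) (hl : 0 ≤ l) :
    matInner (linkDiff b H₀ (linearPredictor x q.1 q.2)) q.1 ≤ -(l * nuclearNorm q.1) := by
  have h1 := h.first_order hb hl (0, q.2) h.norm_le
  have h2 : linearPredictor x 0 (0 : EuclideanSpace ℝ (Fin m)) = 0 := by
    ext i j; simp [linearPredictor]
  have h3 : ∀ Y : Matrix (Fin n) (Fin n) ℝ, matInner Y 0 = 0 := fun Y => by simp [matInner]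
  simp only [linearPredictor_sub, sub_self, h2, add_zero, matInner_sub_right, nuclearNorm_zero,
    h3] at h1
  linarith

end IsPenalizedMin

end PenalizedMinimizer

theorem sqrt_add_le {a b : ℝ} (ha : 0 ≤ a) (hb : 0 ≤ b) : √(a + b) ≤ √a + √b := by
  refine Real.sqrt_le_iff.2 ⟨by positivity, ?_⟩
  nlinarith [Real.sq_sqrt ha, Real.sq_sqrt hb, Real.sqrt_nonneg a, Real.sqrt_nonneg b]

/-! ### Comparison of the estimator with the penalized minimizer -/

section Core

variable {n m : ℕ} {b : ℝ → ℝ} {x : Fin n → Fin n → EuclideanSpace ℝ (Fin m)}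
  {Z : Matrix (Fin n) (Fin n) ℝ} {R Kβ l : ℝ}
  {q₀ q p : Matrix (Fin n) (Fin n) ℝ × EuclideanSpace ℝ (Fin m)}

/-- Comparison of the estimator with the noiseless penalized minimizer `p` at half its level. -/
theorem IsStationary.compare_penalizedMin
    (hq : IsStationary b x (linearPredictor x q₀.1 q₀.2) Z R Kβ q)
    (hp : IsPenalizedMin b x (linearPredictor x q₀.1 q₀.2) l Kβ p)
    (hq₀ : q₀ ∈ feasible n m R Kβ) (hb : Differentiable ℝ b) (hm : Monotone (deriv b))
    (hl : 0 < l)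
    (hlam : 2 * l ≤ opNorm (Z - linkDiff b (linearPredictor x q₀.1 q₀.2)
      (linearPredictor x q.1 q.2))) :
    l * (R - nuclearNorm p.1) ≤
      matInner Z (linearPredictor x q.1 q.2 - linearPredictor x q₀.1 q₀.2) -
        matInner Z (linearPredictor x p.1 p.2 - linearPredictor x q₀.1 q₀.2) ∧
    matInner (linkDiff b (linearPredictor x q₀.1 q₀.2) (linearPredictor x p.1 p.2))
      (linearPredictor x p.1 p.2 - linearPredictor x q₀.1 q₀.2) ≤ l * (R - nuclearNorm p.1) ∧
    l * R + matInner (linkDiff b (linearPredictor x q₀.1 q₀.2) (linearPredictor x p.1 p.2)) q.1 ≤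
      matInner Z (linearPredictor x q.1 q.2 - linearPredictor x q₀.1 q₀.2) +
        l * (R - nuclearNorm p.1) := by
  set H₀ := linearPredictor x q₀.1 q₀.2 with hH₀
  set lam := opNorm (Z - linkDiff b H₀ (linearPredictor x q.1 q.2))
  have hB := hq.penalized_le hb hm p hp.norm_le
  have hF := bregSum_nonneg H₀ (linearPredictor x q.1 q.2) hb hm
  have hFS := bregSum_le_matInner H₀ (linearPredictor x q.1 q.2) hb hm
  have hSg := hq.matInner_linkDiff_le hq₀
  rw [← hH₀] at hSg
  have hmin := hp.le q₀ hq₀.2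
  rw [← hH₀, bregSum_self] at hmin
  have hFp := bregSum_nonneg H₀ (linearPredictor x p.1 p.2) hb hm
  have hNq₀ : l * nuclearNorm q₀.1 ≤ l * R := mul_le_mul_of_nonneg_left hq₀.1 hl.le
  have hNp : nuclearNorm p.1 ≤ R := by
    by_contra! h
    have := mul_lt_mul_of_pos_left h hl
    linarith
  -- Minimality gives divergence of `p` at most `l (R - ‖p‖_*)`. A multiplier of at least `2 l`
  -- gains twice this amount, so one copy remains.
  have h1 : 2 * l * (R - nuclearNorm p.1) ≤ lam * (R - nuclearNorm p.1) :=
    mul_le_mul_of_nonneg_right hlam (by linarith)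
  have hfo := hp.first_order hb hl.le q₀ hq₀.2
  have hfo2 := hp.first_order hb hl.le (p.1, q.2) hq.mem.2
  have hconv := bregSum_add_le H₀ (linearPredictor x p.1 p.2) (linearPredictor x q.1 q.2) hb hm
  have hpp := hp.matInner_le hb hl.le
  set D := linkDiff b H₀ (linearPredictor x p.1 p.2)
  refine ⟨by linarith, ?_, ?_⟩
  · rw [← hH₀] at hfo
    simp only [matInner_sub_right] at hfo ⊢
    linarith
  · simp only [linearPredictor_sub, sub_self, zero_add] at hfo2
    rw [linearPredictor_sub, matInner_add_right, matInner_sub_right] at hconv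
    linarith

/-- The spectral cut of the normalized gradient of the noiseless penalized problem controls the
pairing of the noise with the estimator. -/
theorem IsStationary.matInner_noise_le
    (hq : IsStationary b x (linearPredictor x q₀.1 q₀.2) Z R Kβ q)
    (hp : IsPenalizedMin b x (linearPredictor x q₀.1 q₀.2) l Kβ p)
    (hq₀ : q₀ ∈ feasible n m R Kβ) (hb : Differentiable ℝ b) (hm : Monotone (deriv b))
    (hl : 1 ≤ l)
    (hlam : 2 * l ≤ opNorm (Z - linkDiff b (linearPredictor x q₀.1 q₀.2)
      (linearPredictor x q.1 q.2)))
    {U V : Submodule ℝ (EuclideanSpace ℝ (Fin n))}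
    (hcut : ∀ u v, bilin (-(l⁻¹ • linkDiff b (linearPredictor x q₀.1 q₀.2)
        (linearPredictor x p.1 p.2))) u v ≤ ‖U.starProjection u‖ * ‖V.starProjection v‖ +
        1 / 2 * (‖u - U.starProjection u‖ * ‖v - V.starProjection v‖))
    {Lip z C k₀ err err' : ℝ} (hLip : 0 ≤ Lip)
    (hsmall : ∀ i j, |linearPredictor x p.1 p.2 i j - linearPredictor x q₀.1 q₀.2 i j| ≤ 1 →
      |linkDiff b (linearPredictor x q₀.1 q₀.2) (linearPredictor x p.1 p.2) i j| ≤
        Lip * |linearPredictor x p.1 p.2 i j - linearPredictor x q₀.1 q₀.2 i j|)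
    (hz : opNorm Z ≤ z) (hzl : 32 * z ≤ l) (hC : 0 ≤ C) (hk₀ : 0 ≤ k₀)
    (hUV : SubspaceBound Z U V (C * √(k₀ + 4 * frobeniusNorm (l⁻¹ • linkDiff b
      (linearPredictor x q₀.1 q₀.2) (linearPredictor x p.1 p.2)) ^ 2)))
    (herr : |matInner Z (linearPredictor x p.1 p.2 - linearPredictor x q₀.1 q₀.2)| ≤ err)
    (herr' : |matInner Z q₀.1| + |matInner Z (linearPredictor x 0 (q.2 - q₀.2))| ≤ err') :
    matInner Z (linearPredictor x q.1 q.2 - linearPredictor x q₀.1 q₀.2) ≤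
      err + 2 * err' + 2 * C * R * √k₀ +
        (64 * z ^ 2 * R + 8 * C ^ 2 * R ^ 2 * (Lip + 1)) / l := by
  have hl0 : 0 < l := by linarith
  have hR : 0 ≤ R := (nuclearNorm_nonneg _).trans hq.mem.1
  obtain ⟨h1, h2, h3⟩ := hq.compare_penalizedMin hp hq₀ hb hm hl0 hlam
  have hgn : matInner Z (linearPredictor x q.1 q.2 - linearPredictor x q₀.1 q₀.2) =
      matInner Z q.1 - matInner Z q₀.1 + matInner Z (linearPredictor x 0 (q.2 - q₀.2)) := by
    rw [linearPredictor_sub, matInner_add_right, matInner_sub_right]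
  set g := matInner Z (linearPredictor x q.1 q.2 - linearPredictor x q₀.1 q₀.2)
  set D := linkDiff b (linearPredictor x q₀.1 q₀.2) (linearPredictor x p.1 p.2) with hD
  have herr2 := abs_le.1 herr
  have hg' : l * (R - nuclearNorm p.1) ≤ g + err := by linarith
  have hDl : ∀ i j, |D i j| ≤ l := fun i j =>
    (abs_apply_le_opNorm D i j).trans (hp.opNorm_le hb hl0.le)
  have hfrob := frobeniusNorm_linkDiff_sq_le (linearPredictor x q₀.1 q₀.2)
    (linearPredictor x p.1 p.2) hm one_pos hLip hl0.le hsmall hDl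
  rw [div_one, ← hD] at hfrob
  have hSp : matInner D (linearPredictor x p.1 p.2 - linearPredictor x q₀.1 q₀.2) ≤ g + err :=
    h2.trans hg'
  have hg0 : 0 ≤ g + err := le_trans (matInner_linkDiff_nonneg _ _ hm) hSp
  -- Entries of the gradient are at most `l` by optimality, so splitting at the threshold `1` bounds
  -- its Frobenius norm; hence the cut subspaces have dimension of order `(g + err) / l`.
  have hDF : frobeniusNorm D ^ 2 ≤ (Lip + 1) * l * (g + err) := by
    refine hfrob.trans ?_
    calc _ ≤ (Lip + l) * (g + err) := by gcongr
      _ ≤ (Lip + 1) * l * (g + err) := by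
          gcongr
          nlinarith
  have hGF : frobeniusNorm (l⁻¹ • D) ^ 2 ≤ (Lip + 1) * (g + err) / l := by
    rw [← matInner_self, matInner_smul_left, matInner_smul_right, matInner_self]
    rw [le_div_iff₀ hl0]
    calc l⁻¹ * (l⁻¹ * frobeniusNorm D ^ 2) * l = l⁻¹ * frobeniusNorm D ^ 2 := by field_simp
      _ ≤ l⁻¹ * ((Lip + 1) * l * (g + err)) := by gcongr
      _ = _ := by field_simp
  have hz0 : 0 ≤ z := (opNorm_nonneg Z).trans hz
  -- The noise off the top block is added with weight `8`, admissible since `32 z ≤ l`. The pairing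
  -- `l R + ⟨D, q.1⟩` is at most `2 g + err`, so after division by `8` only a quarter of `g + err`
  -- returns.
  have hW : 8 * matInner (Z - compress Z U V) q.1 ≤ 2 * (g + err) + 256 * z ^ 2 * R / l := by
    have h4 := matInner_le_nuclearNorm _ q.1
      (bilin_add_smul_sub_compress_le hcut hl0 (by norm_num : (0 : ℝ) ≤ 8) hz (by linarith))
    have h5 : matInner (l • -(l⁻¹ • D) + (8 : ℝ) • (Z - compress Z U V)) q.1 =
        -matInner D q.1 + 8 * matInner (Z - compress Z U V) q.1 := by
      have e : l • -(l⁻¹ • D) = (-1 : ℝ) • D := by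
        rw [smul_neg, smul_smul, mul_inv_cancel₀ hl0.ne', one_smul, neg_one_smul]
      rw [e, matInner_add_left, matInner_smul_left, matInner_smul_left]
      ring
    rw [h5] at h4
    have h6 : (l + 4 * (8 * z) ^ 2 / l) * nuclearNorm q.1 ≤ (l + 4 * (8 * z) ^ 2 / l) * R := by
      gcongr
      exact hq.mem.1
    have h7 : (l + 4 * (8 * z) ^ 2 / l) * R = l * R + 256 * z ^ 2 * R / l := by ring
    linarith
  have hcomp := hUV.matInner_compress_le (by positivity) q.1
  -- The dimension itself contains `g`, through `√((g + err) / l)`; Young's inequality returns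
  -- another quarter of `g + err`, and the total can be absorbed on the left.
  have hcomp2 : matInner (compress Z U V) q.1 ≤
      C * R * √k₀ + ((g + err) / 4 + 4 * C ^ 2 * R ^ 2 * (Lip + 1) / l) := by
    have e1 : √(k₀ + 4 * frobeniusNorm (l⁻¹ • D) ^ 2) ≤
        √k₀ + 2 * √((Lip + 1) * (g + err) / l) := by
      have h4 : √(k₀ + 4 * frobeniusNorm (l⁻¹ • D) ^ 2) ≤
          √(k₀ + 2 ^ 2 * ((Lip + 1) * (g + err) / l)) := by
        apply Real.sqrt_le_sqrt
        norm_num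
        linarith
      refine h4.trans ((sqrt_add_le hk₀ (by positivity)).trans (le_of_eq ?_))
      rw [Real.sqrt_mul (by norm_num), Real.sqrt_sq (by norm_num)]
    have e2 : matInner (compress Z U V) q.1 ≤ C * (√k₀ + 2 * √((Lip + 1) * (g + err) / l)) * R := by
      refine hcomp.trans ?_
      have := hq.mem.1
      have := nuclearNorm_nonneg q.1
      gcongr
    have e3 : √((Lip + 1) * (g + err) / l) = √(g + err) * √((Lip + 1) / l) := by
      rw [← Real.sqrt_mul hg0]
      congr 1; ring
    have e4 : √(g + err) ^ 2 = g + err := Real.sq_sqrt hg0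
    have e5 : √((Lip + 1) / l) ^ 2 = (Lip + 1) / l := Real.sq_sqrt (by positivity)
    have e6 : 4 * C ^ 2 * R ^ 2 * (Lip + 1) / l = 4 * (C * R * √((Lip + 1) / l)) ^ 2 := by
      rw [mul_pow, e5]; ring
    rw [e6, ← e4]
    rw [e3] at e2
    nlinarith [sq_nonneg (√(g + err) / 2 - 2 * (C * R * √((Lip + 1) / l)))]
  have hsplit : matInner Z q.1 =
      matInner (Z - compress Z U V) q.1 + matInner (compress Z U V) q.1 := by
    rw [matInner_sub_left]; ring
  have a1 := neg_abs_le (matInner Z q₀.1)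
  have a2 := le_abs_self (matInner Z (linearPredictor x 0 (q.2 - q₀.2)))
  have hfin : g ≤ (2 * (g + err) + 256 * z ^ 2 * R / l) / 8 + (C * R * √k₀ +
      ((g + err) / 4 + 4 * C ^ 2 * R ^ 2 * (Lip + 1) / l)) + err' := by
    linarith
  have e7 : (64 * z ^ 2 * R + 8 * C ^ 2 * R ^ 2 * (Lip + 1)) / l =
      (256 * z ^ 2 * R / l) / 4 + 2 * (4 * C ^ 2 * R ^ 2 * (Lip + 1) / l) := by ring
  rw [e7]
  linarith

end Core

/-! ### Error from the multiplier, and first bounds -/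

section Rates

variable {n m : ℕ} {b : ℝ → ℝ} {x : Fin n → Fin n → EuclideanSpace ℝ (Fin m)}
  {Z : Matrix (Fin n) (Fin n) ℝ} {R Kβ : ℝ}
  {q₀ q : Matrix (Fin n) (Fin n) ℝ × EuclideanSpace ℝ (Fin m)}

/-- The properties of the noise matrix used in the deterministic analysis; `w` plays the role of
`n ^ (1 / 4)`. -/
structure GoodNoise (b : ℝ → ℝ) (x : Fin n → Fin n → EuclideanSpace ℝ (Fin m))
    (q₀ : Matrix (Fin n) (Fin n) ℝ × EuclideanSpace ℝ (Fin m))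
    (p : ℕ → Matrix (Fin n) (Fin n) ℝ × EuclideanSpace ℝ (Fin m))
    (U V : ℕ → Submodule ℝ (EuclideanSpace ℝ (Fin n))) (C K w : ℝ)
    (Z : Matrix (Fin n) (Fin n) ℝ) : Prop where
  opNorm_le : opNorm Z ≤ C * w ^ 2
  inner_true : |matInner Z q₀.1| ≤ K * w ^ 4
  inner_cov : ∀ δ, |matInner Z (linearPredictor x 0 δ)| ≤ K * w ^ 4 * ‖δ‖
  inner_pen : ∀ j, 1 ≤ j → j ≤ n →
    |matInner Z (linearPredictor x (p j).1 (p j).2 - linearPredictor x q₀.1 q₀.2)| ≤ K * w ^ 5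
  subspace : ∀ j, 1 ≤ j → j ≤ n → SubspaceBound Z (U j) (V j) (C * √(4 * w ^ 2 +
    4 * frobeniusNorm ((j : ℝ)⁻¹ • linkDiff b (linearPredictor x q₀.1 q₀.2)
      (linearPredictor x (p j).1 (p j).2)) ^ 2))

/-- The canonical parameters of a pair in the feasible ball, up to the low-rank part. -/
theorem abs_linearPredictor_le {Kx A : ℝ} (hx : ∀ i j, ‖x i j‖ ≤ Kx) (hKx : 0 ≤ Kx)
    (T : Matrix (Fin n) (Fin n) ℝ) {δ : EuclideanSpace ℝ (Fin m)} (hδ : ‖δ‖ ≤ A) (i j : Fin n) :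
    |linearPredictor x T δ i j| ≤ |T i j| + Kx * A := by
  have e : linearPredictor x T δ i j = T i j + linearPredictor x 0 δ i j := by
    simp [linearPredictor]
  rw [e]
  refine (abs_add_le _ _).trans (add_le_add le_rfl ?_)
  exact (abs_linearPredictor_zero_le x hx δ i j).trans (by gcongr)

/-- The error is small once the score level times the symmetrized divergence is `O(n ^ 2)`. -/
theorem exists_frobeniusNorm_le_of_mul_le (hb : ContDiff ℝ 2 b) (hm : Monotone (deriv b))
    (Kη C C₄ C₅ : ℝ) (hC : 0 ≤ C) (hC₄ : 0 ≤ C₄) (hC₅ : 0 ≤ C₅) {ε : ℝ} (hε : 0 < ε) :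
    ∃ W : ℝ, 1 ≤ W ∧ ∀ (n : ℕ) (H₀ H Z : Matrix (Fin n) (Fin n) ℝ) (w : ℝ), W ≤ w →
      (∀ i j, |H₀ i j| ≤ Kη) → opNorm Z ≤ C * w ^ 2 →
      matInner (linkDiff b H₀ H) (H - H₀) ≤ C₅ * w ^ 6 →
      opNorm (Z - linkDiff b H₀ H) * matInner (linkDiff b H₀ H) (H - H₀) ≤ C₄ * w ^ 8 →
      frobeniusNorm (linkDiff b H₀ H) ≤ ε * w ^ 4 := by
  -- Large entries then contribute at most `ε ^ 2 / 2 * w ^ 8`. The Lipschitz constant on the range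
  -- enlarged by `B` is arbitrary but fixed, and is absorbed by `w ≥ W` because `S = O(w ^ 6)`.
  set B := 2 * (C₄ + C * C₅ + 1) / ε ^ 2 with hB
  have hB0 : 0 < B := by positivity
  obtain ⟨Lip, hLip0, hLip⟩ := exists_lipschitz_deriv hb (Kη + B)
  refine ⟨1 + 2 * Lip * C₅ / ε ^ 2, by
    have : 0 ≤ 2 * Lip * C₅ / ε ^ 2 := by positivity
    linarith, fun n H₀ H Z w hw hH₀ hZ hS hlS => ?_⟩
  have hr : 0 ≤ 2 * Lip * C₅ / ε ^ 2 := by positivity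
  have hw1 : 1 ≤ w := by linarith
  set S := matInner (linkDiff b H₀ H) (H - H₀)
  have hS0 : 0 ≤ S := matInner_linkDiff_nonneg H₀ H hm
  set lam := opNorm (Z - linkDiff b H₀ H) with hlam
  have hlam0 : 0 ≤ lam := opNorm_nonneg _
  have hz0 := opNorm_nonneg Z
  have h1 := frobeniusNorm_linkDiff_sq_le H₀ H hm hB0 hLip0 (M := lam + opNorm Z)
    (by positivity) (fun i j hij => by
      have h2 : |H i j| ≤ Kη + B := by
        have := abs_add_le (H₀ i j) (H i j - H₀ i j)
        rw [add_sub_cancel] at this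
        linarith [hH₀ i j]
      exact hLip _ _ ((hH₀ i j).trans (by linarith)) h2)
    (fun i j => by
      have h2 := abs_apply_le_opNorm (Z - linkDiff b H₀ H) i j
      have h3 := abs_apply_le_opNorm Z i j
      have h4 : linkDiff b H₀ H i j = Z i j - (Z - linkDiff b H₀ H) i j := by
        rw [Matrix.sub_apply]; ring
      rw [h4]
      have h5 := abs_sub (Z i j) ((Z - linkDiff b H₀ H) i j)
      linarith)
  refine le_of_sq_le_sq (h1.trans ?_) (by positivity)
  have h2 : (lam + opNorm Z) * S ≤ (C₄ + C * C₅) * w ^ 8 := by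
    have : opNorm Z * S ≤ (C * w ^ 2) * (C₅ * w ^ 6) := by gcongr
    have e : (C * w ^ 2) * (C₅ * w ^ 6) = C * C₅ * w ^ 8 := by ring
    rw [e] at this
    linarith
  have h3 : Lip * S ≤ ε ^ 2 / 2 * w ^ 8 := by
    have h4 : 2 * Lip * C₅ / ε ^ 2 ≤ w := by linarith
    rw [div_le_iff₀ (by positivity)] at h4
    calc Lip * S ≤ Lip * (C₅ * w ^ 6) := by gcongr
      _ = 2 * Lip * C₅ * w ^ 6 / 2 := by ring
      _ ≤ w * ε ^ 2 * w ^ 6 / 2 := by gcongr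
      _ = ε ^ 2 / 2 * (w ^ 6 * w) := by ring
      _ ≤ ε ^ 2 / 2 * (w ^ 6 * w ^ 2) := by
          gcongr
          nlinarith
      _ = _ := by ring
  have h5 : (lam + opNorm Z) / B * S ≤ ε ^ 2 / 2 * w ^ 8 := by
    rw [div_mul_eq_mul_div, div_le_iff₀ hB0]
    have e : ε ^ 2 / 2 * w ^ 8 * B = (C₄ + C * C₅ + 1) * w ^ 8 := by
      rw [hB]; field_simp
    rw [e]
    have : 0 ≤ w ^ 8 := by positivity
    linarith
  calc (Lip + (lam + opNorm Z) / B) * S = Lip * S + (lam + opNorm Z) / B * S := by ring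
    _ ≤ ε ^ 2 / 2 * w ^ 8 + ε ^ 2 / 2 * w ^ 8 := add_le_add h3 h5
    _ = _ := by ring

/-- A crude bound on the pairing of the noise with the estimation error. -/
theorem matInner_noise_le_crude {p : ℕ → Matrix (Fin n) (Fin n) ℝ × EuclideanSpace ℝ (Fin m)}
    {U V : ℕ → Submodule ℝ (EuclideanSpace ℝ (Fin n))} {C K w : ℝ}
    (hZ : GoodNoise b x q₀ p U V C K w Z) (hK : 0 ≤ K) (hq : q ∈ feasible n m R Kβ)
    (hq₀ : q₀ ∈ feasible n m R Kβ) :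
    |matInner Z (linearPredictor x 0 (q.2 - q₀.2))| ≤ 2 * Kβ * K * w ^ 4 ∧
    matInner Z (linearPredictor x q.1 q.2 - linearPredictor x q₀.1 q₀.2) ≤
      C * w ^ 2 * R + (1 + 2 * Kβ) * K * w ^ 4 := by
  have h1 : |matInner Z (linearPredictor x 0 (q.2 - q₀.2))| ≤ 2 * Kβ * K * w ^ 4 := by
    refine (hZ.inner_cov _).trans ?_
    have h2 : ‖q.2 - q₀.2‖ ≤ 2 * Kβ := by
      have := norm_sub_le q.2 q₀.2
      linarith [hq.2, hq₀.2]
    calc K * w ^ 4 * ‖q.2 - q₀.2‖ ≤ K * w ^ 4 * (2 * Kβ) := by gcongr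
      _ = _ := by ring
  refine ⟨h1, ?_⟩
  rw [linearPredictor_sub, matInner_add_right, matInner_sub_right]
  have h3 : matInner Z q.1 ≤ C * w ^ 2 * R := by
    refine (matInner_le_opNorm_mul Z q.1).trans ?_
    have := nuclearNorm_nonneg q.1
    have := opNorm_nonneg Z
    exact mul_le_mul hZ.opNorm_le hq.1 (by assumption) (by linarith [hZ.opNorm_le])
  have h4 := neg_abs_le (matInner Z q₀.1)
  have h5 := le_abs_self (matInner Z (linearPredictor x 0 (q.2 - q₀.2)))
  have h6 := hZ.inner_true
  linarith

/-- A first bound on the score level when the radius is of order `n`. -/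
theorem IsStationary.opNorm_le_of_large_radius
    (hq : IsStationary b x (linearPredictor x q₀.1 q₀.2) Z R Kβ q)
    (hq₀ : q₀ ∈ feasible n m R Kβ) (hb : Differentiable ℝ b) (hm : Monotone (deriv b))
    {Kη Kθ Kx Lip K C₅ c₀ w : ℝ} (hKx : 0 ≤ Kx) (hKθ : 0 ≤ Kθ) (hKη : Kθ + Kx * Kβ ≤ Kη)
    (hLip0 : 0 ≤ Lip) (hK : 0 ≤ K)
    (hLip : ∀ s t, |s| ≤ Kη → |t| ≤ Kη → |deriv b t - deriv b s| ≤ Lip * |t - s|)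
    (hx : ∀ i j, ‖x i j‖ ≤ Kx) (hθ : ∀ i j, |q₀.1 i j| ≤ Kθ) (hw : 1 ≤ w) (hn : (n : ℝ) = w ^ 4)
    (hc₀ : 0 < c₀) (hR : c₀ * w ^ 4 ≤ R) (htrue : |matInner Z q₀.1| ≤ K * w ^ 4)
    (hg : matInner Z (linearPredictor x q.1 q.2 - linearPredictor x q₀.1 q₀.2) ≤ C₅ * w ^ 6) :
    opNorm (Z - linkDiff b (linearPredictor x q₀.1 q₀.2) (linearPredictor x q.1 q.2)) ≤
      (C₅ + Lip * Kθ ^ 2 + K) / c₀ * w ^ 3 := by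
  have hw0 : 0 < w := by linarith
  -- The comparison point is the truth shrunk by `1 - ρ`. The multiplier gains `ρ R`, of order `ρ w
  -- ^ 4`, against a divergence of order `ρ ^ 2 w ^ 8` and noise of order `w ^ 6`; `ρ = 1 / w`
  -- balances the last two.
  set ρ := w⁻¹ with hρ
  have hρ0 : 0 < ρ := by positivity
  have hρ1 : ρ ≤ 1 := inv_le_one_of_one_le₀ hw
  set H₀ := linearPredictor x q₀.1 q₀.2 with hH₀
  set lam := opNorm (Z - linkDiff b H₀ (linearPredictor x q.1 q.2))
  have hlam0 : 0 ≤ lam := opNorm_nonneg _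
  have hB := hq.penalized_le hb hm ((1 - ρ) • q₀.1, q₀.2) hq₀.2
  have hF := bregSum_nonneg H₀ (linearPredictor x q.1 q.2) hb hm
  have h2 : linearPredictor x 0 (0 : EuclideanSpace ℝ (Fin m)) = 0 := by
    ext i j; simp [linearPredictor]
  have e1 : matInner Z (linearPredictor x ((1 - ρ) • q₀.1) q₀.2 - H₀) = -(ρ * matInner Z q₀.1) := by
    rw [hH₀, linearPredictor_sub, sub_self, h2, add_zero, sub_smul, one_smul, sub_sub_cancel_left,
      ← neg_smul, matInner_smul_right]
    ring
  have e2 : nuclearNorm ((1 - ρ) • q₀.1) ≤ (1 - ρ) * R := by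
    rw [nuclearNorm_smul_of_nonneg _ (by linarith)]
    exact mul_le_mul_of_nonneg_left hq₀.1 (by linarith)
  have e3 : bregSum b H₀ (linearPredictor x ((1 - ρ) • q₀.1) q₀.2) ≤
      Lip * Kθ ^ 2 * ρ ^ 2 * (n : ℝ) ^ 2 := by
    have hterm : ∀ i j, b (linearPredictor x ((1 - ρ) • q₀.1) q₀.2 i j) - b (H₀ i j) -
        deriv b (H₀ i j) * (linearPredictor x ((1 - ρ) • q₀.1) q₀.2 i j - H₀ i j) ≤
        Lip * Kθ ^ 2 * ρ ^ 2 := fun i j => by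
      set s := H₀ i j
      set t := linearPredictor x ((1 - ρ) • q₀.1) q₀.2 i j with ht
      have hst : t - s = -(ρ * q₀.1 i j) := by
        simp only [t, s, hH₀, linearPredictor, Matrix.of_apply, Matrix.smul_apply, smul_eq_mul]
        ring
      have hs : |s| ≤ Kη :=
        (abs_linearPredictor_le hx hKx q₀.1 hq₀.2 i j).trans (by linarith [hθ i j])
      have ht : |t| ≤ Kη := by
        refine (abs_linearPredictor_le hx hKx ((1 - ρ) • q₀.1) hq₀.2 i j).trans ?_
        rw [Matrix.smul_apply, smul_eq_mul, abs_mul, abs_of_nonneg (by linarith : 0 ≤ 1 - ρ)]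
        have h3 := hθ i j
        have h4 := abs_nonneg (q₀.1 i j)
        nlinarith
      have habs : |t - s| ≤ ρ * Kθ := by
        rw [hst, abs_neg, abs_mul, abs_of_pos hρ0]
        exact mul_le_mul_of_nonneg_left (hθ i j) hρ0.le
      refine (bregman_le hb hm s t).trans ?_
      refine (le_abs_self _).trans ?_
      rw [abs_mul]
      calc _ ≤ Lip * |t - s| * |t - s| := by gcongr; exact hLip s t hs ht
        _ ≤ Lip * (ρ * Kθ) * (ρ * Kθ) := by gcongr
        _ = _ := by ring
    unfold bregSum
    refine (Finset.sum_le_sum fun i _ => Finset.sum_le_sum fun j _ => hterm i j).trans (le_of_eq ?_)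
    simp only [Finset.sum_const, Finset.card_univ, Fintype.card_fin, nsmul_eq_mul]
    ring
  have h3 := (abs_le.1 htrue).2
  have h4 := mul_le_mul_of_nonneg_left e2 hlam0
  have h5 : ρ * matInner Z q₀.1 ≤ ρ * (K * w ^ 4) := mul_le_mul_of_nonneg_left h3 hρ0.le
  simp only at hB
  rw [e1] at hB
  have h6 : lam * (ρ * R) ≤ C₅ * w ^ 6 + Lip * Kθ ^ 2 * ρ ^ 2 * (n : ℝ) ^ 2 + ρ * (K * w ^ 4) := by
    linarith
  have h7 : lam * (ρ * (c₀ * w ^ 4)) ≤ lam * (ρ * R) := by gcongr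
  have e4 : lam * (ρ * (c₀ * w ^ 4)) = lam * c₀ * w ^ 3 := by
    rw [hρ]; field_simp
  have e5 : Lip * Kθ ^ 2 * ρ ^ 2 * (n : ℝ) ^ 2 = Lip * Kθ ^ 2 * w ^ 6 := by
    rw [hn, hρ]; field_simp
  have e6 : ρ * (K * w ^ 4) = K * w ^ 3 := by
    rw [hρ]; field_simp
  have h8 : K * w ^ 3 ≤ K * w ^ 6 := by
    gcongr
    norm_num
  rw [e5, e6] at h6
  rw [e4] at h7
  have h9 : lam * c₀ * w ^ 3 ≤ (C₅ + Lip * Kθ ^ 2 + K) * w ^ 3 * w ^ 3 := by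
    have : (C₅ + Lip * Kθ ^ 2 + K) * w ^ 3 * w ^ 3 =
      C₅ * w ^ 6 + Lip * Kθ ^ 2 * w ^ 6 + K * w ^ 6 := by ring
    linarith
  have h10 := le_of_mul_le_mul_right h9 (by positivity)
  rw [div_mul_eq_mul_div, le_div_iff₀ hc₀]
  exact h10

end Rates

/-! ### The deterministic rate on the good noise event -/

section DeterministicRate

variable {n m : ℕ} {b : ℝ → ℝ} {x : Fin n → Fin n → EuclideanSpace ℝ (Fin m)}
  {Z : Matrix (Fin n) (Fin n) ℝ} {R Kβ : ℝ}
  {q₀ q : Matrix (Fin n) (Fin n) ℝ × EuclideanSpace ℝ (Fin m)}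
  {p : ℕ → Matrix (Fin n) (Fin n) ℝ × EuclideanSpace ℝ (Fin m)}
  {U V : ℕ → Submodule ℝ (EuclideanSpace ℝ (Fin n))}

/-- For an intermediate score level, comparison with a penalized minimizer bounds the product of
the score level and the noise term. -/
theorem IsStationary.opNorm_mul_matInner_noise_le
    (hq : IsStationary b x (linearPredictor x q₀.1 q₀.2) Z R Kβ q)
    (hq₀ : q₀ ∈ feasible n m R Kβ) (hb : Differentiable ℝ b) (hm : Monotone (deriv b))
    (hp : ∀ j : ℕ, 1 ≤ j → IsPenalizedMin b x (linearPredictor x q₀.1 q₀.2) j Kβ (p j))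
    (hcut : ∀ (j : ℕ), 1 ≤ j → ∀ u v, bilin (-((j : ℝ)⁻¹ • linkDiff b
        (linearPredictor x q₀.1 q₀.2) (linearPredictor x (p j).1 (p j).2))) u v ≤
        ‖(U j).starProjection u‖ * ‖(V j).starProjection v‖ +
        1 / 2 * (‖u - (U j).starProjection u‖ * ‖v - (V j).starProjection v‖))
    {C K w Lip Kη CR C₃ : ℝ} (hZ : GoodNoise b x q₀ p U V C K w Z) (hC : 0 ≤ C) (hK : 0 ≤ K)
    (hKβ : 0 ≤ Kβ) (hLip0 : 0 ≤ Lip)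
    (hLip : ∀ s t, |s| ≤ Kη + 1 → |t| ≤ Kη + 1 → |deriv b t - deriv b s| ≤ Lip * |t - s|)
    (hη : ∀ i j, |linearPredictor x q₀.1 q₀.2 i j| ≤ Kη)
    (hw : 1 ≤ w) (hC₃w : C₃ ≤ w) (hC₃ : 0 ≤ C₃) (hn : (n : ℝ) = w ^ 4) (hR : R ≤ CR * w ^ 4)
    (hlo : (128 * C + 4) * w ^ 2 ≤ opNorm (Z - linkDiff b (linearPredictor x q₀.1 q₀.2)
      (linearPredictor x q.1 q.2)))
    (hhi : opNorm (Z - linkDiff b (linearPredictor x q₀.1 q₀.2)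
      (linearPredictor x q.1 q.2)) ≤ C₃ * w ^ 3) :
    opNorm (Z - linkDiff b (linearPredictor x q₀.1 q₀.2) (linearPredictor x q.1 q.2)) *
      matInner Z (linearPredictor x q.1 q.2 - linearPredictor x q₀.1 q₀.2) ≤
      (C₃ * (K + 2 * ((1 + 2 * Kβ) * K) + 4 * C * CR) +
        4 * (64 * C ^ 2 * CR + 8 * C ^ 2 * CR ^ 2 * (Lip + 1))) * w ^ 8 := by
  set lam := opNorm (Z - linkDiff b (linearPredictor x q₀.1 q₀.2)
      (linearPredictor x q.1 q.2)) with hlam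
  have hw0 : 0 < w := by linarith
  have hR0 : 0 ≤ R := (nuclearNorm_nonneg _).trans hq.mem.1
  have hw2 : 1 ≤ w ^ 2 := one_le_pow₀ hw
  have h4 : 4 ≤ lam := by nlinarith
  -- An integer level, so that the noise must be controlled only for `n` deterministic minimizers.
  -- `lam ≥ 4` gives `lam ≤ 4 l`, the lower bound on `lam` gives `32 ‖Z‖_op ≤ l`, and `lam ≤ C₃ w ^
  -- 3 ≤ n` gives `l ≤ n`.
  set l := ⌊lam / 2⌋₊ with hl
  have hl1 : (l : ℝ) ≤ lam / 2 := Nat.floor_le (by linarith)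
  have hl2 : lam / 2 < l + 1 := Nat.lt_floor_add_one _
  have hl4 : lam ≤ 4 * l := by linarith
  have hlR : (1 : ℝ) ≤ l := by linarith
  have hlN : 1 ≤ l := by exact_mod_cast hlR
  have hln : l ≤ n := by
    have : (l : ℝ) ≤ n := by
      rw [hn]
      calc (l : ℝ) ≤ lam := by linarith
        _ ≤ C₃ * w ^ 3 := hhi
        _ ≤ w * w ^ 3 := by gcongr
        _ = w ^ 4 := by ring
    exact_mod_cast this
  have h1 := hq.matInner_noise_le (hp l hlN) hq₀ hb hm hlR (by linarith) (hcut l hlN) hLip0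
    (fun i j hij => hLip _ _ ((hη i j).trans (by linarith)) (by
      have := abs_add_le (linearPredictor x q₀.1 q₀.2 i j)
        (linearPredictor x (p l).1 (p l).2 i j - linearPredictor x q₀.1 q₀.2 i j)
      rw [add_sub_cancel] at this
      linarith [hη i j]))
    hZ.opNorm_le (by nlinarith) hC (by positivity) (hZ.subspace l hlN hln) (hZ.inner_pen l hlN hln)
    (add_le_add hZ.inner_true (matInner_noise_le_crude hZ hK hq.mem hq₀).1)
  have hs : √(4 * w ^ 2) = 2 * w := by
    rw [show 4 * w ^ 2 = (2 * w) ^ 2 by ring]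
    exact Real.sqrt_sq (by positivity)
  rw [hs] at h1
  set E := 64 * (C * w ^ 2) ^ 2 * R + 8 * C ^ 2 * R ^ 2 * (Lip + 1)
  have hE : E ≤ (64 * C ^ 2 * CR + 8 * C ^ 2 * CR ^ 2 * (Lip + 1)) * w ^ 8 := by
    calc E ≤ 64 * (C * w ^ 2) ^ 2 * (CR * w ^ 4) + 8 * C ^ 2 * (CR * w ^ 4) ^ 2 * (Lip + 1) := by
          simp only [E]; gcongr
      _ = _ := by ring
  have hE0 : 0 ≤ E := by positivity
  have hEl : lam * (E / l) ≤ 4 * E := by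
    rw [mul_div_assoc', div_le_iff₀ (by linarith)]
    nlinarith
  have h3 : K * w ^ 5 + 2 * (K * w ^ 4 + 2 * Kβ * K * w ^ 4) + 2 * C * R * (2 * w) ≤
      (K + 2 * ((1 + 2 * Kβ) * K) + 4 * C * CR) * w ^ 5 := by
    have e1 : w ^ 4 ≤ w ^ 5 := pow_le_pow_right₀ hw (by norm_num)
    have e2 : 2 * C * R * (2 * w) ≤ 2 * C * (CR * w ^ 4) * (2 * w) := by gcongr
    have e3 : (2 * ((1 + 2 * Kβ) * K)) * w ^ 4 ≤ (2 * ((1 + 2 * Kβ) * K)) * w ^ 5 := by gcongr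
    nlinarith
  calc _ ≤ lam * (K * w ^ 5 + 2 * (K * w ^ 4 + 2 * Kβ * K * w ^ 4) + 2 * C * R * (2 * w) +
        E / l) := by gcongr
    _ = lam * (K * w ^ 5 + 2 * (K * w ^ 4 + 2 * Kβ * K * w ^ 4) + 2 * C * R * (2 * w)) +
        lam * (E / l) := by ring
    _ ≤ C₃ * w ^ 3 * ((K + 2 * ((1 + 2 * Kβ) * K) + 4 * C * CR) * w ^ 5) + 4 * E := by
        refine add_le_add ?_ hEl
        exact mul_le_mul hhi h3 (by positivity) (by positivity)
    _ ≤ C₃ * w ^ 3 * ((K + 2 * ((1 + 2 * Kβ) * K) + 4 * C * CR) * w ^ 5) +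
        4 * ((64 * C ^ 2 * CR + 8 * C ^ 2 * CR ^ 2 * (Lip + 1)) * w ^ 8) := by gcongr
    _ = _ := by ring

/-- For a vanishing low-rank part the score level is controlled by the radius. -/
theorem IsStationary.opNorm_mul_le_of_eq_zero
    (hq : IsStationary b x (linearPredictor x q₀.1 q₀.2) Z R Kβ q)
    (hb : Differentiable ℝ b) (hm : Monotone (deriv b)) (hq₀ : q₀ ∈ feasible n m R Kβ)
    (h0 : q₀.1 = 0) (hR1 : 1 ≤ R) {C CR a w : ℝ} (hR : R ≤ CR * w ^ 4) (hC : 0 ≤ C)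
    (ha : 0 ≤ a)
    (hg0 : 0 ≤ matInner Z (linearPredictor x q.1 q.2 - linearPredictor x q₀.1 q₀.2))
    (hg : matInner Z (linearPredictor x q.1 q.2 - linearPredictor x q₀.1 q₀.2) ≤
      C * w ^ 2 * R + a * w ^ 4) :
    opNorm (Z - linkDiff b (linearPredictor x q₀.1 q₀.2) (linearPredictor x q.1 q.2)) *
      matInner Z (linearPredictor x q.1 q.2 - linearPredictor x q₀.1 q₀.2) ≤
      (2 * C ^ 2 * CR + 2 * a ^ 2) * w ^ 8 := by
  have h1 := hq.penalized_le hb hm q₀ hq₀.2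
  have hF := bregSum_nonneg (linearPredictor x q₀.1 q₀.2) (linearPredictor x q.1 q.2) hb hm
  have e : matInner Z (0 : Matrix (Fin n) (Fin n) ℝ) = 0 := by simp [matInner]
  have e2 : nuclearNorm q₀.1 = 0 := by rw [h0, nuclearNorm_zero]
  rw [bregSum_self, sub_self, e2, e, mul_zero] at h1
  set g := matInner Z (linearPredictor x q.1 q.2 - linearPredictor x q₀.1 q₀.2)
  set lam := opNorm (Z - linkDiff b (linearPredictor x q₀.1 q₀.2) (linearPredictor x q.1 q.2))
  -- The truth has zero divergence and zero nuclear norm. The target is then proved after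
  -- multiplication by `R`, through `lam R g ≤ g ^ 2`.
  have h2 : lam * R ≤ g := by linarith
  have hR0 : 0 ≤ R := by linarith
  have h3 : g * g ≤ 2 * (C * w ^ 2 * R) ^ 2 + 2 * (a * w ^ 4) ^ 2 := by
    have : g * g ≤ (C * w ^ 2 * R + a * w ^ 4) * (C * w ^ 2 * R + a * w ^ 4) := by gcongr
    nlinarith [sq_nonneg (C * w ^ 2 * R - a * w ^ 4)]
  have h4 : lam * g * R ≤ (2 * C ^ 2 * CR + 2 * a ^ 2) * w ^ 8 * R := by
    have h5 : lam * R * g ≤ g * g := by gcongr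
    have h6 : (C * w ^ 2 * R) ^ 2 ≤ C ^ 2 * w ^ 4 * (CR * w ^ 4) * R := by
      calc (C * w ^ 2 * R) ^ 2 = C ^ 2 * w ^ 4 * R * R := by ring
        _ ≤ _ := by gcongr
    have h7 : (a * w ^ 4) ^ 2 ≤ a ^ 2 * w ^ 8 * R := by
      calc (a * w ^ 4) ^ 2 = a ^ 2 * w ^ 8 * 1 := by ring
        _ ≤ _ := by gcongr
    calc lam * g * R = lam * R * g := by ring
      _ ≤ 2 * (C ^ 2 * w ^ 4 * (CR * w ^ 4) * R) + 2 * (a ^ 2 * w ^ 8 * R) := by linarith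
      _ = _ := by ring
  exact le_of_mul_le_mul_right h4 (by linarith)

/-- For a vanishing low-rank part and a bounded radius all canonical parameters are bounded. -/
theorem frobeniusNorm_linkDiff_sq_le_of_radius_le_one (hm : Monotone (deriv b))
    {Kx Kη B Lip : ℝ} (hx : ∀ i j, ‖x i j‖ ≤ Kx) (hKx : 0 ≤ Kx) (hq : q ∈ feasible n m R Kβ)
    (hq₀ : q₀ ∈ feasible n m R Kβ) (h0 : q₀.1 = 0) (hR1 : R ≤ 1)
    (hη : ∀ i j, |linearPredictor x q₀.1 q₀.2 i j| ≤ Kη) (hB0 : 0 < B)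
    (hB : 1 + 2 * Kx * Kβ ≤ B) (hLip0 : 0 ≤ Lip)
    (hLip : ∀ s t, |s| ≤ Kη + B → |t| ≤ Kη + B → |deriv b t - deriv b s| ≤ Lip * |t - s|) :
    frobeniusNorm (linkDiff b (linearPredictor x q₀.1 q₀.2) (linearPredictor x q.1 q.2)) ^ 2 ≤
      2 * Lip * matInner (linkDiff b (linearPredictor x q₀.1 q₀.2) (linearPredictor x q.1 q.2))
        (linearPredictor x q.1 q.2 - linearPredictor x q₀.1 q₀.2) := by
  have hdiff : ∀ i j, |linearPredictor x q.1 q.2 i j - linearPredictor x q₀.1 q₀.2 i j| ≤ B :=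
    fun i j => by
    have h1 := congrFun (congrFun (linearPredictor_sub (x := x) q₀.1 q.1 q₀.2 q.2) i) j
    have e : (q.1 - q₀.1) i j = q.1 i j := by rw [h0, sub_zero]
    rw [Matrix.sub_apply, Matrix.add_apply, e] at h1
    rw [h1]
    refine (abs_add_le _ _).trans ?_
    have h2 : |q.1 i j| ≤ 1 := (abs_apply_le_frobeniusNorm q.1 i j).trans
      ((frobeniusNorm_le_nuclearNorm q.1).trans (hq.1.trans hR1))
    have h3 := abs_linearPredictor_zero_le x hx (q.2 - q₀.2) i j
    have h4 : ‖q.2 - q₀.2‖ ≤ 2 * Kβ := by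
      have := norm_sub_le q.2 q₀.2
      linarith [hq.2, hq₀.2]
    have h5 : Kx * ‖q.2 - q₀.2‖ ≤ Kx * (2 * Kβ) := by gcongr
    linarith
  have hD : ∀ i j, |linkDiff b (linearPredictor x q₀.1 q₀.2) (linearPredictor x q.1 q.2) i j| ≤
      Lip * |linearPredictor x q.1 q.2 i j - linearPredictor x q₀.1 q₀.2 i j| := fun i j =>
    hLip _ _ ((hη i j).trans (by linarith)) (by
      have := abs_add_le (linearPredictor x q₀.1 q₀.2 i j)
        (linearPredictor x q.1 q.2 i j - linearPredictor x q₀.1 q₀.2 i j)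
      rw [add_sub_cancel] at this
      linarith [hη i j, hdiff i j])
  -- All deviations are at most `B`, so the choice `M = Lip * B` turns `Lip + M / B` into `2 * Lip`.
  have h1 := frobeniusNorm_linkDiff_sq_le _ _ hm hB0 hLip0 (M := Lip * B) (by positivity)
    (fun i j _ => hD i j) (fun i j => (hD i j).trans (by gcongr; exact hdiff i j))
  rwa [mul_div_assoc, div_self hB0.ne', mul_one, ← two_mul] at h1

/-- On the event of good noise the error of the fitted means is small. -/
theorem exists_frobeniusNorm_linkDiff_le (hb : ContDiff ℝ 2 b) (hm : Monotone (deriv b)) (m : ℕ)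
    {Kθ Kβ Kx CR C K c₀ ε : ℝ} (hKθ : 0 ≤ Kθ) (hKβ : 0 ≤ Kβ) (hKx : 0 ≤ Kx) (hCR : 0 ≤ CR)
    (hC : 0 ≤ C) (hK : 0 ≤ K) (hc₀ : 0 < c₀) (hε : 0 < ε) :
    ∃ W : ℝ, 1 ≤ W ∧ ∀ (n : ℕ) (x : Fin n → Fin n → EuclideanSpace ℝ (Fin m))
      (q₀ q : Matrix (Fin n) (Fin n) ℝ × EuclideanSpace ℝ (Fin m))
      (p : ℕ → Matrix (Fin n) (Fin n) ℝ × EuclideanSpace ℝ (Fin m))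
      (U V : ℕ → Submodule ℝ (EuclideanSpace ℝ (Fin n))) (Z : Matrix (Fin n) (Fin n) ℝ)
      (R w : ℝ), W ≤ w → (n : ℝ) = w ^ 4 → (∀ i j, ‖x i j‖ ≤ Kx) → (∀ i j, |q₀.1 i j| ≤ Kθ) →
      q₀ ∈ feasible n m R Kβ → R ≤ CR * w ^ 4 → (q₀.1 = 0 ∨ c₀ * w ^ 4 ≤ R) →
      (∀ j : ℕ, 1 ≤ j → IsPenalizedMin b x (linearPredictor x q₀.1 q₀.2) j Kβ (p j)) →
      (∀ j : ℕ, 1 ≤ j → ∀ u v, bilin (-((j : ℝ)⁻¹ • linkDiff b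
        (linearPredictor x q₀.1 q₀.2) (linearPredictor x (p j).1 (p j).2))) u v ≤
        ‖(U j).starProjection u‖ * ‖(V j).starProjection v‖ +
        1 / 2 * (‖u - (U j).starProjection u‖ * ‖v - (V j).starProjection v‖)) →
      IsStationary b x (linearPredictor x q₀.1 q₀.2) Z R Kβ q →
      GoodNoise b x q₀ p U V C K w Z →
      frobeniusNorm (linkDiff b (linearPredictor x q₀.1 q₀.2) (linearPredictor x q.1 q.2)) ≤
        ε * w ^ 4 := by
  have hbd : Differentiable ℝ b := hb.differentiable (by norm_num)
  set Kη := Kθ + Kx * Kβ with hKη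
  obtain ⟨Lip, hLip0, hLip⟩ := exists_lipschitz_deriv hb (Kη + 1)
  set C₅ := C * CR + (1 + 2 * Kβ) * K with hC₅
  have hC₅0 : 0 ≤ C₅ := by positivity
  have hKη0 : 0 ≤ Kη := by positivity
  set C₃ := (C₅ + Lip * Kθ ^ 2 + K) / c₀ with hC₃
  have hC₃0 : 0 ≤ C₃ := by positivity
  set C₄ := (128 * C + 4) * C₅ + (2 * C ^ 2 * CR + 2 * ((1 + 2 * Kβ) * K) ^ 2) +
    (C₃ * (K + 2 * ((1 + 2 * Kβ) * K) + 4 * C * CR) +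
        4 * (64 * C ^ 2 * CR + 8 * C ^ 2 * CR ^ 2 * (Lip + 1))) with hC₄
  have hC₄0 : 0 ≤ C₄ := by positivity
  obtain ⟨W₁, hW₁, hmain⟩ :=
    exists_frobeniusNorm_le_of_mul_le hb hm Kη C C₄ C₅ hC hC₄0 hC₅0 hε
  set B := 1 + 2 * Kx * Kβ with hB
  have hB0 : 0 < B := by positivity
  obtain ⟨Lip', hLip'0, hLip'⟩ := exists_lipschitz_deriv hb (Kη + B)
  have hr0 : 0 ≤ 2 * Lip' * C₅ / ε ^ 2 := by positivity
  refine ⟨W₁ + C₃ + 2 * Lip' * C₅ / ε ^ 2, by linarith, ?_⟩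
  intro n x q₀ q p U V Z R w hw hn hx hθ hq₀ hRCR hR hp hcut hq hZ
  have hw1 : 1 ≤ w := by linarith
  have hw0 : 0 < w := by linarith
  have hR0 : 0 ≤ R := (nuclearNorm_nonneg _).trans hq₀.1
  have hη : ∀ i j, |linearPredictor x q₀.1 q₀.2 i j| ≤ Kη := fun i j =>
    (abs_linearPredictor_le hx hKx q₀.1 hq₀.2 i j).trans (by linarith [hθ i j])
  obtain ⟨hcov, hg⟩ := matInner_noise_le_crude hZ hK hq.mem hq₀
  have hSg := hq.matInner_linkDiff_le hq₀
  set S := matInner (linkDiff b (linearPredictor x q₀.1 q₀.2) (linearPredictor x q.1 q.2))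
    (linearPredictor x q.1 q.2 - linearPredictor x q₀.1 q₀.2) with hS
  have hS0 : 0 ≤ S := matInner_linkDiff_nonneg _ _ hm
  set g := matInner Z (linearPredictor x q.1 q.2 - linearPredictor x q₀.1 q₀.2) with hgdef
  set lam := opNorm (Z - linkDiff b (linearPredictor x q₀.1 q₀.2) (linearPredictor x q.1 q.2))
    with hlam
  have hlam0 : 0 ≤ lam := opNorm_nonneg _
  have h46 : w ^ 4 ≤ w ^ 6 := pow_le_pow_right₀ hw1 (by norm_num)
  have hg6 : g ≤ C₅ * w ^ 6 := by
    have h1 : C * w ^ 2 * R ≤ C * w ^ 2 * (CR * w ^ 4) := by gcongr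
    have h2 : (1 + 2 * Kβ) * K * w ^ 4 ≤ (1 + 2 * Kβ) * K * w ^ 6 := by gcongr
    calc g ≤ _ := hg
      _ ≤ C * w ^ 2 * (CR * w ^ 4) + (1 + 2 * Kβ) * K * w ^ 6 := add_le_add h1 h2
      _ = _ := by rw [hC₅]; ring
  have hS6 : S ≤ C₅ * w ^ 6 := hSg.trans hg6
  have hC₄a : 0 ≤ C₃ * (K + 2 * ((1 + 2 * Kβ) * K) + 4 * C * CR) +
        4 * (64 * C ^ 2 * CR + 8 * C ^ 2 * CR ^ 2 * (Lip + 1)) := by positivity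
  have hC₄b : 0 ≤ 2 * C ^ 2 * CR + 2 * ((1 + 2 * Kβ) * K) ^ 2 := by positivity
  have hC₄c : 0 ≤ (128 * C + 4) * C₅ := by positivity
  have hw8 : 0 ≤ w ^ 8 := by positivity
  have hmain' : lam * S ≤ C₄ * w ^ 8 → frobeniusNorm (linkDiff b (linearPredictor x q₀.1 q₀.2)
      (linearPredictor x q.1 q.2)) ≤ ε * w ^ 4 := fun h =>
    hmain n _ _ Z w (by linarith) hη hZ.opNorm_le hS6 h
  -- A multiplier of order `√n` needs only the crude bound `S ≤ C₅ w ^ 6`. Above it, the argument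
  -- depends on whether the low-rank part vanishes.
  rcases le_total lam ((128 * C + 4) * w ^ 2) with hsm | hlg
  · apply hmain'
    calc lam * S ≤ ((128 * C + 4) * w ^ 2) * (C₅ * w ^ 6) := by gcongr
      _ = (128 * C + 4) * C₅ * w ^ 8 := by ring
      _ ≤ C₄ * w ^ 8 := by gcongr; linarith
  have hlamS : lam * S ≤ lam * g := by gcongr
  rcases hR with h0 | hR
  · rcases le_total 1 R with hR1 | hR1
    · apply hmain'
      refine hlamS.trans ((hq.opNorm_mul_le_of_eq_zero hbd hm hq₀ h0 hR1 hRCR hC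
        (by positivity) (hS0.trans hSg) hg).trans ?_)
      gcongr
      linarith
    · have h1 := frobeniusNorm_linkDiff_sq_le_of_radius_le_one hm hx hKx hq.mem hq₀ h0 hR1 hη
        hB0 hB.ge hLip'0 hLip'
      refine le_of_sq_le_sq (h1.trans ?_) (by positivity)
      have h4 : 2 * Lip' * C₅ / ε ^ 2 ≤ w := by linarith only [hw, hW₁, hC₃0]
      rw [div_le_iff₀ (by positivity)] at h4
      calc 2 * Lip' * S ≤ 2 * Lip' * (C₅ * w ^ 6) := by gcongr
        _ = 2 * Lip' * C₅ * w ^ 6 := by ring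
        _ ≤ w * ε ^ 2 * w ^ 6 := by gcongr
        _ = ε ^ 2 * w ^ 7 := by ring
        _ ≤ ε ^ 2 * w ^ 8 := by
            gcongr
            norm_num
        _ = _ := by ring
  · apply hmain'
    have hhi := hq.opNorm_le_of_large_radius hq₀ hbd hm hKx hKθ hKη.ge hLip0 hK
      (fun s t hs ht => hLip s t (by linarith) (by linarith)) hx hθ hw1 hn hc₀ hR hZ.inner_true
      hg6
    have h1 := hq.opNorm_mul_matInner_noise_le hq₀ hbd hm hp hcut hZ hC hK hKβ hLip0 hLip hη
      hw1 (by linarith) hC₃0 hn hRCR hlg hhi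
    refine hlamS.trans (h1.trans ?_)
    gcongr
    linarith

end DeterministicRate

/-! ### Probability of the good noise event -/

theorem matInner_noiseMatrix {Ω : Type*} {n : ℕ} {Z : Fin n × Fin n → Ω → ℝ}
    (T : Matrix (Fin n) (Fin n) ℝ) (ω : Ω) :
    matInner (noiseMatrix Z ω) T = ∑ p : Fin n × Fin n, T p.1 p.2 * Z p ω := by
  rw [Fintype.sum_prod_type]
  exact Finset.sum_congr rfl fun i _ => Finset.sum_congr rfl fun j _ => mul_comm _ _

section NoiseEvents

variable {Ω : Type*} [MeasurableSpace Ω] {μ : Measure Ω} [IsProbabilityMeasure μ] {c : ℝ}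
  {n m : ℕ} {Z : Fin n × Fin n → Ω → ℝ}

theorem frobeniusNorm_sq (T : Matrix (Fin n) (Fin n) ℝ) :
    frobeniusNorm T ^ 2 = ∑ p : Fin n × Fin n, T p.1 p.2 ^ 2 := by
  rw [Fintype.sum_prod_type]
  exact Real.sq_sqrt (Finset.sum_nonneg fun i _ => Finset.sum_nonneg fun j _ => sq_nonneg _)

theorem frobeniusNorm_sq_le_of_abs_le {T : Matrix (Fin n) (Fin n) ℝ} {a : ℝ}
    (h : ∀ i j, |T i j| ≤ a) : frobeniusNorm T ^ 2 ≤ (a * n) ^ 2 := by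
  rw [frobeniusNorm_sq]
  have h1 : ∀ p ∈ (Finset.univ : Finset (Fin n × Fin n)), T p.1 p.2 ^ 2 ≤ a ^ 2 := fun p _ =>
    sq_le_sq' (abs_le.1 (h p.1 p.2)).1 (abs_le.1 (h p.1 p.2)).2
  refine (Finset.sum_le_sum h1).trans (le_of_eq ?_)
  simp only [Finset.sum_const, Finset.card_univ, Fintype.card_prod, Fintype.card_fin,
    nsmul_eq_mul, Nat.cast_mul]
  ring

theorem IsNoise.measure_matInner_ge_le (hZ : IsNoise μ c Z) (hc : 0 ≤ c)
    {T : Matrix (Fin n) (Fin n) ℝ} {ρ : ℝ} (hρ : 0 < ρ) (hT : frobeniusNorm T ^ 2 ≤ ρ ^ 2) (t : ℝ) :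
    μ.real {ω | t * ρ ≤ |matInner (noiseMatrix Z ω) T|} ≤ 2 * Real.exp (c - t) := by
  simp only [matInner_noiseMatrix]
  rw [frobeniusNorm_sq] at hT
  exact hZ.measure_linear_ge_le hc Finset.univ (fun p => T p.1 p.2) hρ hT t

theorem quadFail_anti {n : ℕ} {c k k' t : ℝ} (hc : 0 ≤ c) (hk : k ≤ k') :
    quadFail n c k' t ≤ quadFail n c k t := by
  unfold quadFail
  gcongr

/-- The covariate forms are controlled by the forms of the single covariates. -/
theorem abs_matInner_linearPredictor_zero_le (Y : Matrix (Fin n) (Fin n) ℝ)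
    {x : Fin n → Fin n → EuclideanSpace ℝ (Fin m)} {a : ℝ}
    (h : ∀ k, |matInner Y (Matrix.of fun i j => x i j k)| ≤ a) (δ : EuclideanSpace ℝ (Fin m)) :
    |matInner Y (linearPredictor x 0 δ)| ≤ m * a * ‖δ‖ := by
  have e : matInner Y (linearPredictor x 0 δ) =
      ∑ k, δ k * matInner Y (Matrix.of fun i j => x i j k) := by
    simp only [matInner, linearPredictor, Matrix.of_apply, Matrix.zero_apply, zero_add,
      Finset.mul_sum]
    rw [Finset.sum_comm (s := (Finset.univ : Finset (Fin m)))]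
    refine Finset.sum_congr rfl fun i _ => ?_
    rw [Finset.sum_comm (s := (Finset.univ : Finset (Fin m)))]
    exact Finset.sum_congr rfl fun j _ => Finset.sum_congr rfl fun k _ => by ring
  rw [e]
  refine (Finset.abs_sum_le_sum_abs _ _).trans ?_
  have h1 : ∀ k ∈ Finset.univ, |δ k * matInner Y (Matrix.of fun i j => x i j k)| ≤ ‖δ‖ * a :=
    fun k _ => by
      rw [abs_mul]
      exact mul_le_mul (by simpa using PiLp.norm_apply_le δ k) (h k) (abs_nonneg _) (norm_nonneg _)
  refine (Finset.sum_le_sum h1).trans (le_of_eq ?_)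
  simp only [Finset.sum_const, Finset.card_univ, Fintype.card_fin, nsmul_eq_mul]
  ring

theorem opNorm_le_of_subspaceBound_top {Y : Matrix (Fin n) (Fin n) ℝ} {M : ℝ} (hM : 0 ≤ M)
    (h : SubspaceBound Y ⊤ ⊤ M) : opNorm Y ≤ M :=
  opNorm_le hM fun u v => (le_abs_self _).trans
    (h u Submodule.mem_top v Submodule.mem_top)

/-- The failure probability of the properties of the noise that are needed up to growing
factors. -/
noncomputable def goodNoiseFail (n : ℕ) (c : ℝ) (L k : ℕ) (t : ℝ) : ℝ :=
  (2 * (n * Real.exp (-L))) ^ 2 +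
    (n + 1) * (2 * (n ^ L * (5 ^ L * quadFail n c k t)) + 2 * Real.exp (-k)) +
    n * (2 * Real.exp (c - t))

theorem subspaceConst_nonneg {c : ℝ} (hc : 0 ≤ c) : 0 ≤ subspaceConst c := by
  unfold subspaceConst; positivity

/-- The minimizers and their cut subspaces are deterministic, so a union bound over the levels `1,
…, n` is enough. Forms needed at `n` levels use a growing `t ≤ w`; the few forms needed at the sharp
order `n` use a fixed `s`, whose failure probability is small but does not vanish. -/
theorem IsNoise.measure_not_goodNoise_le (hZ : IsNoise μ c Z) (hc : 1 ≤ c) (hn : 0 < n)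
    {b : ℝ → ℝ} {x : Fin n → Fin n → EuclideanSpace ℝ (Fin m)}
    {q₀ : Matrix (Fin n) (Fin n) ℝ × EuclideanSpace ℝ (Fin m)}
    {p : ℕ → Matrix (Fin n) (Fin n) ℝ × EuclideanSpace ℝ (Fin m)}
    {U V : ℕ → Submodule ℝ (EuclideanSpace ℝ (Fin n))} {K w t s : ℝ} {L k : ℕ}
    (hw : 0 ≤ w) (hnw : (n : ℝ) = w ^ 4) (hL : 1 ≤ L) (hnL : n * Real.exp (-L) ≤ 1)
    (hLk : L ^ 4 ≤ k) (hkw : (k : ℝ) ≤ 4 * w ^ 2) (hkn : k ≤ n) (ht : 1 ≤ t) (htw : t ≤ w)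
    (hs : 1 ≤ s) (hK : 0 < K) (hx : ∀ i j, ‖x i j‖ ≤ K) (hθ : ∀ i j, |q₀.1 i j| ≤ K)
    (hpen : ∀ j, 1 ≤ j → j ≤ n → frobeniusNorm (linearPredictor x (p j).1 (p j).2 -
      linearPredictor x q₀.1 q₀.2) ^ 2 ≤ (K * n) ^ 2)
    (hU : ∀ j, 1 ≤ j → j ≤ n → (Module.finrank ℝ (U j) : ℝ) ≤ 4 * frobeniusNorm ((j : ℝ)⁻¹ •
      linkDiff b (linearPredictor x q₀.1 q₀.2) (linearPredictor x (p j).1 (p j).2)) ^ 2)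
    (hV : ∀ j, 1 ≤ j → j ≤ n → (Module.finrank ℝ (V j) : ℝ) ≤ 4 * frobeniusNorm ((j : ℝ)⁻¹ •
      linkDiff b (linearPredictor x q₀.1 q₀.2) (linearPredictor x (p j).1 (p j).2)) ^ 2) :
    μ.real {ω | ¬ GoodNoise b x q₀ p U V (subspaceConst c) ((m + 1) * (s * K)) w
      (noiseMatrix Z ω)} ≤ goodNoiseFail n c L k t + (m + 1) * (2 * Real.exp (c - s)) := by
  have hc0 : 0 ≤ c := by linarith
  have hn0 : (0 : ℝ) < n := by exact_mod_cast hn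
  set D : Set Ω := {ω | Discrepancy (c + 1) L (fun i j => Z (i, j) ω)} with hD
  -- The dimensions are padded by `k`: a subspace of tiny dimension would otherwise give too weak a
  -- probability bound.
  set d : ℕ → ℕ := fun j => k + max (Module.finrank ℝ (U j)) (Module.finrank ℝ (V j)) with hd
  set S₀ : Set Ω := {ω | Discrepancy (c + 1) L (fun i j => Z (i, j) ω) ∧
    ¬ SubspaceBound (noiseMatrix Z ω) ⊤ ⊤ (subspaceConst c * √(n : ℝ))} with hS₀
  set S : ℕ → Set Ω := fun j => {ω | Discrepancy (c + 1) L (fun i j => Z (i, j) ω) ∧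
    ¬ SubspaceBound (noiseMatrix Z ω) (U j) (V j) (subspaceConst c * √(d j : ℝ))} with hS
  set P : ℕ → Set Ω := fun j => {ω | t * (K * n) ≤ |matInner (noiseMatrix Z ω)
    (linearPredictor x (p j).1 (p j).2 - linearPredictor x q₀.1 q₀.2)|} with hP
  set T : Set Ω := {ω | s * (K * n) ≤ |matInner (noiseMatrix Z ω) q₀.1|} with hT
  set X : Fin m → Set Ω := fun k => {ω | s * (K * n) ≤ |matInner (noiseMatrix Z ω)
    (Matrix.of fun i j => x i j k)|} with hX
  have hsub : {ω | ¬ GoodNoise b x q₀ p U V (subspaceConst c) ((m + 1) * (s * K)) w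
      (noiseMatrix Z ω)} ⊆ ((((Dᶜ ∪ S₀) ∪ ⋃ j ∈ Finset.Icc 1 n, S j) ∪
        ⋃ j ∈ Finset.Icc 1 n, P j) ∪ T) ∪ ⋃ k ∈ Finset.univ, X k := by
    intro ω hω
    by_contra hcon
    simp only [Set.mem_union, Set.mem_iUnion, Finset.mem_Icc, Finset.mem_univ, not_or, not_exists,
      Set.mem_compl_iff, not_not] at hcon
    obtain ⟨⟨⟨⟨⟨h1, h2⟩, h3⟩, h4⟩, h5⟩, h6⟩ := hcon
    have h1' : Discrepancy (c + 1) L (fun i j => Z (i, j) ω) := h1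
    apply hω
    have hm0 : (0 : ℝ) ≤ m := Nat.cast_nonneg m
    have hsK : 0 ≤ s * K * w ^ 4 := by positivity
    have hX' : ∀ k, |matInner (noiseMatrix Z ω) (Matrix.of fun i j => x i j k)| ≤ s * (K * n) :=
      fun k => by
        have := h6 k trivial
        simp only [X, Set.mem_ofPred_eq, not_le] at this
        exact this.le
    refine ⟨?_, ?_, fun δ => ?_, fun j hj hjn => ?_, fun j hj hjn => ?_⟩
    · have h7 : SubspaceBound (noiseMatrix Z ω) ⊤ ⊤ (subspaceConst c * √(n : ℝ)) := by
        by_contra h; exact h2 ⟨h1', h⟩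
      have h8 : √(n : ℝ) = w ^ 2 := by
        rw [hnw, show w ^ 4 = (w ^ 2) ^ 2 by ring]
        exact Real.sqrt_sq (by positivity)
      rw [h8] at h7
      have := subspaceConst_nonneg hc0
      exact opNorm_le_of_subspaceBound_top (by positivity) h7
    · simp only [T, Set.mem_ofPred_eq, not_le] at h5
      rw [hnw] at h5
      have : 0 ≤ m * (s * K * w ^ 4) := by positivity
      linarith
    · refine (abs_matInner_linearPredictor_zero_le _ hX' δ).trans ?_
      rw [hnw]
      have h7 : (m : ℝ) * (s * (K * w ^ 4)) ≤ (m + 1) * (s * K) * w ^ 4 := by linarith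
      gcongr
    · have := h4 j ⟨hj, hjn⟩
      simp only [P, Set.mem_ofPred_eq, not_le] at this
      refine this.le.trans ?_
      rw [hnw]
      calc t * (K * w ^ 4) ≤ w * (K * w ^ 4) := by gcongr
        _ = 1 * (1 * K) * w ^ 5 := by ring
        _ ≤ (m + 1) * (s * K) * w ^ 5 := by gcongr; linarith
    · have h7 : SubspaceBound (noiseMatrix Z ω) (U j) (V j) (subspaceConst c * √(d j : ℝ)) := by
        by_contra h; exact h3 j ⟨hj, hjn⟩ ⟨h1', h⟩
      have h8 : (d j : ℝ) ≤ 4 * w ^ 2 + 4 * frobeniusNorm ((j : ℝ)⁻¹ •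
          linkDiff b (linearPredictor x q₀.1 q₀.2) (linearPredictor x (p j).1 (p j).2)) ^ 2 := by
        rw [hd]
        push_cast
        exact add_le_add hkw (max_le (hU j hj hjn) (hV j hj hjn))
      intro u hu v hv
      have := subspaceConst_nonneg hc0
      refine (h7 u hu v hv).trans ?_
      gcongr
  have hq : ∀ k' : ℕ, k ≤ k' → 2 * (n ^ L * (5 ^ L * quadFail n c k' t)) + 2 * Real.exp (-k') ≤
      2 * (n ^ L * (5 ^ L * quadFail n c k t)) + 2 * Real.exp (-k) := fun k' hk' => by
    have h1 : (k : ℝ) ≤ k' := by exact_mod_cast hk'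
    have := quadFail_anti (n := n) (t := t) hc0 h1
    gcongr
  have b1 : μ.real Dᶜ ≤ (2 * (n * Real.exp (-L))) ^ 2 := hZ.measure_not_discrepancy_le hnL
  have hfin : ∀ W : Submodule ℝ (EuclideanSpace ℝ (Fin n)), Module.finrank ℝ W ≤ n := fun W => by
    simpa using Submodule.finrank_le W
  have b2 : μ.real S₀ ≤ 2 * (n ^ L * (5 ^ L * quadFail n c k t)) + 2 * Real.exp (-k) :=
    (hZ.measure_not_subspaceBound_le hc hn ⊤ ⊤ hL (hLk.trans hkn) (hfin _) (hfin _) ht).trans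
      (hq n hkn)
  have b3 : μ.real (⋃ j ∈ Finset.Icc 1 n, S j) ≤
      n * (2 * (n ^ L * (5 ^ L * quadFail n c k t)) + 2 * Real.exp (-k)) := by
    refine (measureReal_biUnion_finset_le _ _).trans ?_
    refine (Finset.sum_le_card_nsmul _ _ _ fun j _ =>
      (hZ.measure_not_subspaceBound_le hc hn (U j) (V j) hL (hLk.trans (Nat.le_add_right _ _))
        ((le_max_left _ _).trans (Nat.le_add_left _ _))
        ((le_max_right _ _).trans (Nat.le_add_left _ _)) ht).trans
          (hq (d j) (Nat.le_add_right _ _))).trans (le_of_eq ?_)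
    simp only [Nat.card_Icc, add_tsub_cancel_right, nsmul_eq_mul]
  have b4 : μ.real (⋃ j ∈ Finset.Icc 1 n, P j) ≤ n * (2 * Real.exp (c - t)) := by
    refine (measureReal_biUnion_finset_le _ _).trans ?_
    refine (Finset.sum_le_card_nsmul _ _ _ fun j hj =>
      hZ.measure_matInner_ge_le hc0 (by positivity : 0 < K * n)
        (hpen j (Finset.mem_Icc.1 hj).1 (Finset.mem_Icc.1 hj).2) t).trans (le_of_eq ?_)
    simp
  have b5 : μ.real T ≤ 2 * Real.exp (c - s) :=
    hZ.measure_matInner_ge_le hc0 (by positivity : 0 < K * n) (frobeniusNorm_sq_le_of_abs_le hθ) s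
  have b6 : μ.real (⋃ k ∈ Finset.univ, X k) ≤ m * (2 * Real.exp (c - s)) := by
    refine (measureReal_biUnion_finset_le _ _).trans ?_
    refine (Finset.sum_le_card_nsmul _ _ _ fun k _ =>
      hZ.measure_matInner_ge_le hc0 (by positivity : 0 < K * n) (frobeniusNorm_sq_le_of_abs_le
        fun i j => ?_) s).trans (le_of_eq ?_)
    · exact (by simpa using PiLp.norm_apply_le (x i j) k : |x i j k| ≤ ‖x i j‖).trans (hx i j)
    · simp
  refine (measureReal_mono hsub).trans ?_
  have u1 := measureReal_union_le (μ := μ) ((((Dᶜ ∪ S₀) ∪ ⋃ j ∈ Finset.Icc 1 n, S j) ∪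
        ⋃ j ∈ Finset.Icc 1 n, P j) ∪ T) (⋃ k ∈ Finset.univ, X k)
  have u2 := measureReal_union_le (μ := μ) (((Dᶜ ∪ S₀) ∪ ⋃ j ∈ Finset.Icc 1 n, S j) ∪
        ⋃ j ∈ Finset.Icc 1 n, P j) T
  have u3 := measureReal_union_le (μ := μ) ((Dᶜ ∪ S₀) ∪ ⋃ j ∈ Finset.Icc 1 n, S j)
        (⋃ j ∈ Finset.Icc 1 n, P j)
  have u4 := measureReal_union_le (μ := μ) (Dᶜ ∪ S₀) (⋃ j ∈ Finset.Icc 1 n, S j)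
  have u5 := measureReal_union_le (μ := μ) Dᶜ S₀
  unfold goodNoiseFail
  linarith

end NoiseEvents

/-! ### Choice of `L`, `k`, `t` and the vanishing failure probability -/

section Asymptotics

open Real in
-- With `L ≈ 2 log n`, `k ≈ √n` and `t = n^{1/8}`, the entropy `n ^ L * 5 ^ L` is only `exp (O(log²
-- n))`, whereas each failure is at most `exp (-n^{1/8} / (4 c))` up to polynomial factors.
theorem goodNoiseFail_le {n : ℕ} {c : ℝ} (hc : 1 ≤ c) (hn : 0 < n) :
    goodNoiseFail n c ⌈2 * log n⌉₊ ⌈exp (log n / 2)⌉₊ (exp (log n / 8)) ≤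
      4 * exp (-2 * log n) + 30 * exp ((2 * log n + 1) * (log n + 2) + 2 * log n + c -
        (4 * c)⁻¹ * exp (log n / 8)) := by
  have hn0 : (0 : ℝ) < n := by exact_mod_cast hn
  set y := log n with hy
  have hy0 : 0 ≤ y := log_nonneg (by exact_mod_cast hn)
  have hny : (n : ℝ) = exp y := (exp_log hn0).symm
  set L := ⌈2 * y⌉₊ with hL
  set k := ⌈exp (y / 2)⌉₊ with hk
  set κ := (4 * c)⁻¹ with hκ
  have hκ0 : 0 < κ := by positivity
  have hκ1 : κ ≤ 1 := inv_le_one_of_one_le₀ (by linarith)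
  have hL1 : 2 * y ≤ L := Nat.le_ceil _
  have hL2 : (L : ℝ) ≤ 2 * y + 1 := (Nat.ceil_lt_add_one (by positivity)).le
  have hk1 : exp (y / 2) ≤ k := Nat.le_ceil _
  set z := exp (y / 8) with hz
  have hz1 : 1 ≤ z := one_le_exp (by positivity)
  have hz0 : 0 < z := by linarith
  have hz4 : exp (y / 2) = z ^ 4 := by rw [hz, ← exp_nat_mul]; ring_nf
  rw [hz4] at hk1
  have hzz : κ * z ≤ z := by nlinarith
  set E := exp ((2 * y + 1) * (y + 2) + 2 * y + c - κ * z) with hE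
  have hkt : z ≤ (k : ℝ) / z ^ 2 := by
    rw [le_div_iff₀ (by positivity)]
    calc z * z ^ 2 = z ^ 3 := by ring
      _ ≤ z ^ 4 := by gcongr; norm_num
      _ ≤ k := hk1
  have hkt' : κ * z ≤ (k : ℝ) / (4 * c * z ^ 2) := by
    have : (k : ℝ) / (4 * c * z ^ 2) = κ * (k / z ^ 2) := by rw [hκ]; field_simp
    rw [this]; gcongr
  have hkz : κ * z ≤ k := by
    refine hzz.trans (le_trans ?_ hk1)
    exact le_self_pow₀ hz1 (by norm_num)
  have hq : quadFail n c k z ≤ 6 * exp (y + c - κ * z) := by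
    unfold quadFail
    have h1 : 4 * (n : ℝ) * exp (c - z) ≤ 4 * exp (y + c - κ * z) := by
      rw [hny, mul_assoc, ← exp_add]
      gcongr
      linarith
    have h2 : exp (-(k : ℝ) / z ^ 2) ≤ exp (y + c - κ * z) := by
      rw [neg_div]; gcongr; linarith
    have h3 : exp (-(k : ℝ) / (4 * c * z ^ 2)) ≤ exp (y + c - κ * z) := by
      rw [neg_div]; gcongr; linarith
    linarith
  have hpow : (n : ℝ) ^ L * 5 ^ L ≤ exp ((2 * y + 1) * (y + 2)) := by
    calc (n : ℝ) ^ L * 5 ^ L ≤ exp (L * y) * exp (2 * L) := by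
          rw [hny, ← exp_nat_mul]
          gcongr
          exact natPow_five_le_exp L
      _ = exp (L * (y + 2)) := by rw [← exp_add]; ring_nf
      _ ≤ _ := by gcongr
  have hn1 : (n : ℝ) + 1 ≤ 2 * exp y := by rw [← hny]; linarith [show (1 : ℝ) ≤ n by exact_mod_cast hn]
  have t1 : (2 * (n * exp (-(L : ℝ)))) ^ 2 ≤ 4 * exp (-2 * y) := by
    have : (n : ℝ) * exp (-(L : ℝ)) ≤ exp (-y) := by
      rw [hny, ← exp_add]; gcongr; linarith
    calc (2 * (n * exp (-(L : ℝ)))) ^ 2 ≤ (2 * exp (-y)) ^ 2 := by gcongr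
      _ = 4 * exp (-2 * y) := by rw [mul_pow, ← exp_nat_mul]; ring_nf
  have t2 : ((n : ℝ) + 1) * (2 * (n ^ L * (5 ^ L * quadFail n c k z))) ≤ 24 * E := by
    calc _ = ((n : ℝ) + 1) * (2 * ((n ^ L * 5 ^ L) * quadFail n c k z)) := by ring
      _ ≤ (2 * exp y) * (2 * (exp ((2 * y + 1) * (y + 2)) * (6 * exp (y + c - κ * z)))) := by
          have := quadFail_nonneg n c k z
          gcongr
      _ = 24 * (exp y * (exp ((2 * y + 1) * (y + 2)) * exp (y + c - κ * z))) := by ring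
      _ = 24 * E := by rw [hE, ← exp_add, ← exp_add]; ring_nf
  have hpos : 0 ≤ (2 * y + 1) * (y + 2) := by positivity
  have t3 : ((n : ℝ) + 1) * (2 * exp (-(k : ℝ))) ≤ 4 * E := by
    calc _ ≤ (2 * exp y) * (2 * exp (-(κ * z))) := by gcongr
      _ = 4 * exp (y - κ * z) := by rw [sub_eq_add_neg, exp_add]; ring
      _ ≤ 4 * E := by rw [hE]; gcongr; linarith
  have t4 : (n : ℝ) * (2 * exp (c - z)) ≤ 2 * E := by
    calc (n : ℝ) * (2 * exp (c - z)) = 2 * exp (y + (c - z)) := by rw [hny, exp_add]; ring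
      _ ≤ 2 * E := by rw [hE]; gcongr; linarith
  unfold goodNoiseFail
  linarith

open Real in
theorem tendsto_exp_quadratic_sub_exp (c κ : ℝ) (hκ : 0 < κ) :
    Tendsto (fun y : ℝ => exp ((2 * y + 1) * (y + 2) + 2 * y + c - κ * exp (y / 8))) atTop
      (𝓝 0) := by
  have hz : Tendsto (fun y : ℝ => y / 8) atTop atTop := tendsto_id.atTop_div_const (by norm_num)
  -- The polynomial exponent rewritten in `z = y / 8`: it equals `128 z² + 56 z + 2 + c`.
  have h : Tendsto (fun z : ℝ => (128 * (z ^ 2 * exp (-z)) + 56 * (z ^ 1 * exp (-z)) +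
      (2 + c) * (z ^ 0 * exp (-z)))) atTop (𝓝 (128 * 0 + 56 * 0 + (2 + c) * 0)) :=
    (((tendsto_pow_mul_exp_neg_atTop_nhds_zero 2).const_mul _).add
      ((tendsto_pow_mul_exp_neg_atTop_nhds_zero 1).const_mul _)).add
      ((tendsto_pow_mul_exp_neg_atTop_nhds_zero 0).const_mul _)
  have h1 := (h.comp hz).eventually_le_const (show 128 * 0 + 56 * 0 + (2 + c) * 0 < κ / 2 by
    simpa using hκ)
  have h2 : Tendsto (fun y : ℝ => exp (-(κ / 2 * exp (y / 8)))) atTop (𝓝 0) :=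
    tendsto_exp_neg_atTop_nhds_zero.comp
      ((tendsto_exp_atTop.comp hz).const_mul_atTop (by positivity))
  refine squeeze_zero' (Eventually.of_forall fun y => (exp_pos _).le) ?_ h2
  filter_upwards [h1] with y hy
  have h3 := mul_le_mul_of_nonneg_right hy (exp_pos (y / 8)).le
  have e : exp (-(y / 8)) * exp (y / 8) = 1 := by rw [← exp_add]; simp
  simp only [Function.comp] at h3
  have h4 : (128 * ((y / 8) ^ 2 * exp (-(y / 8))) + 56 * ((y / 8) ^ 1 * exp (-(y / 8))) +
      (2 + c) * ((y / 8) ^ 0 * exp (-(y / 8)))) * exp (y / 8) =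
      ((2 * y + 1) * (y + 2) + 2 * y + c) * (exp (-(y / 8)) * exp (y / 8)) := by ring
  rw [h4, e] at h3
  gcongr
  linarith

open Real in
theorem tendsto_goodNoiseFail {c : ℝ} (hc : 1 ≤ c) :
    Tendsto (fun n : ℕ => goodNoiseFail n c ⌈2 * log n⌉₊ ⌈exp (log n / 2)⌉₊ (exp (log n / 8)))
      atTop (𝓝 0) := by
  have hlog : Tendsto (fun n : ℕ => log n) atTop atTop :=
    tendsto_log_atTop.comp tendsto_natCast_atTop_atTop
  have h1 : Tendsto (fun n : ℕ => 4 * exp (-2 * log n)) atTop (𝓝 0) := by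
    have := (tendsto_exp_neg_atTop_nhds_zero.comp
      (hlog.const_mul_atTop (by norm_num : (0 : ℝ) < 2))).const_mul 4
    simpa [Function.comp_def] using this
  have h2 := ((tendsto_exp_quadratic_sub_exp c (4 * c)⁻¹ (by positivity)).comp hlog).const_mul 30
  have h3 := h1.add h2
  rw [mul_zero, add_zero] at h3
  refine squeeze_zero' (Eventually.of_forall fun n => ?_) ?_ h3
  · have := quadFail_nonneg n c ⌈exp (log n / 2)⌉₊ (exp (log n / 8))
    unfold goodNoiseFail
    positivity
  · filter_upwards [eventually_gt_atTop 0] with n hn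
    exact goodNoiseFail_le hc hn

open Real in
theorem eventually_log_pow_le : ∀ᶠ n : ℕ in atTop, ⌈2 * log n⌉₊ ^ 4 ≤ ⌈exp (log n / 2)⌉₊ := by
  have hlog : Tendsto (fun n : ℕ => log n) atTop atTop :=
    tendsto_log_atTop.comp tendsto_natCast_atTop_atTop
  have h1 := (((tendsto_pow_mul_exp_neg_atTop_nhds_zero 4).const_mul 1296).comp
    (hlog.atTop_div_const (by norm_num : (0 : ℝ) < 2))).eventually_le_const
      (show (1296 : ℝ) * 0 < 1 by norm_num)
  filter_upwards [h1, hlog.eventually_ge_atTop 1] with n hn hn1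
  have h2 : (⌈2 * log n⌉₊ : ℝ) ≤ 3 * log n := by
    have := Nat.ceil_lt_add_one (show 0 ≤ 2 * log n by linarith)
    linarith
  have h3 := mul_le_mul_of_nonneg_right hn (exp_pos (log n / 2)).le
  simp only [Function.comp] at h3
  have e : exp (-(log n / 2)) * exp (log n / 2) = 1 := by rw [← exp_add]; simp
  have h4 : (⌈2 * log n⌉₊ : ℝ) ^ 4 ≤ ⌈exp (log n / 2)⌉₊ := by
    calc (⌈2 * log n⌉₊ : ℝ) ^ 4 ≤ (3 * log n) ^ 4 := by gcongr
      _ = 1296 * ((log n / 2) ^ 4 * 1) := by ring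
      _ = 1296 * ((log n / 2) ^ 4 * exp (-(log n / 2))) * exp (log n / 2) := by
          rw [← e]; ring
      _ ≤ 1 * exp (log n / 2) := h3
      _ ≤ _ := by rw [one_mul]; exact Nat.le_ceil _
  exact_mod_cast h4

end Asymptotics

/-! ### From the statistical model to the noise matrix -/

section Model

variable {ν : Measure ℝ} {n m : ℕ}

theorem opNorm_smul (a : ℝ) (Y : Matrix (Fin n) (Fin n) ℝ) : opNorm (a • Y) = |a| * opNorm Y := by
  simp [opNorm, norm_smul]

theorem frobeniusNorm_neg (T : Matrix (Fin n) (Fin n) ℝ) :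
    frobeniusNorm (-T) = frobeniusNorm T := by
  simp [frobeniusNorm]

theorem frobeniusNorm_add_sq_le (S T : Matrix (Fin n) (Fin n) ℝ) :
    frobeniusNorm (S + T) ^ 2 ≤ 2 * frobeniusNorm S ^ 2 + 2 * frobeniusNorm T ^ 2 := by
  simp only [frobeniusNorm_sq, Finset.mul_sum, ← Finset.sum_add_distrib]
  refine Finset.sum_le_sum fun p _ => ?_
  rw [Matrix.add_apply]
  nlinarith [sq_nonneg (S p.1 p.2 - T p.1 p.2)]

/-- The centred data matrix is a noise matrix. -/
theorem exists_isNoise (hν : ∀ η : ℝ, Integrable (fun a : ℝ => Real.exp (η * a)) ν)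
    {c K : ℝ} (hc : ∀ η t, |η| ≤ K → |t| ≤ 1 →
      ∫ a, Real.exp (t * (a - deriv (cumulant ν) η)) ∂(expFamily ν η) ≤ Real.exp (c * t ^ 2))
    {H₀ : Matrix (Fin n) (Fin n) ℝ} (hH₀ : ∀ i j, |H₀ i j| ≤ K)
    {Ω : Type*} [MeasurableSpace Ω] {μ : Measure Ω} {A : Ω → Matrix (Fin n) (Fin n) ℝ}
    (hlaw : ∀ i j, HasLaw (fun ω => A ω i j) (expFamily ν (H₀ i j)) μ)
    (hindep : iIndepFun (fun (p : Fin n × Fin n) ω => A ω p.1 p.2) μ) :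
    ∃ Z : Fin n × Fin n → Ω → ℝ, IsNoise μ c Z ∧
      ∀ᵐ ω ∂μ, noiseMatrix Z ω = A ω - H₀.map (deriv (cumulant ν)) := by
  -- The laws give only almost everywhere measurable entries; measurable modifications are used for
  -- the noise.
  let X : Fin n × Fin n → Ω → ℝ := fun p => (hlaw p.1 p.2).aemeasurable.mk _
  have hX : ∀ p, Measurable (X p) := fun p => (hlaw p.1 p.2).aemeasurable.measurable_mk
  have hXA : ∀ p : Fin n × Fin n, (fun ω => A ω p.1 p.2) =ᵐ[μ] X p := fun p =>
    (hlaw p.1 p.2).aemeasurable.ae_eq_mk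
  have hXlaw : ∀ p : Fin n × Fin n, HasLaw (X p) (expFamily ν (H₀ p.1 p.2)) μ := fun p =>
    (hlaw p.1 p.2).congr (hXA p).symm
  have hXind : iIndepFun X μ := hindep.congr hXA
  refine ⟨fun p ω => X p ω - deriv (cumulant ν) (H₀ p.1 p.2),
    ⟨fun p => (hX p).sub_const _, ?_, fun p t => ?_, fun p t ht => ?_⟩, ?_⟩
  · exact hXind.comp (fun p a => a - deriv (cumulant ν) (H₀ p.1 p.2)) (fun p => by fun_prop)
  · have h1 : Integrable (fun a => Real.exp (t * a)) (μ.map (X p)) := by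
      rw [(hXlaw p).map_eq]; exact integrable_exp_expFamily hν _ t
    have h2 := (h1.comp_aemeasurable (hX p).aemeasurable).mul_const
      (Real.exp (-(t * deriv (cumulant ν) (H₀ p.1 p.2))))
    refine h2.congr (ae_of_all _ fun ω => ?_)
    simp only [Function.comp]
    rw [← Real.exp_add]
    ring_nf
  · have h1 := (hXlaw p).integral_comp
      (f := fun a => Real.exp (t * (a - deriv (cumulant ν) (H₀ p.1 p.2)))) (by fun_prop)
    unfold mgf
    exact h1.trans_le (hc _ t (hH₀ _ _) ht)
  · have h1 : ∀ᵐ ω ∂μ, ∀ p : Fin n × Fin n, A ω p.1 p.2 = X p ω := ae_all_iff.2 hXA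
    filter_upwards [h1] with ω hω
    ext i j
    simp only [noiseMatrix, Matrix.of_apply, Matrix.sub_apply, Matrix.map_apply]
    rw [hω (i, j)]

theorem meanMatrix_eq_map (hν : ∀ η : ℝ, Integrable (fun a : ℝ => Real.exp (η * a)) ν)
    {H₀ : Matrix (Fin n) (Fin n) ℝ} {Ω : Type*} [MeasurableSpace Ω] {μ : Measure Ω}
    {A : Ω → Matrix (Fin n) (Fin n) ℝ}
    (hlaw : ∀ i j, HasLaw (fun ω => A ω i j) (expFamily ν (H₀ i j)) μ) :
    meanMatrix μ A = H₀.map (deriv (cumulant ν)) := by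
  ext i j
  simp only [meanMatrix, Matrix.of_apply, Matrix.map_apply]
  rw [(hlaw i j).integral_eq, integral_id_expFamily hν]

theorem fittedMean_sub_eq_linkDiff (x : Fin n → Fin n → EuclideanSpace ℝ (Fin m))
    (q : Matrix (Fin n) (Fin n) ℝ × EuclideanSpace ℝ (Fin m)) (H₀ : Matrix (Fin n) (Fin n) ℝ) :
    fittedMean ν x q - H₀.map (deriv (cumulant ν)) =
      linkDiff (cumulant ν) H₀ (linearPredictor x q.1 q.2) := by
  ext i j
  rfl

/-- A matrix with bounded entries and rank lies in a nuclear norm ball of radius of order `n`. -/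
theorem nuclearNorm_le_of_rank_le {r : ℕ} {Kθ : ℝ} {Θ : Matrix (Fin n) (Fin n) ℝ} (hKθ : 0 ≤ Kθ)
    (hΘ : ∀ i j, |Θ i j| ≤ Kθ) (hr : Θ.rank ≤ r) : nuclearNorm Θ ≤ √r * n * Kθ := by
  have h1 : frobeniusNorm Θ ≤ Kθ * n :=
    le_of_sq_le_sq (frobeniusNorm_sq_le_of_abs_le hΘ) (by positivity)
  have h2 : √(Θ.rank) ≤ √(r : ℝ) := Real.sqrt_le_sqrt (by exact_mod_cast hr)
  calc nuclearNorm Θ ≤ √(Θ.rank) * frobeniusNorm Θ := nuclearNorm_le_sqrt_rank Θ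
    _ ≤ √r * (Kθ * n) := by
        have := frobeniusNorm_nonneg Θ
        gcongr
    _ = _ := by ring

/-- Either the low-rank part vanishes or the radius is at least of order `n`. -/
theorem exists_radius_dichotomy (r : ℕ) {Kθ : ℝ} (hKθ : 0 ≤ Kθ) :
    ∃ c₀ : ℝ, 0 < c₀ ∧ ∀ (n : ℕ) (Θ : Matrix (Fin n) (Fin n) ℝ) (R : ℝ),
      (∀ i j, |Θ i j| ≤ Kθ) → Θ.rank ≤ r → √r * n * Kθ ≤ R → Θ = 0 ∨ c₀ * n ≤ R := by
  have h0 : 0 ≤ √r * Kθ := by positivity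
  rcases h0.eq_or_lt with h | h
  · refine ⟨1, one_pos, fun n Θ R hΘ hr hR => Or.inl ?_⟩
    have h1 := nuclearNorm_le_of_rank_le hKθ hΘ hr
    have h2 : √r * n * Kθ = 0 := by
      rw [show √r * n * Kθ = √r * Kθ * n by ring, ← h, zero_mul]
    ext i j
    have h3 := (abs_apply_le_frobeniusNorm Θ i j).trans (frobeniusNorm_le_nuclearNorm Θ)
    exact abs_nonpos_iff.1 (by linarith)
  · refine ⟨√r * Kθ, h, fun n Θ R _ _ hR => Or.inr ?_⟩
    linarith

variable {b : ℝ → ℝ} {x : Fin n → Fin n → EuclideanSpace ℝ (Fin m)} {R Kβ : ℝ}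
  {q₀ : Matrix (Fin n) (Fin n) ℝ × EuclideanSpace ℝ (Fin m)}

/-- Penalized minimizers at all integer levels, together with the spectral cuts of their
normalized scores. -/
theorem exists_penalizedMin_family (hb : Differentiable ℝ b) (hm : Monotone (deriv b))
    (hq₀ : q₀ ∈ feasible n m R Kβ) :
    ∃ (p : ℕ → Matrix (Fin n) (Fin n) ℝ × EuclideanSpace ℝ (Fin m))
      (U V : ℕ → Submodule ℝ (EuclideanSpace ℝ (Fin n))), ∀ j : ℕ, 1 ≤ j →
      IsPenalizedMin b x (linearPredictor x q₀.1 q₀.2) j Kβ (p j) ∧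
      (Module.finrank ℝ (U j) : ℝ) ≤ 4 * frobeniusNorm ((j : ℝ)⁻¹ •
        linkDiff b (linearPredictor x q₀.1 q₀.2) (linearPredictor x (p j).1 (p j).2)) ^ 2 ∧
      (Module.finrank ℝ (V j) : ℝ) ≤ 4 * frobeniusNorm ((j : ℝ)⁻¹ •
        linkDiff b (linearPredictor x q₀.1 q₀.2) (linearPredictor x (p j).1 (p j).2)) ^ 2 ∧
      ∀ u v, bilin (-((j : ℝ)⁻¹ • linkDiff b
        (linearPredictor x q₀.1 q₀.2) (linearPredictor x (p j).1 (p j).2))) u v ≤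
        ‖(U j).starProjection u‖ * ‖(V j).starProjection v‖ +
        1 / 2 * (‖u - (U j).starProjection u‖ * ‖v - (V j).starProjection v‖) := by
  have key : ∀ j : ℕ, ∃ (p : Matrix (Fin n) (Fin n) ℝ × EuclideanSpace ℝ (Fin m))
      (U V : Submodule ℝ (EuclideanSpace ℝ (Fin n))), 1 ≤ j →
      IsPenalizedMin b x (linearPredictor x q₀.1 q₀.2) j Kβ p ∧
      (Module.finrank ℝ U : ℝ) ≤ 4 * frobeniusNorm ((j : ℝ)⁻¹ •
        linkDiff b (linearPredictor x q₀.1 q₀.2) (linearPredictor x p.1 p.2)) ^ 2 ∧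
      (Module.finrank ℝ V : ℝ) ≤ 4 * frobeniusNorm ((j : ℝ)⁻¹ •
        linkDiff b (linearPredictor x q₀.1 q₀.2) (linearPredictor x p.1 p.2)) ^ 2 ∧
      ∀ u v, bilin (-((j : ℝ)⁻¹ • linkDiff b
        (linearPredictor x q₀.1 q₀.2) (linearPredictor x p.1 p.2))) u v ≤
        ‖U.starProjection u‖ * ‖V.starProjection v‖ +
        1 / 2 * (‖u - U.starProjection u‖ * ‖v - V.starProjection v‖) := fun j => by
    by_cases hj : 1 ≤ j
    · have hj0 : (0 : ℝ) < j := by exact_mod_cast hj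
      obtain ⟨p, hp⟩ := exists_isPenalizedMin (x := x) hb hm hj0 hq₀
      obtain ⟨U, V, h1, h2, h3⟩ := exists_spectral_cut (-((j : ℝ)⁻¹ • linkDiff b
        (linearPredictor x q₀.1 q₀.2) (linearPredictor x p.1 p.2))) (by
          rw [← neg_smul, opNorm_smul, abs_neg, abs_of_pos (by positivity), inv_mul_le_iff₀ hj0,
            mul_one]
          exact hp.opNorm_le hb hj0.le)
      rw [frobeniusNorm_neg] at h1 h2
      exact ⟨p, U, V, fun _ => ⟨hp, h1, h2, h3⟩⟩
    · exact ⟨0, ⊤, ⊤, fun h => absurd h hj⟩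
  choose p U V h using key
  exact ⟨p, U, V, h⟩

/-- Penalized minimizers stay at Frobenius distance of order `n` from the truth. -/
theorem IsPenalizedMin.frobeniusNorm_sub_sq_le
    {p : Matrix (Fin n) (Fin n) ℝ × EuclideanSpace ℝ (Fin m)} {l Kx CR K : ℝ}
    (hp : IsPenalizedMin b x (linearPredictor x q₀.1 q₀.2) l Kβ p) (hl : 0 < l)
    (hq₀ : q₀ ∈ feasible n m R Kβ) (hb : Differentiable ℝ b) (hm : Monotone (deriv b))
    (hx : ∀ i j, ‖x i j‖ ≤ Kx) (hKx : 0 ≤ Kx) (hKβ : 0 ≤ Kβ) (hCR : 0 ≤ CR) (hR : R ≤ CR * n)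
    (hK : 4 * CR + 4 * (Kx * Kβ) ≤ K) :
    frobeniusNorm (linearPredictor x p.1 p.2 - linearPredictor x q₀.1 q₀.2) ^ 2 ≤ (K * n) ^ 2 := by
  have h1 := hp.le q₀ hq₀.2
  rw [bregSum_self] at h1
  have h2 := bregSum_nonneg (linearPredictor x q₀.1 q₀.2) (linearPredictor x p.1 p.2) hb hm
  have h3 : nuclearNorm p.1 ≤ nuclearNorm q₀.1 := le_of_mul_le_mul_left (by linarith) hl
  have h4 : frobeniusNorm (p.1 - q₀.1) ≤ 2 * (CR * n) := by
    refine (frobeniusNorm_le_nuclearNorm _).trans ?_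
    rw [sub_eq_add_neg]
    refine (nuclearNorm_add_le _ _).trans ?_
    rw [nuclearNorm_neg]
    linarith [hq₀.1]
  have h5 : ∀ i j, |linearPredictor x 0 (p.2 - q₀.2) i j| ≤ 2 * (Kx * Kβ) := fun i j => by
    refine (abs_linearPredictor_zero_le x hx _ i j).trans ?_
    have := norm_sub_le p.2 q₀.2
    calc Kx * ‖p.2 - q₀.2‖ ≤ Kx * (2 * Kβ) := by
          gcongr
          linarith [hp.norm_le, hq₀.2]
      _ = _ := by ring
  have h6 := frobeniusNorm_sq_le_of_abs_le h5
  have h7 : frobeniusNorm (p.1 - q₀.1) ^ 2 ≤ (2 * (CR * n)) ^ 2 := by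
    have := frobeniusNorm_nonneg (p.1 - q₀.1)
    gcongr
  rw [linearPredictor_sub]
  refine (frobeniusNorm_add_sq_le _ _).trans ?_
  have hn : (0 : ℝ) ≤ n := Nat.cast_nonneg n
  calc _ ≤ 2 * (2 * (CR * n)) ^ 2 + 2 * (2 * (Kx * Kβ) * n) ^ 2 := by linarith
    _ ≤ ((4 * CR + 4 * (Kx * Kβ)) * n) ^ 2 := by
        have : 0 ≤ CR * (Kx * Kβ) := by positivity
        have : 0 ≤ n ^ 2 * (CR * (Kx * Kβ)) := by positivity
        nlinarith [sq_nonneg (CR * n), sq_nonneg (Kx * Kβ * n)]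
    _ ≤ (K * n) ^ 2 := by gcongr

end Model

/-! ### Consistency -/

section Consistency

/-- For a fixed size, the probability of a large error is at most the failure probability of the
good noise event. -/
theorem measureReal_error_le {ν : Measure ℝ}
    (hν : ∀ η : ℝ, Integrable (fun a : ℝ => Real.exp (η * a)) ν) {n m : ℕ} (hn : 0 < n)
    {Kθ Kβ Kx CR R c s w ε : ℝ} (hKθ : 0 ≤ Kθ) (hKβ : 0 ≤ Kβ) (hKx : 0 ≤ Kx) (hCR : 0 ≤ CR)
    (hc1 : 1 ≤ c) (hc : ∀ η t, |η| ≤ Kθ + Kx * Kβ → |t| ≤ 1 →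
      ∫ a, Real.exp (t * (a - deriv (cumulant ν) η)) ∂(expFamily ν η) ≤ Real.exp (c * t ^ 2))
    {x : Fin n → Fin n → EuclideanSpace ℝ (Fin m)} (hx : ∀ i j, ‖x i j‖ ≤ Kx)
    {q₀ : Matrix (Fin n) (Fin n) ℝ × EuclideanSpace ℝ (Fin m)} (hθ : ∀ i j, |q₀.1 i j| ≤ Kθ)
    (hq₀ : q₀ ∈ feasible n m R Kβ) (hR : R ≤ CR * n)
    (hs : 1 ≤ s) {L k : ℕ} {t : ℝ} (hw : 0 ≤ w) (hnw : (n : ℝ) = w ^ 4) (hL : 1 ≤ L)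
    (hnL : n * Real.exp (-L) ≤ 1) (hLk : L ^ 4 ≤ k) (hkw : (k : ℝ) ≤ 4 * w ^ 2) (hkn : k ≤ n)
    (ht : 1 ≤ t) (htw : t ≤ w)
    (hdet : ∀ (q : Matrix (Fin n) (Fin n) ℝ × EuclideanSpace ℝ (Fin m))
      (p : ℕ → Matrix (Fin n) (Fin n) ℝ × EuclideanSpace ℝ (Fin m))
      (U V : ℕ → Submodule ℝ (EuclideanSpace ℝ (Fin n))) (Z : Matrix (Fin n) (Fin n) ℝ),
      (∀ j : ℕ, 1 ≤ j →
        IsPenalizedMin (cumulant ν) x (linearPredictor x q₀.1 q₀.2) j Kβ (p j)) →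
      (∀ j : ℕ, 1 ≤ j → ∀ u v, bilin (-((j : ℝ)⁻¹ • linkDiff (cumulant ν)
        (linearPredictor x q₀.1 q₀.2) (linearPredictor x (p j).1 (p j).2))) u v ≤
        ‖(U j).starProjection u‖ * ‖(V j).starProjection v‖ +
        1 / 2 * (‖u - (U j).starProjection u‖ * ‖v - (V j).starProjection v‖)) →
      IsStationary (cumulant ν) x (linearPredictor x q₀.1 q₀.2) Z R Kβ q →
      GoodNoise (cumulant ν) x q₀ p U V (subspaceConst c)
        ((m + 1) * (s * (4 * CR + 4 * (Kx * Kβ) + Kx + Kθ + 1))) w Z →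
      frobeniusNorm (linkDiff (cumulant ν) (linearPredictor x q₀.1 q₀.2)
        (linearPredictor x q.1 q.2)) < ε * n)
    {Ω : Type*} [MeasurableSpace Ω] {μ : Measure Ω} [IsProbabilityMeasure μ]
    {A : Ω → Matrix (Fin n) (Fin n) ℝ}
    (hlaw : ∀ i j, HasLaw (fun ω => A ω i j)
      (expFamily ν (linearPredictor x q₀.1 q₀.2 i j)) μ)
    (hindep : iIndepFun (fun (p : Fin n × Fin n) ω => A ω p.1 p.2) μ)
    {q : Ω → Matrix (Fin n) (Fin n) ℝ × EuclideanSpace ℝ (Fin m)}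
    (hq : ∀ᵐ ω ∂μ, IsConstrainedMLE ν R Kβ x (A ω) (q ω)) :
    μ.real {ω | ε ≤ (n : ℝ)⁻¹ * frobeniusNorm (fittedMean ν x (q ω) - meanMatrix μ A)} ≤
      goodNoiseFail n c L k t + (m + 1) * (2 * Real.exp (c - s)) := by
  have hn0 : (0 : ℝ) < n := by exact_mod_cast hn
  have hb2 := contDiff_cumulant hν
  have hb : Differentiable ℝ (cumulant ν) := hb2.differentiable (by norm_num)
  have hm := monotone_invLink hν
  have hH₀ : ∀ i j, |linearPredictor x q₀.1 q₀.2 i j| ≤ Kθ + Kx * Kβ := fun i j =>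
    (abs_linearPredictor_le hx hKx q₀.1 hq₀.2 i j).trans (by linarith [hθ i j])
  obtain ⟨Z, hZ, hZA⟩ := exists_isNoise hν hc hH₀ hlaw hindep
  obtain ⟨p, U, V, hpUV⟩ := exists_penalizedMin_family (x := x) hb hm hq₀
  have hKxβ : 0 ≤ Kx * Kβ := by positivity
  have hK : 0 < 4 * CR + 4 * (Kx * Kβ) + Kx + Kθ + 1 := by positivity
  refine le_trans ?_ (hZ.measure_not_goodNoise_le (b := cumulant ν) (q₀ := q₀) (p := p) (U := U)
    (V := V) hc1 hn hw hnw hL hnL hLk hkw hkn ht htw hs hK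
    (fun i j => (hx i j).trans (by linarith)) (fun i j => (hθ i j).trans (by linarith))
    (fun j hj _ => (hpUV j hj).1.frobeniusNorm_sub_sq_le (by exact_mod_cast hj) hq₀ hb hm hx hKx
      hKβ hCR hR (by linarith)) (fun j hj _ => (hpUV j hj).2.1) (fun j hj _ => (hpUV j hj).2.2.1))
  -- Comparison of events up to null sets, valid for outer measure: the estimator is not assumed
  -- measurable.
  refine ENNReal.toReal_mono (measure_ne_top _ _) (measure_mono_ae ?_)
  filter_upwards [hZA, hq] with ω hω hqω hbad
  intro hgood
  have h1 := hqω.isStationary hb (linearPredictor x q₀.1 q₀.2)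
  rw [← hω] at h1
  have h2 := hdet (q ω) p U V (noiseMatrix Z ω) (fun j hj => (hpUV j hj).1)
    (fun j hj => (hpUV j hj).2.2.2) h1 hgood
  have h3 : ε ≤ (n : ℝ)⁻¹ * frobeniusNorm (fittedMean ν x (q ω) - meanMatrix μ A) := hbad
  rw [meanMatrix_eq_map hν hlaw, fittedMean_sub_eq_linkDiff, inv_mul_eq_div, le_div_iff₀ hn0] at h3
  linarith

end Consistency

end LowRankGLM

theorem theorem1
    -- the exponential family, with a cumulant function that is finite on the whole line
    (ν : Measure ℝ) (hν : ∀ η : ℝ, Integrable (fun a : ℝ => Real.exp (η * a)) ν)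
    -- constants, not depending on the number n of nodes
    (m r : ℕ) (Kθ Kβ Kx CR : ℝ)
    -- the true parameters and the covariates
    (Θ : ∀ n : ℕ, Matrix (Fin n) (Fin n) ℝ)
    (β : ℕ → EuclideanSpace ℝ (Fin m))
    (x : ∀ n : ℕ, Fin n → Fin n → EuclideanSpace ℝ (Fin m))
    (hΘmax : ∀ n i j, |Θ n i j| ≤ Kθ) (hΘrank : ∀ n, (Θ n).rank ≤ r)
    (hβ : ∀ n, ‖β n‖ ≤ Kβ)
    (hx : ∀ n i j, ‖x n i j‖ ≤ Kx)
    -- the random adjacency matrices: independent entries from the exponential family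
    {Ω : ℕ → Type*} [∀ n, MeasurableSpace (Ω n)] (μ : ∀ n, Measure (Ω n))
    [∀ n, IsProbabilityMeasure (μ n)]
    (A : ∀ n, Ω n → Matrix (Fin n) (Fin n) ℝ)
    (hlaw : ∀ n i j, HasLaw (fun ω => A n ω i j)
      (LowRankGLM.expFamily ν (LowRankGLM.linearPredictor (x n) (Θ n) (β n) i j)) (μ n))
    (hindep : ∀ n, iIndepFun (fun (p : Fin n × Fin n) ω => A n ω p.1 p.2) (μ n))
    -- the tuning parameter
    (R : ℕ → ℝ) (hR : ∀ n : ℕ, Real.sqrt r * n * Kθ ≤ R n ∧ R n ≤ CR * n)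
    -- the estimator
    (q : ∀ n, Ω n → Matrix (Fin n) (Fin n) ℝ × EuclideanSpace ℝ (Fin m))
    (hq : ∀ n, ∀ᵐ ω ∂(μ n), LowRankGLM.IsConstrainedMLE ν (R n) Kβ (x n) (A n ω) (q n ω)) :
    ∀ ε : ℝ, 0 < ε →
      Tendsto (fun n : ℕ => μ n {ω | ε ≤ (n : ℝ)⁻¹ * LowRankGLM.frobeniusNorm
        (LowRankGLM.fittedMean ν (x n) (q n ω) - LowRankGLM.meanMatrix (μ n) (A n))})
        atTop (𝓝 0) := by
  open LowRankGLM in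
  intro ε hε
  -- Signs of the constants are read off from the bounds at sizes `0` and `1`.
  have hKθ : 0 ≤ Kθ := (abs_nonneg _).trans (hΘmax 1 0 0)
  have hKβ : 0 ≤ Kβ := (norm_nonneg _).trans (hβ 0)
  have hKx : 0 ≤ Kx := (norm_nonneg _).trans (hx 1 0 0)
  have hCR : 0 ≤ CR := by
    have h1 := hR 1
    have h2 : 0 ≤ √r * ((1 : ℕ) : ℝ) * Kθ := by positivity
    have h3 := h2.trans (h1.1.trans h1.2)
    simpa using h3
  have hν0 : ν ≠ 0 := by
    rintro rfl
    -- The family over the zero measure is zero and cannot be the law of an entry under a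
    -- probability measure.
    have h1 := (hlaw 1 0 0).isProbabilityMeasure_iff.1 inferInstance
    have h2 := h1.measure_univ
    simp [expFamily] at h2
  obtain ⟨c, hc1, hc⟩ := exists_centered_mgf_bound hν hν0 (Kθ + Kx * Kβ)
  obtain ⟨c₀, hc₀, hdich⟩ := exists_radius_dichotomy r hKθ
  refine (ENNReal.tendsto_toReal_iff (fun n => measure_ne_top _ _) ENNReal.zero_ne_top).1 ?_
  rw [ENNReal.toReal_zero]
  refine tendsto_order.2 ⟨fun a ha => Eventually.of_forall fun n =>
    ha.trans_le ENNReal.toReal_nonneg, fun δ hδ => ?_⟩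
  -- The level `s` is fixed by `δ` before `n` grows; the remaining failure probability tends to
  -- zero.
  obtain ⟨s, hs1, hs⟩ : ∃ s : ℝ, 1 ≤ s ∧ ((m : ℝ) + 1) * (2 * Real.exp (c - s)) < δ / 2 := by
    have h1 : Tendsto (fun s : ℝ => ((m : ℝ) + 1) * (2 * Real.exp (c - s))) atTop
        (𝓝 (((m : ℝ) + 1) * (2 * 0))) := by
      refine ((Real.tendsto_exp_atBot.comp ?_).const_mul 2).const_mul _
      exact tendsto_atBot_add_const_left _ c tendsto_neg_atTop_atBot
    exact ((eventually_ge_atTop 1).and (h1.eventually_lt_const (by simpa using hδ))).exists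
  have hC := subspaceConst_nonneg (zero_le_one.trans hc1)
  set K := ((m : ℝ) + 1) * (s * (4 * CR + 4 * (Kx * Kβ) + Kx + Kθ + 1)) with hK
  have hK0 : 0 ≤ K := by positivity
  -- Half of `ε` is used so that the deterministic bound becomes a strict inequality.
  obtain ⟨W, hW1, hdet⟩ := exists_frobeniusNorm_linkDiff_le (contDiff_cumulant hν)
    (monotone_invLink hν) m hKθ hKβ hKx hCR hC hK0 hc₀ (half_pos hε)
  have hlog : Tendsto (fun n : ℕ => Real.log n) atTop atTop :=
    Real.tendsto_log_atTop.comp tendsto_natCast_atTop_atTop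
  have hw : Tendsto (fun n : ℕ => Real.exp (Real.log n / 4)) atTop atTop :=
    Real.tendsto_exp_atTop.comp (hlog.atTop_div_const (by norm_num))
  filter_upwards [eventually_gt_atTop 0, hlog.eventually_ge_atTop 1, hw.eventually_ge_atTop W,
    eventually_log_pow_le, (tendsto_goodNoiseFail hc1).eventually_lt_const (half_pos hδ)]
    with n hn hn1 hnW hLk hfail
  have hn0 : (0 : ℝ) < n := by exact_mod_cast hn
  set y := Real.log n with hy
  have hny : Real.exp y = n := Real.exp_log hn0
  have hnw : (n : ℝ) = Real.exp (y / 4) ^ 4 := by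
    rw [← Real.exp_nat_mul, ← hny]; ring_nf
  have hw2 : Real.exp (y / 4) ^ 2 = Real.exp (y / 2) := by
    rw [← Real.exp_nat_mul]; ring_nf
  have hfeas : (Θ n, β n) ∈ feasible n m (R n) Kβ :=
    ⟨(nuclearNorm_le_of_rank_le hKθ (hΘmax n) (hΘrank n)).trans (hR n).1, hβ n⟩
  have hceil := Nat.le_ceil (2 * y)
  have hR' := hdich n (Θ n) (R n) (hΘmax n) (hΘrank n) (hR n).1
  have h1 := measureReal_error_le hν (ε := ε) (q₀ := (Θ n, β n)) hn hKθ hKβ hKx hCR hc1 hc (hx n)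
    (hΘmax n) hfeas (hR n).2 hs1 (Real.exp_pos (y / 4)).le hnw
    (Nat.one_le_ceil_iff.2 (by linarith) : 1 ≤ ⌈2 * y⌉₊)
    (by
      rw [← hny, ← Real.exp_add, Real.exp_le_one_iff]
      linarith) hLk
    (by
      have h2 := Nat.ceil_lt_add_one (Real.exp_pos (y / 2)).le
      have h3 : 1 ≤ Real.exp (y / 2) := Real.one_le_exp (by linarith)
      rw [hw2]
      linarith)
    (Nat.ceil_le.2 (by rw [← hny]; gcongr; linarith))
    (Real.one_le_exp (by linarith : 0 ≤ y / 8))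
    (Real.exp_le_exp.2 (by linarith))
    (fun q' p U V Z hp hcut hst hgood => by
      have h2 := hdet n (x n) (Θ n, β n) q' p U V Z (R n) (Real.exp (y / 4)) hnW hnw (hx n)
        (hΘmax n) hfeas (by rw [← hnw]; exact (hR n).2) (by rw [← hnw]; exact hR') hp hcut hst hgood
      rw [← hnw] at h2
      refine h2.trans_lt ?_
      gcongr
      linarith) (hlaw n) (hindep n) (hq n)
  have h2 : goodNoiseFail n c ⌈2 * y⌉₊ ⌈Real.exp (y / 2)⌉₊ (Real.exp (y / 8)) +
      ((m : ℝ) + 1) * (2 * Real.exp (c - s)) < δ := by linarith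
  exact h1.trans_lt h2
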